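/- Let $(M,\xi)$ be a closed (compact, without boundary) connected co-oriented contact manifold of dimension $2n+1$, $n\ge 0$, i.e. $\xi=\ker\alpha$ for a smooth $1$-form $\alpha$ with $\alpha\wedge(d\alpha)^n$ nowhere vanishing, and fix such a contact form $\alpha$ (inducing the co-orientation). Let $\mathrm{Cont}_0(M)$ be the group of diffeomorphisms preserving $\xi$ that are smoothly isotopic to $\mathrm{id}_M$ through such diffeomorphisms. For a smooth isotopy of contactomorphisms $(\phi_t)_{t\in[0,1]}$ let $X_t$ be the vector field with $X_t\circ\phi_t=\frac{d}{dt}\phi_t$; the isotopy is called non-negative (positive) if $\alpha(X_t)\ge 0$ (resp. $\alpha(X_t)>0$) on $M$ for all $t\in[0,1]$. For $\phi,\psi\in\mathrm{Cont}_0(M)$ write $\phi\preccurlyeq\psi$ if there is a non-negative isotopy from $\phi$ to $\psi$, and call $\mathrm{Cont}_0(M)$ orderable if $\preccurlyeq$ is a partial order on $\mathrm{Cont}_0(M)$. Define $\tau_\alpha:\mathrm{Cont}_0(M)\times\mathrm{Cont}_0(M)\to[0,\infty]$ by $$\tau_\alpha(\phi,\psi)=\sup\int_0^1\min_M\alpha(X_t)\,dt\quad\text{if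 }\phi\preccurlyeq\psi,\qquad \tau_\alpha(\phi,\psi)=0\quad\text{otherwise},$$ the supremum being over all non-negative isotopies $(\phi_t)_{t\in[0,1]}$ of contactomorphisms with $\phi_0=\phi$ and $\phi_1=\psi$. Then the following are equivalent: 1. $\mathrm{Cont}_0(M)$ is orderable; 2. every non-negative isotopy of contactomorphisms from $\mathrm{id}_M$ to $\mathrm{id}_M$ is constant; 3. there is no positive isotopy of contactomorphisms from $\mathrm{id}_M$ to $\mathrm{id}_M$; 4. $\tau_\alpha(\phi,\psi)<\infty$ for all $\phi,\psi\in\mathrm{Cont}_0(M)$. Moreover the Reeb flow $(\phi^\alpha_t)_{t\in\mathbb R}$ of $\alpha$, i.e. the flow of the vector field $R$ with $\alpha(R)=1$ and $d\alpha(R,\cdot)=0$, exists and lies in $\mathrm{Cont}_0(M)$, and if $\mathrm{Cont}_0(M)$ is orderable, then $$\tau_\alpha(\phi,\phi^\alpha_t\circ\phi)=t\qquad\text{for all } t\ge 0\text{ and all }\phi\in\mathrm{Cont}_0(M).$$ -/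

import Mathlib

open Set Manifold
open scoped ContDiff

namespace ContactGeometry

noncomputable section

/-- The model space `ℝ ^ (2 n + 1)`. -/
abbrev Model (n : ℕ) : Type := EuclideanSpace ℝ (Fin (2 * n + 1))

section FormsAndContactomorphisms

variable {n : ℕ} {M : Type*} [TopologicalSpace M] [ChartedSpace (Model n) M]

/-- A (not necessarily continuous) distribution of tangent subspaces on `M`. -/
abbrev Distribution (n : ℕ) (M : Type*) [TopologicalSpace M] [ChartedSpace (Model n) M] :=
  (x : M) → Submodule ℝ (TangentSpace (𝓡 (2 * n + 1)) x)

/-- A (not necessarily continuous) `1`-form on `M`. -/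
abbrev OneForm (n : ℕ) (M : Type*) [TopologicalSpace M] [ChartedSpace (Model n) M] :=
  (x : M) → TangentSpace (𝓡 (2 * n + 1)) x →L[ℝ] ℝ

/-- A `1`-form is smooth: it is a smooth section of the cotangent bundle. -/
def SmoothOneForm [IsManifold (𝓡 (2 * n + 1)) ∞ M] (α : OneForm n M) : Prop :=
  ContMDiff (𝓡 (2 * n + 1)) ((𝓡 (2 * n + 1)).prod 𝓘(ℝ, Model n →L[ℝ] ℝ)) ∞
    (fun x ↦ (Bundle.TotalSpace.mk' (Model n →L[ℝ] ℝ) x (α x) :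
      Bundle.TotalSpace (Model n →L[ℝ] ℝ)
        (fun y : M ↦ TangentSpace (𝓡 (2 * n + 1)) y →L[ℝ] Bundle.Trivial M ℝ y)))

/-- The `1`-form `α` written in the preferred chart at `x`, that is, its pullback by the inverse of
that chart. It is a `1`-form on the target of the chart, an open subset of the model space. -/
def OneForm.inChart (α : OneForm n M) (x : M) (y : Model n) : Model n →L[ℝ] ℝ :=
  (α ((extChartAt (𝓡 (2 * n + 1)) x).symm y)).comp
    (mfderiv 𝓘(ℝ, Model n) (𝓡 (2 * n + 1)) (extChartAt (𝓡 (2 * n + 1)) x).symm y)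

/-- The exterior derivative `dα` of a `1`-form, computed in the preferred chart at each point. -/
def OneForm.d (α : OneForm n M) (x : M) (u v : TangentSpace (𝓡 (2 * n + 1)) x) : ℝ :=
  extDeriv (fun y : Model n ↦
      ContinuousAlternatingMap.ofSubsingleton ℝ (Model n) ℝ (0 : Fin 1) (α.inChart x y))
    (extChartAt (𝓡 (2 * n + 1)) x x)
    ![mfderiv (𝓡 (2 * n + 1)) 𝓘(ℝ, Model n) (extChartAt (𝓡 (2 * n + 1)) x) x u,
      mfderiv (𝓡 (2 * n + 1)) 𝓘(ℝ, Model n) (extChartAt (𝓡 (2 * n + 1)) x) x v]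

/-- The value of the top degree form `α ∧ (dα)^n` on `2 n + 1` tangent vectors at `x`, i.e.
`1 / (1! (2!)^n) ∑_σ sign(σ) α(v_σ(0)) dα(v_σ(1), v_σ(2)) ⋯ dα(v_σ(2n-1), v_σ(2n))`. -/
def OneForm.wedgePow (α : OneForm n M) (x : M)
    (v : Fin (2 * n + 1) → TangentSpace (𝓡 (2 * n + 1)) x) : ℝ :=
  (1 / 2 ^ n : ℝ) * ∑ σ : Equiv.Perm (Fin (2 * n + 1)),
    ((Equiv.Perm.sign σ : ℤ) : ℝ) * (α x (v (σ 0)) *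
      ∏ i : Fin n, α.d x (v (σ ⟨2 * i + 1, by omega⟩)) (v (σ ⟨2 * i + 2, by omega⟩)))

/-- `α` is a contact form of the distribution `ξ`: it is smooth, its kernel is `ξ`, and
`α ∧ (dα)^n` vanishes nowhere. In particular `ξ` is a co-oriented contact structure. -/
structure IsContactForm [IsManifold (𝓡 (2 * n + 1)) ∞ M] (ξ : Distribution n M)
    (α : OneForm n M) : Prop where
  smooth : SmoothOneForm α
  ker_eq : ∀ x, LinearMap.ker (α x).toLinearMap = ξ x
  wedge_ne_zero : ∀ x, ∃ v, α.wedgePow x v ≠ 0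

/-- The group `Cont(M, ξ)` of contactomorphisms: diffeomorphisms `φ` with `dφ(ξ) = ξ`. -/
def Cont [IsManifold (𝓡 (2 * n + 1)) ∞ M] (ξ : Distribution n M) : Subgroup (Equiv.Perm M) where
  carrier := {φ | ContMDiff (𝓡 (2 * n + 1)) (𝓡 (2 * n + 1)) ∞ φ ∧
    ContMDiff (𝓡 (2 * n + 1)) (𝓡 (2 * n + 1)) ∞ φ.symm ∧
    ∀ x, (ξ x).map (mfderiv (𝓡 (2 * n + 1)) (𝓡 (2 * n + 1)) φ x).toLinearMap = ξ (φ x)}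
  one_mem' := by
    refine ⟨contMDiff_id, contMDiff_id, fun x ↦ ?_⟩
    have h : mfderiv (𝓡 (2 * n + 1)) (𝓡 (2 * n + 1)) (⇑(1 : Equiv.Perm M)) x
        = ContinuousLinearMap.id ℝ (TangentSpace (𝓡 (2 * n + 1)) x) := mfderiv_id
    rw [h]
    exact Submodule.map_id _
  mul_mem' := by
    rintro φ ψ ⟨h1, h2, h3⟩ ⟨k1, k2, k3⟩
    refine ⟨h1.comp k1, k2.comp h2, fun x ↦ ?_⟩
    have h : mfderiv (𝓡 (2 * n + 1)) (𝓡 (2 * n + 1)) (⇑(φ * ψ)) x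
        = (mfderiv (𝓡 (2 * n + 1)) (𝓡 (2 * n + 1)) φ (ψ x)).comp
          (mfderiv (𝓡 (2 * n + 1)) (𝓡 (2 * n + 1)) ψ x) :=
      mfderiv_comp x (h1.mdifferentiableAt (by simp)) (k1.mdifferentiableAt (by simp))
    rw [h]
    calc _ = ((ξ x).map (mfderiv (𝓡 (2 * n + 1)) (𝓡 (2 * n + 1)) ψ x).toLinearMap).map
          (mfderiv (𝓡 (2 * n + 1)) (𝓡 (2 * n + 1)) φ (ψ x)).toLinearMap :=
          Submodule.map_comp _ _ _
      _ = _ := by rw [k3, h3]; rfl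
  inv_mem' := by
    rintro φ ⟨h1, h2, h3⟩
    refine ⟨h2, h1, fun x ↦ ?_⟩
    obtain ⟨y, rfl⟩ := φ.surjective x
    have hc : (mfderiv (𝓡 (2 * n + 1)) (𝓡 (2 * n + 1)) φ.symm (φ y)).comp
        (mfderiv (𝓡 (2 * n + 1)) (𝓡 (2 * n + 1)) φ y)
        = ContinuousLinearMap.id ℝ (TangentSpace (𝓡 (2 * n + 1)) y) := by
      have e : (φ.symm ∘ φ : M → M) = id := by ext; simp
      refine (mfderiv_comp (I' := 𝓡 (2 * n + 1)) y (h2.mdifferentiableAt (by simp))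
        (h1.mdifferentiableAt (by simp))).symm.trans ?_
      rw [e]; exact mfderiv_id
    have e2 : φ.symm (φ y) = y := by simp
    change (ξ (φ y)).map (mfderiv (𝓡 (2 * n + 1)) (𝓡 (2 * n + 1)) φ.symm (φ y)).toLinearMap
      = ξ (φ.symm (φ y))
    have e3 : ξ (φ.symm (φ y)) = ξ y := by rw [e2]
    rw [e3, ← h3 y]
    refine (Submodule.map_comp _ _ _).symm.trans ?_
    have hc' : (mfderiv (𝓡 (2 * n + 1)) (𝓡 (2 * n + 1)) φ.symm (φ y)).toLinearMap.comp
        (mfderiv (𝓡 (2 * n + 1)) (𝓡 (2 * n + 1)) φ y).toLinearMap = LinearMap.id :=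
      congrArg ContinuousLinearMap.toLinearMap hc
    rw [hc']
    exact Submodule.map_id _

/-- `γ`, restricted to times in `[0, 1]`, is a smooth isotopy through contactomorphisms. -/
structure IsContactIsotopy [IsManifold (𝓡 (2 * n + 1)) ∞ M] (ξ : Distribution n M)
    (γ : ℝ → Equiv.Perm M) : Prop where
  smooth : ContMDiffOn (𝓘(ℝ, ℝ).prod (𝓡 (2 * n + 1))) (𝓡 (2 * n + 1)) ∞
    (fun p : ℝ × M ↦ γ p.1 p.2) (Icc 0 1 ×ˢ univ)
  mem : ∀ t ∈ Icc (0 : ℝ) 1, γ t ∈ Cont ξ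

/-- The identity component `Cont₀(M, ξ)`: contactomorphisms that are isotopic to the identity
through contactomorphisms. -/
def Cont₀ [IsManifold (𝓡 (2 * n + 1)) ∞ M] (ξ : Distribution n M) : Subgroup (Equiv.Perm M) where
  carrier := {φ | ∃ γ : ℝ → Equiv.Perm M, IsContactIsotopy ξ γ ∧ γ 0 = 1 ∧ γ 1 = φ}
  one_mem' := ⟨fun _ ↦ 1, ⟨contMDiffOn_snd, fun _ _ ↦ one_mem _⟩, rfl, rfl⟩
  mul_mem' := by
    rintro φ ψ ⟨γ, hγ, h0, h1⟩ ⟨δ, hδ, k0, k1⟩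
    refine ⟨fun t ↦ γ t * δ t, ⟨?_, fun t ht ↦ mul_mem (hγ.mem t ht) (hδ.mem t ht)⟩,
      by simp [h0, k0], by simp [h1, k1]⟩
    exact hγ.smooth.comp (contMDiffOn_fst.prodMk hδ.smooth) (fun p hp ↦ ⟨hp.1, mem_univ _⟩)
  inv_mem' := by
    rintro φ ⟨γ, hγ, h0, h1⟩
    have hφ : φ ∈ Cont ξ := h1 ▸ hγ.mem 1 (by simp)
    have hI : ∀ t ∈ Icc (0 : ℝ) 1, 1 - t ∈ Icc (0 : ℝ) 1 :=
      fun t ht ↦ ⟨by linarith [ht.2], by linarith [ht.1]⟩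
    refine ⟨fun t ↦ γ (1 - t) * φ⁻¹,
      ⟨?_, fun t ht ↦ mul_mem (hγ.mem _ (hI t ht)) (inv_mem hφ)⟩, by simp [h1], by simp [h0]⟩
    have hs : ContMDiff 𝓘(ℝ, ℝ) 𝓘(ℝ, ℝ) ∞ (fun t : ℝ ↦ 1 - t) :=
      (contDiff_const.sub contDiff_id).contMDiff
    exact hγ.smooth.comp
      (t := Icc 0 1 ×ˢ univ) (f := fun p : ℝ × M ↦ ((1 - p.1, φ.symm p.2) : ℝ × M))
      ((hs.comp contMDiff_fst).prodMk (hφ.2.1.comp contMDiff_snd)).contMDiffOn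
      (fun p hp ↦ ⟨hI _ hp.1, mem_univ _⟩)

/-- The number `α(X_t)` at the point `γ_t(x)`, where `X_t ∘ γ_t = d/dt γ_t` (one-sided derivatives
at `t = 0` and `t = 1`). As `γ_t` is a bijection, its range over all `x` is the range of the
function `α(X_t)` on `M`. -/
def hamiltonian (α : OneForm n M) (γ : ℝ → Equiv.Perm M) (t : ℝ) (x : M) : ℝ :=
  α (γ t x) (mfderivWithin 𝓘(ℝ, ℝ) (𝓡 (2 * n + 1)) (fun s : ℝ ↦ γ s x) (Icc 0 1) t (1 : ℝ))

/-- The integral over `[0, 1]` of `min_M α(X_t)`. -/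
def lorentzLength (α : OneForm n M) (γ : ℝ → Equiv.Perm M) : ℝ :=
  ∫ t in (0 : ℝ)..1, ⨅ x : M, hamiltonian α γ t x

variable [IsManifold (𝓡 (2 * n + 1)) ∞ M]

/-- `γ` is a non-negative isotopy of contactomorphisms from `φ` to `ψ`. -/
structure IsNonnegPath (ξ : Distribution n M) (α : OneForm n M) (φ ψ : Equiv.Perm M)
    (γ : ℝ → Equiv.Perm M) : Prop where
  isotopy : IsContactIsotopy ξ γ
  source : γ 0 = φ
  target : γ 1 = ψ
  nonneg : ∀ t ∈ Icc (0 : ℝ) 1, ∀ x, 0 ≤ hamiltonian α γ t x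

/-- `γ` is a positive isotopy of contactomorphisms from `φ` to `ψ`. -/
structure IsPosPath (ξ : Distribution n M) (α : OneForm n M) (φ ψ : Equiv.Perm M)
    (γ : ℝ → Equiv.Perm M) : Prop where
  isotopy : IsContactIsotopy ξ γ
  source : γ 0 = φ
  target : γ 1 = ψ
  pos : ∀ t ∈ Icc (0 : ℝ) 1, ∀ x, 0 < hamiltonian α γ t x

/-- The relation `φ ≼ ψ` on `Cont₀(M, ξ)`. -/
def NonnegRel (ξ : Distribution n M) (α : OneForm n M) (φ ψ : Cont₀ ξ) : Prop :=
  ∃ γ, IsNonnegPath ξ α φ ψ γ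

/-- `Cont₀(M, ξ)` is orderable: the relation `≼` is a partial order on it. -/
def Orderable (ξ : Distribution n M) (α : OneForm n M) : Prop :=
  IsPartialOrder (Cont₀ ξ) (NonnegRel ξ α)

open Classical in
/-- The Lorentzian distance function `τ_α` on `Cont₀(M, ξ)`. -/
def lorentzDist (ξ : Distribution n M) (α : OneForm n M) (φ ψ : Cont₀ ξ) : ENNReal :=
  if NonnegRel ξ α φ ψ then
    ⨆ γ ∈ {γ : ℝ → Equiv.Perm M | IsNonnegPath ξ α φ ψ γ}, ENNReal.ofReal (lorentzLength α γ)
  else 0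

/-- `θ` is the Reeb flow of `α`, i.e. the flow of the vector field `R` with `α(R) = 1` and
`dα(R, ·) = 0`. -/
def IsReebFlow (ξ : Distribution n M) (α : OneForm n M) (θ : ℝ → Cont₀ ξ) : Prop :=
  ∃ R : (x : M) → TangentSpace (𝓡 (2 * n + 1)) x,
    (∀ x, α x (R x) = 1 ∧ ∀ v, α.d x (R x) v = 0) ∧ θ 0 = 1 ∧
      ∀ x, IsMIntegralCurve (I := 𝓡 (2 * n + 1)) (fun t : ℝ ↦ (θ t : Equiv.Perm M) x) R

end FormsAndContactomorphisms

end

end ContactGeometry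

/-! Write `H` for the function `α(X_t)` along an isotopy. Two facts about Hamiltonians drive
everything. An element of `Cont₀ ξ` pulls `α` back to a positive multiple of `α`, so the pointwise
product of two isotopies has Hamiltonian `H_Γ + l * H_Δ` with `l > 0` (`IsContactForm.ham_mul`). And
an isotopy with `H = 0` is constant, because `dα` is nondegenerate on `ξ`
(`IsContactForm.eq_of_ham_eq_zero`).

Orderability versus constant loops. A nonnegative loop cut at time `s` gives `1 ≼ γ s ≼ 1`, so
antisymmetry makes it constant. Conversely, reflexivity comes from constant paths and transitivity
from products of paths. If `φ ≼ ψ ≼ φ`, the product of the two paths is a nonnegative loop up to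
translation. When it is constant, its Hamiltonian is a vanishing sum of nonnegative terms, so both
paths are constant.

From nonconstant to positive loops (the argument of Eliashberg and Polterovich). A nonconstant
nonnegative loop has `H > 0` somewhere. Restarting the loop at another time and conjugating it moves
this point to any point of `M` at time `0`, since `Cont₀ ξ` acts transitively
(`IsContactForm.exists_cont₀_apply_eq`). Products add positivity, so compactness of `M` yields a
loop positive on all of `M` at time `0`, and compactness of `[0, 1]` one that is positive always
(`IsNonnegLoop.exists_pos`). A positive loop traversed `k` times has length at least `k * min H`,
whence `τ_α(1, 1) = ∞`.

Finiteness of `τ_α` in the orderable case (`Orderable.lorentzLength_le`). Suppose `γ` from `φ` to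
`ψ` has length greater than `C`, while some `δ` from `ψ` back to `φ` has Hamiltonian at least `-C`.
The Reeb flow `θ` preserves `α`, so multiplication by `θ (u t)` on the left changes the Hamiltonian
by exactly `u'`. Composing `γ` with the backward Reeb flow, at a speed below the minimum of `H`,
gives a nonnegative path to `θ (-S) * ψ` with `S > C`. Composing `δ` with the forward Reeb flow at
speed `S` gives a positive path back to `φ`. By antisymmetry the endpoints agree, so the second path
yields a positive loop, which is impossible. The same bound, with `δ` the reversed Reeb path, gives
`τ_α(φ, θ t * φ) ≤ t`; the Reeb path itself gives the reverse inequality.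

The analysis underneath consists of smooth flows on closed manifolds, chart invariance of `dα`, and
the construction of a contact vector field from its Hamiltonian. The last of these gives
transitivity. -/

namespace ContactGeometry

/-! ### Smoothness of postcomposition on spaces of continuous curves. -/

section Postcomposition

universe u

variable {K : Type*} [TopologicalSpace K] [CompactSpace K]

/-- Pointwise application of a family of continuous linear maps to a family of vectors. -/
noncomputable def applyCM (K : Type*) [TopologicalSpace K] [CompactSpace K]
    (E F : Type*) [NormedAddCommGroup E] [NormedSpace ℝ E]
    [NormedAddCommGroup F] [NormedSpace ℝ F] :
    C(K, E →L[ℝ] F) →L[ℝ] C(K, E) →L[ℝ] C(K, F) :=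
  LinearMap.mkContinuous₂
    (LinearMap.mk₂ ℝ (fun (A : C(K, E →L[ℝ] F)) (v : C(K, E)) ↦
        (⟨fun k ↦ A k (v k), A.continuous.clm_apply v.continuous⟩ : C(K, F)))
      (fun _ _ _ ↦ by ext; simp) (fun _ _ _ ↦ by ext; simp)
      (fun _ _ _ ↦ by ext; simp) (fun _ _ _ ↦ by ext; simp)) 1 (fun A v ↦ by
        rw [one_mul, ContinuousMap.norm_le _ (by positivity)]
        intro k
        refine (ContinuousLinearMap.le_opNorm (A k) (v k)).trans ?_
        gcongr
        exacts [A.norm_coe_le_norm k, v.norm_coe_le_norm k])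

@[simp] lemma applyCM_apply {E F : Type*} [NormedAddCommGroup E] [NormedSpace ℝ E]
    [NormedAddCommGroup F] [NormedSpace ℝ F] (A : C(K, E →L[ℝ] F)) (v : C(K, E)) (k : K) :
    applyCM K E F A v k = A k (v k) := rfl

/-- Postcomposition with a continuously differentiable map is differentiable. -/
lemma hasFDerivAt_postcomp {E F : Type*} [NormedAddCommGroup E] [NormedSpace ℝ E]
    [NormedAddCommGroup F] [NormedSpace ℝ F] (f : C(E, F)) (f' : C(E, E →L[ℝ] F))
    (hf : ∀ x, HasFDerivAt f (f' x) x) (γ : C(K, E)) :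
    HasFDerivAt (fun γ : C(K, E) ↦ f.comp γ) (applyCM K E F (f'.comp γ)) γ := by
  rw [hasFDerivAt_iff_isLittleO_nhds_zero, Asymptotics.isLittleO_iff]
  intro c hc
  -- In the sup norms this says that `f'` near the curve `γ` is close to its values on `γ`,
  -- uniformly over `K`. The mean value inequality on each segment then gives a bound independent of
  -- `k`.
  have hcont : ContinuousAt (fun g : C(K, E) ↦ f'.comp g) γ :=
    (ContinuousMap.continuous_postcomp f').continuousAt
  obtain ⟨δ, hδ, H⟩ := (Metric.continuousAt_iff (α := C(K, E)) (β := C(K, E →L[ℝ] F))).1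
    hcont c hc
  filter_upwards [Metric.ball_mem_nhds (0 : C(K, E)) hδ] with h hh
  rw [mem_ball_zero_iff] at hh
  rw [ContinuousMap.norm_le _ (by positivity)]
  intro k
  have hseg : ∀ x ∈ segment ℝ (γ k) (γ k + h k), ‖f' x - f' (γ k)‖ ≤ c := by
    intro x hx
    rw [segment_eq_image'] at hx
    obtain ⟨s, hs, rfl⟩ := hx
    have h1 : dist (γ + s • h) γ < δ := by
      rw [dist_eq_norm, add_sub_cancel_left, norm_smul, Real.norm_eq_abs, abs_of_nonneg hs.1]
      calc s * ‖h‖ ≤ 1 * ‖h‖ := by gcongr; exact hs.2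
        _ < δ := by rwa [one_mul]
    have h2 := (ContinuousMap.dist_lt_iff hc).1 (H h1) k
    rw [dist_eq_norm] at h2
    simpa using h2.le
  have := (convex_segment (γ k) (γ k + h k)).norm_image_sub_le_of_norm_hasFDerivWithin_le'
    (fun x _ ↦ (hf x).hasFDerivWithinAt) hseg (left_mem_segment ℝ _ _) (right_mem_segment ℝ _ _)
  rw [add_sub_cancel_left] at this
  calc _ ≤ c * ‖h k‖ := by simpa using this
    _ ≤ c * ‖h‖ := by gcongr; exact h.norm_coe_le_norm k

/-- Postcomposition with a smooth map is smooth. -/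
lemma contDiff_postcomp_nat (n : ℕ) : ∀ {E F : Type u} [NormedAddCommGroup E] [NormedSpace ℝ E]
    [NormedAddCommGroup F] [NormedSpace ℝ F] (f : C(E, F)), ContDiff ℝ n f →
    ContDiff ℝ n (fun γ : C(K, E) ↦ f.comp γ) := by
  -- The derivative is again a postcomposition, now with `fderiv ℝ f`, followed by a continuous
  -- linear map. The induction thus changes `F` into `E →L[ℝ] F`, so the spaces are quantified
  -- inside it and share a universe.
  induction n with
  | zero =>
    intro E F _ _ _ _ f _
    exact contDiff_zero.2 (ContinuousMap.continuous_postcomp f)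
  | succ n ih =>
    intro E F _ _ _ _ f hf
    have hf' := (contDiff_succ_iff_fderiv (𝕜 := ℝ) (n := n)).1 (by exact_mod_cast hf)
    let f' : C(E, E →L[ℝ] F) := ⟨fderiv ℝ f, hf'.2.2.continuous⟩
    have hd := fun γ : C(K, E) ↦
      hasFDerivAt_postcomp f f' (fun x ↦ (hf'.1 x).hasFDerivAt) γ
    have := (contDiff_succ_iff_fderiv (𝕜 := ℝ) (n := n)
      (f := fun γ : C(K, E) ↦ f.comp γ)).2 ⟨fun γ ↦ (hd γ).differentiableAt, by simp, by
        rw [funext fun γ ↦ (hd γ).fderiv]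
        exact (applyCM K E F).contDiff.comp (ih f' hf'.2.2)⟩
    exact_mod_cast this

lemma contDiff_postcomp {E F : Type u} [NormedAddCommGroup E] [NormedSpace ℝ E]
    [NormedAddCommGroup F] [NormedSpace ℝ F] (f : C(E, F)) (hf : ContDiff ℝ ∞ f) :
    ContDiff ℝ ∞ (fun γ : C(K, E) ↦ f.comp γ) :=
  contDiff_infty.2 fun n ↦ contDiff_postcomp_nat n f (hf.of_le (by exact_mod_cast le_top))

end Postcomposition

/-! ### Smooth dependence of solutions of an ODE on a normed space. -/

section LocalFlow

open MeasureTheory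

variable {E : Type*} [NormedAddCommGroup E] [NormedSpace ℝ E] [CompleteSpace E]

/-- The primitive vanishing at `0` of a continuous function on `[-2, 2]`. -/
noncomputable def primitiveCM (E : Type*) [NormedAddCommGroup E] [NormedSpace ℝ E]
    [CompleteSpace E] : C(Icc (-2 : ℝ) 2, E) →L[ℝ] C(Icc (-2 : ℝ) 2, E) :=
  LinearMap.mkContinuous
    { toFun := fun g ↦ ⟨fun t ↦ ∫ τ in (0 : ℝ)..t, IccExtend (by norm_num) g τ, by
        have hg : Continuous (IccExtend (by norm_num : (-2 : ℝ) ≤ 2) g) :=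
          g.continuous.Icc_extend'
        exact (intervalIntegral.continuous_primitive
          (fun a b ↦ hg.intervalIntegrable a b) 0).comp continuous_subtype_val⟩
      map_add' := fun g h ↦ by
        ext t
        have hg : Continuous (IccExtend (by norm_num : (-2 : ℝ) ≤ 2) g) :=
          g.continuous.Icc_extend'
        have hh : Continuous (IccExtend (by norm_num : (-2 : ℝ) ≤ 2) h) :=
          h.continuous.Icc_extend'
        exact intervalIntegral.integral_add (hg.intervalIntegrable _ _)
          (hh.intervalIntegrable _ _)
      map_smul' := fun c g ↦ by
        ext t
        exact intervalIntegral.integral_smul c _ } 2 (fun g ↦ by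
      rw [ContinuousMap.norm_le _ (by positivity)]
      intro t
      have := intervalIntegral.norm_integral_le_of_norm_le_const (a := 0) (b := (t : ℝ))
        (f := IccExtend (by norm_num : (-2 : ℝ) ≤ 2) g) (C := ‖g‖)
        (fun x _ ↦ g.norm_coe_le_norm _)
      refine this.trans ?_
      rw [sub_zero, mul_comm]
      gcongr
      exact abs_le.2 t.2)

/-- Constant functions, as a continuous linear map. -/
noncomputable def constCM (K : Type*) [TopologicalSpace K] [CompactSpace K]
    (E : Type*) [NormedAddCommGroup E] [NormedSpace ℝ E] : E →L[ℝ] C(K, E) :=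
  LinearMap.mkContinuous
    { toFun := fun x ↦ ContinuousMap.const K x
      map_add' := fun _ _ ↦ rfl
      map_smul' := fun _ _ ↦ rfl } 1 (fun x ↦ by
      rw [one_mul, ContinuousMap.norm_le _ (by positivity)]
      intro t
      rfl)

/-- For a smooth vector field `V`, the solutions of `c' = s V(c)`, `c(0) = x` on `[-2, 2]` form a
smooth family for `(s, x)` close to `(0, x₀)`. -/
theorem exists_contDiffAt_integralCurves {E : Type u} [NormedAddCommGroup E] [NormedSpace ℝ E]
    [CompleteSpace E] (V : E → E) (hV : ContDiff ℝ ∞ V) (x₀ : E) :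
    ∃ G : ℝ × E → C(Icc (-2 : ℝ) 2, E), ContDiffAt ℝ ∞ G (0, x₀) ∧
      G (0, x₀) = ContinuousMap.const _ x₀ ∧
      ∀ᶠ p in nhds ((0 : ℝ), x₀), G p ⟨0, by norm_num⟩ = p.2 ∧
        ∀ t : ℝ, ∀ ht : t ∈ Ioo (-2 : ℝ) 2,
          HasDerivAt (IccExtend (by norm_num : (-2 : ℝ) ≤ 2) (G p))
            (p.1 • V (G p ⟨t, Ioo_subset_Icc_self ht⟩)) t := by
  let B := C(Icc (-2 : ℝ) 2, E)
  let Vc : C(E, E) := ⟨V, hV.continuous⟩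
  let N : B → B := fun g ↦ primitiveCM E (Vc.comp g)
  have hN : ContDiff ℝ ∞ N := (primitiveCM E).contDiff.comp (contDiff_postcomp Vc hV)
  -- The second component vanishes exactly on solutions of Picard's integral equation. At `s = 0`
  -- the solution is constant and the derivative of `Φ` is a shear, since `s • N g` contributes only
  -- through `ds`. The inverse function theorem therefore solves the equation smoothly. Scaling the
  -- field by `s` keeps the interval fixed: the value at time `1` is the flow for time `s`.
  let Φ : (ℝ × E) × B → (ℝ × E) × B := fun p ↦ (p.1, p.2 - constCM _ E p.1.2 - p.1.1 • N p.2)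
  have hΦ : ContDiff ℝ ∞ Φ := by
    refine contDiff_fst.prodMk ((contDiff_snd.sub ?_).sub ?_)
    · exact (ContinuousLinearMap.contDiff (F := B) (constCM _ E)).comp (contDiff_snd.comp contDiff_fst)
    · exact (contDiff_fst.comp contDiff_fst).smul (hN.comp contDiff_snd)
  let p₀ : (ℝ × E) × B := ((0, x₀), constCM _ E x₀)
  let n₀ : B := N (constCM _ E x₀)
  let shear : (ℝ × E) →L[ℝ] B := (constCM _ E).comp (ContinuousLinearMap.snd ℝ ℝ E) +
    (ContinuousLinearMap.fst ℝ ℝ E).smulRight n₀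
  let Φ' : ((ℝ × E) × B) ≃L[ℝ] (ℝ × E) × B :=
    ContinuousLinearEquiv.equivOfInverse
      ((ContinuousLinearMap.fst ℝ (ℝ × E) B).prod
        (ContinuousLinearMap.snd ℝ (ℝ × E) B - shear.comp (ContinuousLinearMap.fst ℝ (ℝ × E) B)))
      ((ContinuousLinearMap.fst ℝ (ℝ × E) B).prod
        (ContinuousLinearMap.snd ℝ (ℝ × E) B + shear.comp (ContinuousLinearMap.fst ℝ (ℝ × E) B)))
      (fun p ↦ by ext <;> simp) (fun p ↦ by ext <;> simp)
  have hΦ' : HasFDerivAt Φ (Φ' : ((ℝ × E) × B) →L[ℝ] (ℝ × E) × B) p₀ := by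
    have h1 : HasFDerivAt (fun p : (ℝ × E) × B ↦ p.1.1 • N p.2) _ p₀ :=
      ((hasFDerivAt_fst (𝕜 := ℝ) (p := p₀)).fst).smul
        (((hN.differentiable (by simp)) (p₀.2)).hasFDerivAt.comp p₀ hasFDerivAt_snd)
    have h2 : HasFDerivAt (fun p : (ℝ × E) × B ↦ constCM (Icc (-2 : ℝ) 2) E p.1.2) _ p₀ :=
      (constCM _ E).hasFDerivAt.comp p₀ ((hasFDerivAt_fst (𝕜 := ℝ) (p := p₀)).snd)
    refine (hasFDerivAt_fst.prodMk ((hasFDerivAt_snd.sub h2).sub h1)).congr_fderiv ?_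
    refine ContinuousLinearMap.ext fun q ↦ Prod.ext (by simp [Φ']) ?_
    simp [Φ', shear, p₀, n₀, sub_sub]
  have hΦat : ContDiffAt ℝ ∞ Φ p₀ := hΦ.contDiffAt
  let Ψ := hΦat.localInverse hΦ' (by simp)
  have hΨ : ContDiffAt ℝ ∞ Ψ (Φ p₀) := hΦat.to_localInverse hΦ' (by simp)
  have hp₀ : Φ p₀ = ((0, x₀), 0) := by simp [Φ, p₀]
  have hΨ0 : Ψ (Φ p₀) = p₀ := hΦat.localInverse_apply_image hΦ' (by simp)
  have hright : ∀ᶠ q in nhds (Φ p₀), Φ (Ψ q) = q :=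
    (hΦat.hasStrictFDerivAt' hΦ' (by simp)).eventually_right_inverse
  rw [hp₀] at hΨ hΨ0 hright
  have hins : ContDiff ℝ ∞ (fun p : ℝ × E ↦ ((p, 0) : (ℝ × E) × B)) :=
    contDiff_id.prodMk contDiff_const
  refine ⟨fun p ↦ (Ψ (p, 0)).2, ?_, ?_, ?_⟩
  · exact contDiffAt_snd.comp _ (hΨ.comp ((0 : ℝ), x₀) hins.contDiffAt)
  · simp only [hΨ0, p₀]; rfl
  · have := (hins.continuous.continuousAt (x := ((0 : ℝ), x₀))).eventually hright
    filter_upwards [this] with p hp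
    set γ : B := (Ψ (p, 0)).2 with hγ
    have h1 : (Ψ (p, 0)).1 = p := congrArg Prod.fst hp
    have h2 : γ - constCM _ E p.2 - p.1 • N γ = 0 := by
      have := congrArg Prod.snd hp
      simpa only [Φ, h1] using this
    have h3 : ∀ t, γ t = p.2 + p.1 • ∫ τ in (0 : ℝ)..t, IccExtend (by norm_num) (Vc.comp γ) τ := by
      intro t
      have h4 : γ = constCM _ E p.2 + p.1 • N γ := by
        rw [sub_sub, sub_eq_zero] at h2; exact h2
      exact congrArg (fun g : B ↦ g t) h4
    refine ⟨by rw [h3]; simp, fun t ht ↦ ?_⟩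
    have hc : Continuous (IccExtend (by norm_num : (-2 : ℝ) ≤ 2) (Vc.comp γ)) :=
      (Vc.comp γ).continuous.Icc_extend'
    have hd : HasDerivAt (fun t : ℝ ↦ p.2 + p.1 •
        ∫ τ in (0 : ℝ)..t, IccExtend (by norm_num) (Vc.comp γ) τ)
        (p.1 • IccExtend (by norm_num : (-2 : ℝ) ≤ 2) (Vc.comp γ) t) t :=
      ((intervalIntegral.integral_hasDerivAt_right (hc.intervalIntegrable _ _)
        (hc.stronglyMeasurableAtFilter _ _) hc.continuousAt).const_smul p.1).const_add p.2
    rw [IccExtend_of_mem _ _ (Ioo_subset_Icc_self ht)] at hd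
    refine hd.congr_of_eventuallyEq ?_
    filter_upwards [Ioo_mem_nhds ht.1 ht.2] with τ hτ
    rw [IccExtend_of_mem _ _ (Ioo_subset_Icc_self hτ), h3]

end LocalFlow

/-! ### Tangent vectors and vector fields read in a chart. -/

section ChartVectors

variable {E : Type*} [NormedAddCommGroup E] [NormedSpace ℝ E]
  {M : Type*} [TopologicalSpace M] [ChartedSpace E M] [IsManifold 𝓘(ℝ, E) ∞ M]

/-- The derivative at `x` of the preferred chart at `x₀`. -/
noncomputable def chartDeriv (x₀ x : M) : TangentSpace 𝓘(ℝ, E) x →L[ℝ] E :=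
  mfderiv 𝓘(ℝ, E) 𝓘(ℝ, E) (extChartAt 𝓘(ℝ, E) x₀) x

lemma chartDeriv_eq_continuousLinearMapAt {x₀ x : M} (hx : x ∈ (chartAt E x₀).source) :
    (trivializationAt E (TangentSpace 𝓘(ℝ, E)) x₀).continuousLinearMapAt ℝ x = chartDeriv x₀ x :=
  have : IsManifold 𝓘(ℝ, E) 1 M := .of_le (n := ∞) (by simp)
  TangentBundle.continuousLinearMapAt_trivializationAt hx

lemma contMDiffAt_vectorField_iff {X : (x : M) → TangentSpace 𝓘(ℝ, E) x} {x₀ x : M}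
    (hx : x ∈ (chartAt E x₀).source) :
    ContMDiffAt 𝓘(ℝ, E) 𝓘(ℝ, E).tangent ∞ (fun y ↦ (⟨y, X y⟩ : TangentBundle 𝓘(ℝ, E) M)) x ↔
      ContMDiffAt 𝓘(ℝ, E) 𝓘(ℝ, E) ∞ (fun y ↦ chartDeriv x₀ y (X y)) x := by
  have := (trivializationAt E (TangentSpace 𝓘(ℝ, E)) x₀).contMDiffAt_section_iff (IB := 𝓘(ℝ, E))
    (n := ∞) (s := X) (x₀ := x) (by simpa using hx)
  refine this.trans ⟨fun h ↦ h.congr_of_eventuallyEq ?_, fun h ↦ h.congr_of_eventuallyEq ?_⟩ <;>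
  · filter_upwards [(chartAt E x₀).open_source.mem_nhds hx] with y hy
    rw [← chartDeriv_eq_continuousLinearMapAt hy,
      Bundle.Trivialization.continuousLinearMapAt_apply_of_mem ℝ _ (by simpa using hy)]

lemma chartDeriv_bijective {x₀ x : M} (hx : x ∈ (chartAt E x₀).source) :
    Function.Bijective (chartDeriv (E := E) x₀ x) := by
  have : IsManifold 𝓘(ℝ, E) 1 M := .of_le (n := ∞) (by simp)
  exact (isInvertible_mfderiv_extChartAt (I := 𝓘(ℝ, E)) (x := x₀) (y := x)
    (by simpa using hx)).bijective

lemma mdifferentiableAt_extChartAt' {x₀ x : M} (hx : x ∈ (chartAt E x₀).source) :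
    MDifferentiableAt 𝓘(ℝ, E) 𝓘(ℝ, E) (extChartAt 𝓘(ℝ, E) x₀) x :=
  have : IsManifold 𝓘(ℝ, E) 1 M := .of_le (n := ∞) (by simp)
  mdifferentiableAt_extChartAt hx

lemma contMDiffAt_extChartAt_symm {x₀ : M} {y : E} (hy : y ∈ (extChartAt 𝓘(ℝ, E) x₀).target) :
    ContMDiffAt 𝓘(ℝ, E) 𝓘(ℝ, E) ∞ (extChartAt 𝓘(ℝ, E) x₀).symm y :=
  (contMDiffOn_extChartAt_symm x₀).contMDiffAt
    ((isOpen_extChartAt_target x₀).mem_nhds hy)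

/-- The chain rule for a map followed by a chart. -/
lemma mfderiv_extChartAt_comp {F H N : Type*} [NormedAddCommGroup F] [NormedSpace ℝ F]
    [TopologicalSpace H] {J : ModelWithCorners ℝ F H} [TopologicalSpace N] [ChartedSpace H N]
    {f : N → M} {p : N} {x₀ : M} (hf : MDifferentiableAt J 𝓘(ℝ, E) f p)
    (hp : f p ∈ (chartAt E x₀).source) (w : TangentSpace J p) :
    mfderiv J 𝓘(ℝ, E) (fun q ↦ extChartAt 𝓘(ℝ, E) x₀ (f q)) p w =
      chartDeriv x₀ (f p) (mfderiv J 𝓘(ℝ, E) f p w) :=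
  congrArg (fun L ↦ L w) (mfderiv_comp p (mdifferentiableAt_extChartAt' hp) hf)

lemma hasMFDerivAt_of_hasDerivAt_chart {c : ℝ → M} {t : ℝ} {x₀ : M}
    {v : TangentSpace 𝓘(ℝ, E) (c t)} (hc : MDifferentiableAt 𝓘(ℝ, ℝ) 𝓘(ℝ, E) c t)
    (hs : c t ∈ (chartAt E x₀).source)
    (hd : HasDerivAt (fun τ ↦ extChartAt 𝓘(ℝ, E) x₀ (c τ)) (chartDeriv x₀ (c t) v) t) :
    HasMFDerivAt 𝓘(ℝ, ℝ) 𝓘(ℝ, E) c t ((1 : ℝ →L[ℝ] ℝ).smulRight v) := by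
  refine hc.hasMFDerivAt.congr_mfderiv ?_
  have key : mfderiv 𝓘(ℝ, ℝ) 𝓘(ℝ, E) c t (1 : ℝ) = v := by
    apply (chartDeriv_bijective hs).1
    rw [← mfderiv_extChartAt_comp hc hs (1 : ℝ), mfderiv_eq_fderiv]
    exact hd.deriv
  refine ContinuousLinearMap.ext_ring (key.trans ?_)
  exact (one_smul ℝ v).symm

end ChartVectors

/-! ### Local flows of vector fields on manifolds. -/

section Flow

variable {E : Type*} [NormedAddCommGroup E] [NormedSpace ℝ E] [FiniteDimensional ℝ E]
  {M : Type*} [TopologicalSpace M] [ChartedSpace E M] [IsManifold 𝓘(ℝ, E) ∞ M]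

/-- A smooth vector field agrees near the base point of a chart with a globally defined smooth
vector field on the model space. -/
lemma exists_contDiff_eq_chartDeriv {X : (x : M) → TangentSpace 𝓘(ℝ, E) x}
    (hX : ContMDiff 𝓘(ℝ, E) 𝓘(ℝ, E).tangent ∞ (fun y ↦ (⟨y, X y⟩ : TangentBundle 𝓘(ℝ, E) M)))
    (x₀ : M) : ∃ V : E → E, ContDiff ℝ ∞ V ∧ ∀ᶠ y in nhds (extChartAt 𝓘(ℝ, E) x₀ x₀),
      V y = chartDeriv x₀ ((extChartAt 𝓘(ℝ, E) x₀).symm y)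
        (X ((extChartAt 𝓘(ℝ, E) x₀).symm y)) := by
  set φ := extChartAt 𝓘(ℝ, E) x₀ with hφ
  set V₀ : E → E := fun y ↦ chartDeriv x₀ (φ.symm y) (X (φ.symm y)) with hV₀
  have hs : ∀ y ∈ φ.target, ContDiffAt ℝ ∞ V₀ y := by
    intro y hy
    have h1 : φ.symm y ∈ (chartAt E x₀).source := by
      simpa [hφ] using φ.map_target hy
    rw [← contMDiffAt_iff_contDiffAt]
    exact ((contMDiffAt_vectorField_iff h1).1 (hX _)).comp y (contMDiffAt_extChartAt_symm hy)
  have ht : φ.target ∈ nhds (φ x₀) := extChartAt_target_mem_nhds x₀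
  obtain ⟨r, hr, hball⟩ := Metric.nhds_basis_closedBall.mem_iff.1 ht
  -- `V₀` is meaningful only on the chart target. The bump function is supported in a closed ball
  -- inside it, so the product is smooth everywhere and equals `V₀` near the centre.
  let χ : ContDiffBump (φ x₀) := ⟨r / 2, r, by positivity, by linarith⟩
  refine ⟨fun y ↦ χ y • V₀ y, contDiff_iff_contDiffAt.2 fun y ↦ ?_, ?_⟩
  · by_cases hy : y ∈ φ.target
    · exact χ.contDiffAt.smul (hs y hy)
    · have h0 : y ∉ tsupport χ := fun h ↦ hy (hball (by rwa [χ.tsupport_eq] at h))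
      refine (contDiffAt_const (c := (0 : E))).congr_of_eventuallyEq ?_
      filter_upwards [(isClosed_tsupport χ).isOpen_compl.mem_nhds h0] with z hz
      simp [image_eq_zero_of_notMem_tsupport hz]
  · filter_upwards [χ.eventuallyEq_one] with y hy
    rw [hy]; exact one_smul ℝ _

/-- Integral curves of a smooth vector field exist locally and depend smoothly on the initial
point. -/
theorem exists_local_integralCurves {X : (x : M) → TangentSpace 𝓘(ℝ, E) x}
    (hX : ContMDiff 𝓘(ℝ, E) 𝓘(ℝ, E).tangent ∞ (fun y ↦ (⟨y, X y⟩ : TangentBundle 𝓘(ℝ, E) M)))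
    (x₀ : M) : ∃ c : ℝ × M → ℝ → M,
      ContMDiffAt (𝓘(ℝ, ℝ).prod 𝓘(ℝ, E)) 𝓘(ℝ, E) ∞ (fun p ↦ c p 1) ((0 : ℝ), x₀) ∧
      ∀ᶠ p in nhds ((0 : ℝ), x₀), c p 0 = p.2 ∧
        IsMIntegralCurveOn (I := 𝓘(ℝ, E)) (c p) (fun x ↦ p.1 • X x) (Ioo (-2) 2) := by
  set φ := extChartAt 𝓘(ℝ, E) x₀ with hφ
  obtain ⟨V, hV, hVX⟩ := exists_contDiff_eq_chartDeriv hX x₀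
  obtain ⟨G, hG, hG0, hGd⟩ := exists_contDiffAt_integralCurves V hV (φ x₀)
  have hI : (-2 : ℝ) ≤ 2 := by norm_num
  let ι : ℝ × M → ℝ × E := fun p ↦ (p.1, φ p.2)
  have hι : ContMDiffAt (𝓘(ℝ, ℝ).prod 𝓘(ℝ, E)) (𝓘(ℝ, ℝ).prod 𝓘(ℝ, E)) ∞ ι ((0 : ℝ), x₀) :=
    contMDiffAt_fst.prodMk ((contMDiffAt_extChartAt (x := x₀)).comp _ contMDiffAt_snd)
  have hιc : Filter.Tendsto ι (nhds ((0 : ℝ), x₀)) (nhds (0, φ x₀)) := hι.continuousAt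
  refine ⟨fun p t ↦ φ.symm (IccExtend hI (G (ι p)) t), ?_, ?_⟩
  · have hev : ContDiffAt ℝ ∞ (fun p : ℝ × E ↦ IccExtend hI (G p) 1) (0, φ x₀) := by
      have : (fun p : ℝ × E ↦ IccExtend hI (G p) 1) =
          fun p ↦ ContinuousMap.evalCLM ℝ (⟨1, by norm_num⟩ : Icc (-2 : ℝ) 2) (G p) := by
        funext p
        exact IccExtend_of_mem _ _ (by norm_num)
      rw [this]
      exact (ContinuousMap.evalCLM ℝ (⟨1, by norm_num⟩ : Icc (-2 : ℝ) 2)).contDiff.contDiffAt.comp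
        (0, φ x₀) hG
    have hev' : ContMDiffAt (𝓘(ℝ, ℝ).prod 𝓘(ℝ, E)) 𝓘(ℝ, E) ∞
        (fun p : ℝ × E ↦ IccExtend hI (G p) 1) (0, φ x₀) := by
      rw [← modelWithCornersSelf_prod, chartedSpaceSelf_prod]
      exact hev.contMDiffAt
    refine ContMDiffAt.comp ((0 : ℝ), x₀) (I' := 𝓘(ℝ, E)) (g := φ.symm)
      (f := fun p ↦ IccExtend hI (G (ι p)) 1) ?_ (ContMDiffAt.comp ((0 : ℝ), x₀) hev' hι)
    refine contMDiffAt_extChartAt_symm ?_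
    have : IccExtend hI (G (ι ((0 : ℝ), x₀))) 1 = φ x₀ := by
      rw [IccExtend_of_mem _ _ (by norm_num)]
      simp only [ι, hG0]; rfl
    rw [this]; exact mem_extChartAt_target x₀
  · have hV' : ∀ᶠ y in nhds (φ x₀), y ∈ φ.target ∧ V y = chartDeriv x₀ (φ.symm y) (X (φ.symm y)) :=
      Filter.Eventually.and (extChartAt_target_mem_nhds x₀) hVX
    obtain ⟨r, hr, hball⟩ := Metric.eventually_nhds_iff_ball.1 hV'
    -- Closeness in the sup norm confines the entire solution to the ball where `V` represents `X`,
    -- so it solves the right equation on all of `(-2, 2)`.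
    have hclose : ∀ᶠ q in nhds ((0 : ℝ), φ x₀), dist (G q) (ContinuousMap.const _ (φ x₀)) < r := by
      have := hG.continuousAt.eventually (Metric.ball_mem_nhds _ hr)
      rw [hG0] at this
      exact this
    have hsrc : ∀ᶠ p in nhds ((0 : ℝ), x₀), p.2 ∈ φ.source :=
      continuousAt_snd.eventually (extChartAt_source_mem_nhds x₀)
    filter_upwards [hιc.eventually hGd, hιc.eventually hclose, hsrc] with p ⟨hp0, hpd⟩ hpc hps
    refine ⟨?_, fun t ht ↦ ?_⟩
    · rw [IccExtend_of_mem _ _ (by norm_num : (0 : ℝ) ∈ Icc (-2 : ℝ) 2), hp0]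
      exact φ.left_inv hps
    · have hmem : ∀ τ, IccExtend hI (G (ι p)) τ ∈ Metric.ball (φ x₀) r := fun τ ↦
        (ContinuousMap.dist_apply_le_dist _).trans_lt hpc
      obtain ⟨ht1, ht2⟩ := hball _ (hmem t)
      have hd := hpd t ht
      rw [← IccExtend_of_mem hI (G (ι p)) (Ioo_subset_Icc_self ht), ht2] at hd
      have hs : φ.symm (IccExtend hI (G (ι p)) t) ∈ (chartAt E x₀).source := by
        simpa [hφ] using φ.map_target ht1
      refine HasMFDerivAt.hasMFDerivWithinAt (hasMFDerivAt_of_hasDerivAt_chart (x₀ := x₀) ?_ hs ?_)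
      · exact ((contMDiffAt_extChartAt_symm ht1).mdifferentiableAt (by simp)).comp t
          hd.differentiableAt.mdifferentiableAt
      · rw [map_smul]
        refine hd.congr_of_eventuallyEq (Filter.Eventually.of_forall fun τ ↦ ?_)
        exact φ.right_inv (hball _ (hmem τ)).1

end Flow

/-! ### Global smooth flows on closed manifolds. -/

section GlobalFlow

variable {E : Type*} [NormedAddCommGroup E] [NormedSpace ℝ E] [FiniteDimensional ℝ E]
  {M : Type*} [TopologicalSpace M] [ChartedSpace E M] [IsManifold 𝓘(ℝ, E) ∞ M]

/-- On a closed manifold, integral curves exist for a time independent of the initial point. -/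
lemma exists_uniform_integralCurves [CompactSpace M] {X : (x : M) → TangentSpace 𝓘(ℝ, E) x}
    (hX : ContMDiff 𝓘(ℝ, E) 𝓘(ℝ, E).tangent ∞
      (fun y ↦ (⟨y, X y⟩ : TangentBundle 𝓘(ℝ, E) M))) :
    ∃ ε : ℝ, 0 < ε ∧ ∀ x : M, ∃ c : ℝ → M, c 0 = x ∧
      IsMIntegralCurveOn (I := 𝓘(ℝ, E)) c X (Ioo (-ε) ε) := by
  have key : ∃ ε : ℝ, 0 < ε ∧ ∀ s : ℝ, |s| < ε → ∀ x ∈ (univ : Set M), ∃ c : ℝ → M, c 0 = x ∧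
      IsMIntegralCurveOn (I := 𝓘(ℝ, E)) c (fun x ↦ s • X x) (Ioo (-2) 2) := by
    refine isCompact_univ.induction_on (p := fun S : Set M ↦ ∃ ε : ℝ, 0 < ε ∧ ∀ s : ℝ, |s| < ε →
      ∀ x ∈ S, ∃ c : ℝ → M, c 0 = x ∧
        IsMIntegralCurveOn (I := 𝓘(ℝ, E)) c (fun x ↦ s • X x) (Ioo (-2) 2)) ?_ ?_ ?_ ?_
    · exact ⟨1, one_pos, fun _ _ x hx ↦ hx.elim⟩
    · rintro S T hST ⟨ε, hε, h⟩
      exact ⟨ε, hε, fun s hs x hx ↦ h s hs x (hST hx)⟩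
    · rintro S T ⟨ε, hε, h⟩ ⟨δ, hδ, k⟩
      refine ⟨min ε δ, lt_min hε hδ, fun s hs x hx ↦ ?_⟩
      rcases hx with hx | hx
      · exact h s (hs.trans_le (min_le_left _ _)) x hx
      · exact k s (hs.trans_le (min_le_right _ _)) x hx
    · intro x₀ _
      obtain ⟨c, -, hc⟩ := exists_local_integralCurves hX x₀
      obtain ⟨u, hu, v, hv, huv⟩ := mem_nhds_prod_iff.1 hc
      obtain ⟨ε, hε, hball⟩ := Metric.mem_nhds_iff.1 hu
      refine ⟨v, mem_nhdsWithin_of_mem_nhds hv, ε, hε, fun s hs x hx ↦ ⟨c (s, x), ?_⟩⟩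
      exact @huv (s, x) ⟨hball (by simpa using hs), hx⟩
  obtain ⟨ε, hε, h⟩ := key
  refine ⟨ε / 2, by positivity, fun x ↦ ?_⟩
  obtain ⟨c, hc0, hc⟩ := h (ε / 2) (by rw [abs_of_pos] <;> linarith) x (mem_univ x)
  refine ⟨c ∘ (· * (ε / 2)⁻¹), by simpa using hc0, ?_⟩
  have := (hc.comp_mul (ε / 2)⁻¹)
  have e : ((ε / 2)⁻¹ • fun x ↦ (ε / 2) • X x) = X := by
    funext y
    exact inv_smul_smul₀ (by positivity) _
  rw [e] at this
  refine this.mono fun t ht ↦ ?_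
  have h2 : 0 < ε / 2 := by positivity
  simp only [mem_ofPred_eq, mem_Ioo, ← div_eq_mul_inv, lt_div_iff₀ h2, div_lt_iff₀ h2]
  constructor <;> nlinarith [ht.1, ht.2]

/-- A smooth vector field on a closed manifold has a smooth global flow. -/
theorem exists_smooth_flow [CompactSpace M] [T2Space M] {X : (x : M) → TangentSpace 𝓘(ℝ, E) x}
    (hX : ContMDiff 𝓘(ℝ, E) 𝓘(ℝ, E).tangent ∞
      (fun y ↦ (⟨y, X y⟩ : TangentBundle 𝓘(ℝ, E) M))) :
    ∃ φ : ℝ → M → M, (∀ x, φ 0 x = x) ∧ (∀ s t x, φ (s + t) x = φ s (φ t x)) ∧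
      ContMDiff (𝓘(ℝ, ℝ).prod 𝓘(ℝ, E)) 𝓘(ℝ, E) ∞ (fun p : ℝ × M ↦ φ p.1 p.2) ∧
      ∀ x, IsMIntegralCurve (I := 𝓘(ℝ, E)) (fun t ↦ φ t x) X := by
  have : IsManifold 𝓘(ℝ, E) 1 M := .of_le (n := ∞) (by simp)
  have hX1 := hX.of_le (m := 1) (by simp)
  obtain ⟨ε, hε, hloc⟩ := exists_uniform_integralCurves hX
  choose c hc0 hc using exists_isMIntegralCurve_of_isMIntegralCurveOn hX1 hε hloc
  set φ : ℝ → M → M := fun t x ↦ c x t with hφ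
  have hadd : ∀ s t x, φ (s + t) x = φ s (φ t x) := by
    intro s t x
    have h1 := (hc x).comp_add t
    have := isMIntegralCurve_Ioo_eq_of_contMDiff_boundaryless (t₀ := 0) hX1 h1 (hc (c x t))
      (by simp [hc0])
    exact congrFun this s
  -- By uniqueness of integral curves, `φ s x` is the value at time `1` of the local smooth family
  -- for the scaled field `s • X`.
  have hzero : ∀ x₀, ContMDiffAt (𝓘(ℝ, ℝ).prod 𝓘(ℝ, E)) 𝓘(ℝ, E) ∞
      (fun p : ℝ × M ↦ φ p.1 p.2) ((0 : ℝ), x₀) := by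
    intro x₀
    obtain ⟨g, hg, hgc⟩ := exists_local_integralCurves hX x₀
    refine hg.congr_of_eventuallyEq ?_
    filter_upwards [hgc] with p ⟨hp0, hp⟩
    have h1 := ((hc p.2).comp_mul p.1).isMIntegralCurveOn (Ioo (-2) 2)
    have := isMIntegralCurveOn_Ioo_eqOn_of_contMDiff_boundaryless (t₀ := 0) (by norm_num)
      (hX1.const_smul_section (a := p.1)) h1 hp (by simp [hc0, hp0])
    simpa using this (by norm_num : (1 : ℝ) ∈ Ioo (-2 : ℝ) 2)
  refine ⟨φ, hc0, hadd, contMDiff_infty.2 fun m ↦ ?_, hc⟩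
  -- Regularity at a point spreads to a neighbourhood only for finite order, which is the reason for
  -- working with `m` in place of `∞`.
  have hunif : ∃ δ : ℝ, 0 < δ ∧ ∀ s : ℝ, |s| < δ → ∀ x ∈ (univ : Set M),
      ContMDiffAt (𝓘(ℝ, ℝ).prod 𝓘(ℝ, E)) 𝓘(ℝ, E) m (fun p : ℝ × M ↦ φ p.1 p.2) (s, x) := by
    refine isCompact_univ.induction_on (p := fun S : Set M ↦ ∃ δ : ℝ, 0 < δ ∧ ∀ s : ℝ, |s| < δ →
      ∀ x ∈ S, ContMDiffAt (𝓘(ℝ, ℝ).prod 𝓘(ℝ, E)) 𝓘(ℝ, E) m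
        (fun p : ℝ × M ↦ φ p.1 p.2) (s, x)) ?_ ?_ ?_ ?_
    · exact ⟨1, one_pos, fun _ _ x hx ↦ hx.elim⟩
    · rintro S T hST ⟨ε, hε, h⟩
      exact ⟨ε, hε, fun s hs x hx ↦ h s hs x (hST hx)⟩
    · rintro S T ⟨ε, hε, h⟩ ⟨δ, hδ, k⟩
      refine ⟨min ε δ, lt_min hε hδ, fun s hs x hx ↦ ?_⟩
      rcases hx with hx | hx
      · exact h s (hs.trans_le (min_le_left _ _)) x hx
      · exact k s (hs.trans_le (min_le_right _ _)) x hx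
    · intro x₀ _
      have : IsManifold 𝓘(ℝ, E) m M := .of_le (n := ∞) (by exact_mod_cast le_top)
      have := (contMDiffAt_iff_contMDiffAt_nhds (by exact_mod_cast ENat.natCast_ne_top m)).1
        ((hzero x₀).of_le (m := m) (by exact_mod_cast le_top))
      obtain ⟨u, hu, v, hv, huv⟩ := mem_nhds_prod_iff.1 this
      obtain ⟨ε, hε, hball⟩ := Metric.mem_nhds_iff.1 hu
      refine ⟨v, mem_nhdsWithin_of_mem_nhds hv, ε, hε, fun s hs x hx ↦ ?_⟩
      exact @huv (s, x) ⟨hball (by simpa using hs), hx⟩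
  obtain ⟨δ, hδ, h⟩ := hunif
  have hsmall : ∀ s, |s| < δ → ContMDiff 𝓘(ℝ, E) 𝓘(ℝ, E) m (φ s) := fun s hs x ↦
    (h s hs x (mem_univ x)).comp x (contMDiffAt_const.prodMk contMDiffAt_id)
  have htime : ∀ t, ContMDiff 𝓘(ℝ, E) 𝓘(ℝ, E) m (φ t) := by
    intro t
    -- The time `t` map is the `N`-th iterate of the time `t / N` map, and `|t / N| < δ`.
    obtain ⟨N, hN⟩ := exists_nat_gt (|t| / δ)
    have hN0 : (0 : ℝ) < N := lt_of_le_of_lt (by positivity) hN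
    have hs : |t / N| < δ := by
      rw [abs_div, Nat.abs_cast, div_lt_iff₀ hN0]
      rw [div_lt_iff₀ hδ] at hN
      linarith
    have hk : ∀ k : ℕ, ContMDiff 𝓘(ℝ, E) 𝓘(ℝ, E) m (φ (k * (t / N))) := by
      intro k
      induction k with
      | zero =>
        have : φ ((0 : ℕ) * (t / N)) = id := by funext x; simp [hφ, hc0]
        rw [this]; exact contMDiff_id
      | succ k ih =>
        have : φ ((k + 1 : ℕ) * (t / N)) = φ (t / N) ∘ φ (k * (t / N)) := by
          funext x
          rw [Function.comp_apply, ← hadd]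
          congr 1
          push_cast; ring
        rw [this]; exact (hsmall _ hs).comp ih
    have := hk N
    rwa [mul_div_cancel₀ _ hN0.ne'] at this
  rintro ⟨t₀, x₀⟩
  have e : (fun p : ℝ × M ↦ φ p.1 p.2) =
      (fun p : ℝ × M ↦ φ p.1 p.2) ∘ (fun p : ℝ × M ↦ (p.1 - t₀, φ t₀ p.2)) := by
    funext p
    simp only [Function.comp_apply, ← hadd, sub_add_cancel]
  rw [e]
  refine ContMDiffAt.comp (t₀, x₀) (I' := 𝓘(ℝ, ℝ).prod 𝓘(ℝ, E)) ?_ ?_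
  · exact h _ (by simpa using hδ) _ (mem_univ _)
  · refine ContMDiffAt.prodMk ?_ (((htime t₀) x₀).comp (t₀, x₀) contMDiffAt_snd)
    exact ContMDiffAt.comp (t₀, x₀) (I' := 𝓘(ℝ, ℝ)) (g := fun t : ℝ ↦ t - t₀)
      (contDiff_id.sub contDiff_const).contMDiff.contMDiffAt contMDiffAt_fst

end GlobalFlow

/-! ### Linear algebra of a pair `(a, B)` with `a ∧ Bⁿ ≠ 0`. -/

section LinearAlgebra

variable {n : ℕ} {V : Type*} [AddCommGroup V] [Module ℝ V]

/-- The product `a(v₀) B(v₁, v₂) ⋯ B(v₂ₙ₋₁, v₂ₙ)` is linear in each variable. -/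
lemma exists_linearMap_eq_prod_update (a : V →ₗ[ℝ] ℝ) (B : V →ₗ[ℝ] V →ₗ[ℝ] ℝ)
    [DecidableEq (Fin (2 * n + 1))] (v : Fin (2 * n + 1) → V) (k : Fin (2 * n + 1)) :
    ∃ l : V →ₗ[ℝ] ℝ, ∀ z, a (Function.update v k z 0) * ∏ i : Fin n,
      B (Function.update v k z ⟨2 * i + 1, by omega⟩)
        (Function.update v k z ⟨2 * i + 2, by omega⟩) = l z := by
  by_cases hk : k = 0
  · subst hk
    have h1 : ∀ i : Fin n, (⟨2 * i + 1, by omega⟩ : Fin (2 * n + 1)) ≠ 0 := fun i h ↦ by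
      simp [Fin.ext_iff] at h
    have h2 : ∀ i : Fin n, (⟨2 * i + 2, by omega⟩ : Fin (2 * n + 1)) ≠ 0 := fun i h ↦ by
      simp [Fin.ext_iff] at h
    refine ⟨(∏ i : Fin n, B (v ⟨2 * i + 1, by omega⟩) (v ⟨2 * i + 2, by omega⟩)) • a,
      fun z ↦ ?_⟩
    rw [Function.update_self, LinearMap.smul_apply, smul_eq_mul, mul_comm]
    congr 1
    refine Finset.prod_congr rfl fun i _ ↦ ?_
    rw [Function.update_of_ne (h1 i), Function.update_of_ne (h2 i)]
  · have hk' : (k : ℕ) ≠ 0 := fun h ↦ hk (Fin.ext h)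
    have hj : ((k : ℕ) - 1) / 2 < n := by omega
    -- Slots `2 j + 1` and `2 j + 2` are paired, so a slot `k ≠ 0` enters only the factor with `j =
    -- (k - 1) / 2`; all the others form the constant `c`.
    set j : Fin n := ⟨((k : ℕ) - 1) / 2, hj⟩ with hjdef
    set c := a (v 0) * ∏ i ∈ Finset.univ.erase j,
      B (v ⟨2 * i + 1, by omega⟩) (v ⟨2 * i + 2, by omega⟩) with hc
    have hprod : ∀ z, a (Function.update v k z 0) * ∏ i : Fin n,
        B (Function.update v k z ⟨2 * i + 1, by omega⟩)
          (Function.update v k z ⟨2 * i + 2, by omega⟩) =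
        c * B (Function.update v k z ⟨2 * j + 1, by omega⟩)
          (Function.update v k z ⟨2 * j + 2, by omega⟩) := by
      intro z
      rw [← Finset.mul_prod_erase Finset.univ _ (Finset.mem_univ j),
        Function.update_of_ne (Ne.symm hk), hc, mul_right_comm, mul_assoc]
      congr 2
      refine Finset.prod_congr rfl fun i hi ↦ ?_
      have hij : (i : ℕ) ≠ ((k : ℕ) - 1) / 2 := fun h ↦ (Finset.mem_erase.1 hi).1 (Fin.ext h)
      rw [Function.update_of_ne (fun h ↦ by rw [← h] at hij; simp at hij),
        Function.update_of_ne (fun h ↦ by rw [← h] at hij; simp at hij; omega)]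
    simp only [hprod]
    rcases Nat.even_or_odd' (k : ℕ) with ⟨m, hm | hm⟩
    · have e1 : (⟨2 * j + 1, by omega⟩ : Fin (2 * n + 1)) ≠ k := fun h ↦ by
        have := congrArg Fin.val h; simp [j] at this; omega
      have e2 : (⟨2 * j + 2, by omega⟩ : Fin (2 * n + 1)) = k := Fin.ext (by simp [j]; omega)
      refine ⟨c • B (v ⟨2 * j + 1, by omega⟩), fun z ↦ ?_⟩
      rw [Function.update_of_ne e1, e2, Function.update_self]
      rfl
    · have e1 : (⟨2 * j + 1, by omega⟩ : Fin (2 * n + 1)) = k := Fin.ext (by simp [j]; omega)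
      have e2 : (⟨2 * j + 2, by omega⟩ : Fin (2 * n + 1)) ≠ k := fun h ↦ by
        have := congrArg Fin.val h; simp [j] at this; omega
      refine ⟨c • B.flip (v ⟨2 * j + 2, by omega⟩), fun z ↦ ?_⟩
      rw [Function.update_of_ne e2, e1, Function.update_self]
      rfl

/-- The multilinear map `a(v₀) B(v₁, v₂) ⋯ B(v₂ₙ₋₁, v₂ₙ)`. -/
def tensorPow (n : ℕ) (a : V →ₗ[ℝ] ℝ) (B : V →ₗ[ℝ] V →ₗ[ℝ] ℝ) :
    MultilinearMap ℝ (fun _ : Fin (2 * n + 1) ↦ V) ℝ where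
  toFun v := a (v 0) * ∏ i : Fin n, B (v ⟨2 * i + 1, by omega⟩) (v ⟨2 * i + 2, by omega⟩)
  map_update_add' v k x y := by
    obtain ⟨l, hl⟩ := exists_linearMap_eq_prod_update a B v k
    rw [hl, hl, hl, map_add]
  map_update_smul' v k c x := by
    obtain ⟨l, hl⟩ := exists_linearMap_eq_prod_update a B v k
    rw [hl, hl, map_smul]

/-- Slot `0` is killed through `a`, and every other slot through the factor of `B` that contains it.
-/
lemma tensorPow_eq_zero (a : V →ₗ[ℝ] ℝ) (B : V →ₗ[ℝ] V →ₗ[ℝ] ℝ) (hB : ∀ v, B v v = 0)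
    {v : V} (ha : a v = 0) (hv : ∀ u, B v u = 0) (w : Fin (2 * n + 1) → V) (k : Fin (2 * n + 1))
    (hk : w k = v) : tensorPow n a B w = 0 := by
  have hv' : ∀ u, B u v = 0 := fun u ↦ by
    have := hB (u + v)
    simp only [map_add, LinearMap.add_apply, hB, hv, zero_add, add_zero] at this
    exact this
  change a (w 0) * ∏ i : Fin n, B (w ⟨2 * i + 1, by omega⟩) (w ⟨2 * i + 2, by omega⟩) = 0
  by_cases hk0 : k = 0
  · rw [← hk0, hk, ha, zero_mul]
  · have hk' : (k : ℕ) ≠ 0 := fun h ↦ hk0 (Fin.ext h)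
    have hj : ((k : ℕ) - 1) / 2 < n := by omega
    refine mul_eq_zero_of_right _ (Finset.prod_eq_zero (Finset.mem_univ ⟨_, hj⟩) ?_)
    rcases Nat.even_or_odd' (k : ℕ) with ⟨m, hm | hm⟩
    · have e2 : (⟨2 * (((k : ℕ) - 1) / 2) + 2, by omega⟩ : Fin (2 * n + 1)) = k :=
        Fin.ext (by simp; omega)
      simp only [e2, hk, hv']
    · have e2 : (⟨2 * (((k : ℕ) - 1) / 2) + 1, by omega⟩ : Fin (2 * n + 1)) = k :=
        Fin.ext (by simp; omega)
      simp only [e2, hk, hv]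

/-- The data `(a, B)` of a contact form at a point: `B` is alternating and `a ∧ Bⁿ ≠ 0`. -/
structure IsContactPair (n : ℕ) (a : V →ₗ[ℝ] ℝ) (B : V →ₗ[ℝ] V →ₗ[ℝ] ℝ) : Prop where
  finrank : Module.finrank ℝ V = 2 * n + 1
  self_eq_zero : ∀ v, B v v = 0
  ne_zero : ∃ w, MultilinearMap.alternatization (tensorPow n a B) w ≠ 0

namespace IsContactPair

variable {a : V →ₗ[ℝ] ℝ} {B : V →ₗ[ℝ] V →ₗ[ℝ] ℝ} (h : IsContactPair n a B)
include h

lemma finiteDimensional : FiniteDimensional ℝ V :=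
  FiniteDimensional.of_finrank_pos (by rw [h.finrank]; omega)

lemma swap (u v : V) : B u v = -B v u := by
  have := h.self_eq_zero (u + v)
  simp only [map_add, LinearMap.add_apply, h.self_eq_zero, zero_add, add_zero] at this
  linarith

/-- This is nondegeneracy of `B` on the kernel of `a`. A family `w` with `(a ∧ Bⁿ)(w) ≠ 0` is a
basis. Replacing `w j` by `v` multiplies this value by the `j`-th coordinate of `v`, yet gives zero,
so every coordinate vanishes. -/
lemma eq_zero {v : V} (ha : a v = 0) (hv : ∀ u, B v u = 0) : v = 0 := by
  obtain ⟨w, hw⟩ := h.ne_zero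
  set A := MultilinearMap.alternatization (tensorPow n a B) with hA
  have hvan : ∀ (w : Fin (2 * n + 1) → V) (j : Fin (2 * n + 1)), w j = v → A w = 0 := by
    intro w j hj
    rw [hA, MultilinearMap.alternatization_apply]
    refine Finset.sum_eq_zero fun σ _ ↦ ?_
    rw [MultilinearMap.domDomCongr_apply,
      tensorPow_eq_zero a B h.self_eq_zero ha hv _ (σ⁻¹ j) (by simpa using hj), smul_zero]
  have hli : LinearIndependent ℝ w := by
    by_contra hcon
    exact hw (A.map_linearDependent w hcon)
  have := h.finiteDimensional
  let b := basisOfLinearIndependentOfCardEqFinrank hli (by simp [h.finrank])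
  have hb : ∀ i, b i = w i := fun i ↦ by simp [b]
  have hsum : v = ∑ i, b.repr v i • w i := by
    conv_lhs => rw [← b.sum_repr v]
    simp only [hb]
  have hc : ∀ j, b.repr v j = 0 := by
    intro j
    have h1 := hvan (Function.update w j v) j (Function.update_self ..)
    rw [hsum, AlternatingMap.map_update_sum, Finset.sum_eq_single j] at h1
    · rw [AlternatingMap.map_update_smul, Function.update_eq_self, smul_eq_mul, mul_eq_zero] at h1
      exact h1.resolve_right hw
    · intro i _ hij
      rw [AlternatingMap.map_update_smul, A.map_update_self w hij.symm, smul_zero]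
    · intro hj
      exact absurd (Finset.mem_univ j) hj
  rw [hsum]
  exact Finset.sum_eq_zero fun i _ ↦ by rw [hc, zero_smul]

/-- A skew-symmetric matrix of odd size is singular, so `B` has a nonzero radical vector.
Nondegeneracy on the kernel of `a` forces `a` to be nonzero on it, so it can be normalised. -/
lemma exists_reeb : ∃ R, a R = 1 ∧ ∀ v, B R v = 0 := by
  have := h.finiteDimensional
  let b := Module.finBasisOfFinrankEq ℝ V h.finrank
  let A : Matrix (Fin (2 * n + 1)) (Fin (2 * n + 1)) ℝ := Matrix.of fun i j ↦ B (b i) (b j)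
  have hT : A.transpose = -A := by
    ext i j
    exact h.swap _ _
  have hdet : A.det = 0 := by
    have h1 : A.det = (-A).det := by rw [← hT, Matrix.det_transpose]
    rw [Matrix.det_neg, Fintype.card_fin, pow_succ, pow_mul] at h1
    simp only [even_two, Even.neg_pow, one_pow, one_mul] at h1
    linarith
  obtain ⟨c, hc, hAc⟩ := Matrix.exists_mulVec_eq_zero_iff.2 hdet
  set v := ∑ j, c j • b j with hvdef
  have hv : ∀ u, B v u = 0 := by
    have : B.flip v = 0 := by
      refine b.ext fun i ↦ ?_
      have := congrFun hAc i
      simp only [Matrix.mulVec, dotProduct, A, Matrix.of_apply, Pi.zero_apply] at this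
      rw [LinearMap.flip_apply, hvdef, map_sum, LinearMap.zero_apply, ← this]
      exact Finset.sum_congr rfl fun j _ ↦ by rw [map_smul, smul_eq_mul, mul_comm]
    intro u
    rw [h.swap]
    have := congrArg (fun f ↦ f u) this
    simpa using this
  have hv0 : v ≠ 0 := fun h0 ↦ hc (by
    have := Fintype.linearIndependent_iff.1 b.linearIndependent c h0
    exact funext this)
  have hav : a v ≠ 0 := fun h0 ↦ hv0 (h.eq_zero h0 hv)
  exact ⟨(a v)⁻¹ • v, by simp [hav], fun u ↦ by simp [hv]⟩

/-- The form `B + a ⊗ a` is nondegenerate: a vector `Z` in its kernel, paired with itself, gives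
`a(Z)² = 0`, and then `B(Z, ·) = 0`. This form packs conditions on `α(X)` and on `dα(X, ·)` into one
invertible linear equation. -/
lemma eq_of_apply_add_eq {X Y : V} (hXY : ∀ u, B X u + a X * a u = B Y u + a Y * a u) :
    X = Y := by
  have h1 : ∀ u, B (X - Y) u + a (X - Y) * a u = 0 := fun u ↦ by
    have := hXY u
    simp only [map_sub, LinearMap.sub_apply]
    linarith
  have h2 : a (X - Y) = 0 := by
    have := h1 (X - Y)
    rw [h.self_eq_zero, zero_add] at this
    simpa using this
  refine sub_eq_zero.1 (h.eq_zero h2 fun u ↦ ?_)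
  have := h1 u
  rwa [h2, zero_mul, add_zero] at this

lemma exists_apply_add_eq (β : V →ₗ[ℝ] ℝ) : ∃ X, ∀ u, B X u + a X * a u = β u := by
  have := h.finiteDimensional
  let T : V →ₗ[ℝ] Module.Dual ℝ V := B + a.smulRight a
  have hT : ∀ X u, T X u = B X u + a X * a u := fun X u ↦ by simp [T]
  have hinj : Function.Injective T := fun X Y hXY ↦
    h.eq_of_apply_add_eq fun u ↦ by rw [← hT, ← hT, hXY]
  have hsurj := (LinearMap.injective_iff_surjective_of_finrank_eq_finrank
    (Subspace.dual_finrank_eq (K := ℝ) (V := V)).symm).1 hinj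
  obtain ⟨X, hX⟩ := hsurj β
  exact ⟨X, fun u ↦ by rw [← hT, hX]⟩

end IsContactPair
end LinearAlgebra

/-! ### One-forms in charts and chart independence of the exterior derivative. -/

section ChartForms

variable {n : ℕ} {M : Type*} [TopologicalSpace M] [ChartedSpace (Model n) M]
  [IsManifold (𝓡 (2 * n + 1)) ∞ M] {α : OneForm n M}

lemma SmoothOneForm.contMDiffWithinAt_apply {F H N : Type*} [NormedAddCommGroup F]
    [NormedSpace ℝ F] [TopologicalSpace H] {J : ModelWithCorners ℝ F H} [TopologicalSpace N]
    [ChartedSpace H N] (hα : SmoothOneForm α) {k : WithTop ℕ∞} (hk : k ≤ ∞) {b : N → M}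
    {v : (q : N) → TangentSpace (𝓡 (2 * n + 1)) (b q)} {s : Set N} {p : N}
    (hv : ContMDiffWithinAt J (𝓡 (2 * n + 1)).tangent k
      (fun q ↦ (⟨b q, v q⟩ : TangentBundle (𝓡 (2 * n + 1)) M)) s p) :
    ContMDiffWithinAt J 𝓘(ℝ, ℝ) k (fun q ↦ α (b q) (v q)) s p := by
  have hb : ContMDiffWithinAt J (𝓡 (2 * n + 1)) k b s p :=
    (Bundle.contMDiffWithinAt_totalSpace.1 hv).1
  have hαb := (hα.of_le hk).contMDiffAt.comp_contMDiffWithinAt (x := p) (f := b) hb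
  have := ContMDiffWithinAt.clm_bundle_apply (F₁ := Model n) (F₂ := ℝ)
    (E₁ := TangentSpace (𝓡 (2 * n + 1)) (M := M)) (E₂ := Bundle.Trivial M ℝ) hαb hv
  exact (Bundle.contMDiffWithinAt_totalSpace.1 this).2

omit [IsManifold (𝓡 (2 * n + 1)) ∞ M] in
lemma mem_chart_source_of_mem_target {x₀ : M} {y : Model n}
    (hy : y ∈ (extChartAt (𝓡 (2 * n + 1)) x₀).target) :
    (extChartAt (𝓡 (2 * n + 1)) x₀).symm y ∈ (chartAt (Model n) x₀).source := by
  rw [← extChartAt_source (𝓡 (2 * n + 1))]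
  exact (extChartAt (𝓡 (2 * n + 1)) x₀).map_target hy

/-- The derivative of a map from a normed space to a manifold. -/
noncomputable def vderiv {F : Type*} [NormedAddCommGroup F] [NormedSpace ℝ F]
    (f : F → M) (y : F) : F →L[ℝ] TangentSpace (𝓡 (2 * n + 1)) (f y) :=
  mfderiv 𝓘(ℝ, F) (𝓡 (2 * n + 1)) f y

lemma chartDeriv_vderiv {F : Type*} [NormedAddCommGroup F] [NormedSpace ℝ F]
    {f : F → M} {y : F} {x₀ : M} (hf : MDifferentiableAt 𝓘(ℝ, F) (𝓡 (2 * n + 1)) f y)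
    (hs : f y ∈ (chartAt (Model n) x₀).source) (w : F) :
    chartDeriv x₀ (f y) (vderiv f y w) =
      fderiv ℝ (fun q ↦ extChartAt (𝓡 (2 * n + 1)) x₀ (f q)) y w := by
  rw [← mfderiv_eq_fderiv]
  exact (mfderiv_extChartAt_comp hf hs w).symm

lemma vderiv_symm_chartDeriv {x₀ : M} {y : Model n}
    (hy : y ∈ (extChartAt (𝓡 (2 * n + 1)) x₀).target)
    (u : TangentSpace (𝓡 (2 * n + 1)) ((extChartAt (𝓡 (2 * n + 1)) x₀).symm y)) :
    vderiv (extChartAt (𝓡 (2 * n + 1)) x₀).symm y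
      (chartDeriv x₀ ((extChartAt (𝓡 (2 * n + 1)) x₀).symm y) u) = u := by
  have hs := mem_chart_source_of_mem_target hy
  apply (chartDeriv_bijective hs).1
  refine (chartDeriv_vderiv ((contMDiffAt_extChartAt_symm hy).mdifferentiableAt (by simp))
    hs _).trans ?_
  have : (fun q ↦ extChartAt (𝓡 (2 * n + 1)) x₀ ((extChartAt (𝓡 (2 * n + 1)) x₀).symm q))
      =ᶠ[nhds y] id := by
    filter_upwards [(isOpen_extChartAt_target x₀).mem_nhds hy] with z hz
    exact (extChartAt (𝓡 (2 * n + 1)) x₀).right_inv hz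
  rw [this.fderiv_eq, fderiv_id]
  rfl

lemma inChart_chartDeriv (α : OneForm n M) {x₀ : M} {y : Model n}
    (hy : y ∈ (extChartAt (𝓡 (2 * n + 1)) x₀).target)
    (u : TangentSpace (𝓡 (2 * n + 1)) ((extChartAt (𝓡 (2 * n + 1)) x₀).symm y)) :
    α.inChart x₀ y (chartDeriv x₀ ((extChartAt (𝓡 (2 * n + 1)) x₀).symm y) u) =
      α ((extChartAt (𝓡 (2 * n + 1)) x₀).symm y) u :=
  congrArg (α ((extChartAt (𝓡 (2 * n + 1)) x₀).symm y)) (vderiv_symm_chartDeriv hy u)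

lemma inChart_extChartAt (α : OneForm n M) {x₀ p : M} (hp : p ∈ (chartAt (Model n) x₀).source)
    (u : TangentSpace (𝓡 (2 * n + 1)) p) :
    α.inChart x₀ (extChartAt (𝓡 (2 * n + 1)) x₀ p) (chartDeriv x₀ p u) = α p u := by
  rw [← extChartAt_source (𝓡 (2 * n + 1))] at hp
  obtain ⟨y, hy, rfl⟩ : ∃ y ∈ (extChartAt (𝓡 (2 * n + 1)) x₀).target,
      p = (extChartAt (𝓡 (2 * n + 1)) x₀).symm y :=
    ⟨_, (extChartAt (𝓡 (2 * n + 1)) x₀).map_source hp,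
      ((extChartAt (𝓡 (2 * n + 1)) x₀).left_inv hp).symm⟩
  rw [(extChartAt (𝓡 (2 * n + 1)) x₀).right_inv hy]
  exact inChart_chartDeriv α hy u

/-- Vectors constant in a chart form a smooth vector field. -/
lemma exists_vectorField_chartDeriv_eq (x₀ : M) (w : Model n) :
    ∃ W : (x : M) → TangentSpace (𝓡 (2 * n + 1)) x,
      (∀ x ∈ (chartAt (Model n) x₀).source, chartDeriv x₀ x (W x) = w) ∧
      ∀ x ∈ (chartAt (Model n) x₀).source, ContMDiffAt (𝓡 (2 * n + 1)) (𝓡 (2 * n + 1)).tangent ∞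
        (fun y ↦ (⟨y, W y⟩ : TangentBundle (𝓡 (2 * n + 1)) M)) x := by
  classical
  let W : (x : M) → TangentSpace (𝓡 (2 * n + 1)) x := fun x ↦
    if h : x ∈ (chartAt (Model n) x₀).source then
      Classical.choose ((chartDeriv_bijective (E := Model n) h).2 w) else 0
  have hW : ∀ x ∈ (chartAt (Model n) x₀).source, chartDeriv x₀ x (W x) = w := by
    intro x hx
    simp only [W, dif_pos hx]
    exact Classical.choose_spec ((chartDeriv_bijective (E := Model n) hx).2 w)
  refine ⟨W, hW, fun x hx ↦ (contMDiffAt_vectorField_iff hx).2 ?_⟩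
  refine (contMDiffAt_const (c := w)).congr_of_eventuallyEq ?_
  filter_upwards [(chartAt (Model n) x₀).open_source.mem_nhds hx] with z hz
  exact hW z hz

/-- In finite dimension it suffices to test the local expression on constant vectors, which come
from smooth local vector fields on `M`. -/
lemma SmoothOneForm.contDiffOn_inChart (hα : SmoothOneForm α) (x₀ : M) :
    ContDiffOn ℝ ∞ (α.inChart x₀) (extChartAt (𝓡 (2 * n + 1)) x₀).target := by
  rw [contDiffOn_clm_apply]
  intro w y hy
  obtain ⟨W, hW, hWs⟩ := exists_vectorField_chartDeriv_eq x₀ w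
  have hy' := mem_chart_source_of_mem_target hy
  have h1 : ContMDiffAt (𝓡 (2 * n + 1)) 𝓘(ℝ, ℝ) ∞ (fun x ↦ α x (W x))
      ((extChartAt (𝓡 (2 * n + 1)) x₀).symm y) :=
    hα.contMDiffWithinAt_apply le_rfl (hWs _ hy').contMDiffWithinAt
  have h2 := (h1.comp y (contMDiffAt_extChartAt_symm hy)).contDiffAt
  refine (h2.congr_of_eventuallyEq ?_).contDiffWithinAt
  filter_upwards [(isOpen_extChartAt_target x₀).mem_nhds hy] with z hz
  rw [← hW _ (mem_chart_source_of_mem_target hz)]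
  exact inChart_chartDeriv α hz _

lemma SmoothOneForm.contDiffAt_inChart (hα : SmoothOneForm α) (x₀ : M) {y : Model n}
    (hy : y ∈ (extChartAt (𝓡 (2 * n + 1)) x₀).target) :
    ContDiffAt ℝ ∞ (α.inChart x₀) y :=
  (hα.contDiffOn_inChart x₀).contDiffAt ((isOpen_extChartAt_target x₀).mem_nhds hy)

/-- The exterior derivative of a `1`-form on a vector space. -/
lemma extDeriv_ofSubsingleton_apply {E : Type*} [NormedAddCommGroup E] [NormedSpace ℝ E]
    {a : E → E →L[ℝ] ℝ} {y : E} (ha : DifferentiableAt ℝ a y) (u v : E) :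
    extDeriv (fun y ↦ ContinuousAlternatingMap.ofSubsingleton ℝ E ℝ (0 : Fin 1) (a y)) y ![u, v] =
      fderiv ℝ a y u v - fderiv ℝ a y v u := by
  let L : (E →L[ℝ] ℝ) →L[ℝ] (E [⋀^Fin 1]→L[ℝ] ℝ) :=
    (ContinuousAlternatingMap.ofSubsingletonLIE (𝕜 := ℝ) (E := E) (F := ℝ)
      (0 : Fin 1)).toContinuousLinearEquiv.toContinuousLinearMap
  have hd : HasFDerivAt (fun y ↦ ContinuousAlternatingMap.ofSubsingleton ℝ E ℝ (0 : Fin 1) (a y))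
      (L.comp (fderiv ℝ a y)) y := L.hasFDerivAt.comp y ha.hasFDerivAt
  have hev : ∀ w z : E, fderiv ℝ (fun x ↦ a x z) y w = fderiv ℝ a y w z := fun w z ↦ by
    rw [(ha.hasFDerivAt.clm_apply (hasFDerivAt_const z y)).fderiv]
    simp
  rw [extDeriv_apply hd.differentiableAt, Fin.sum_univ_two]
  change (-1) ^ 0 • fderiv ℝ (fun x ↦ a x v) y u + (-1) ^ 1 • fderiv ℝ (fun x ↦ a x u) y v = _
  rw [hev, hev]
  simp [sub_eq_add_neg]

lemma two_le_infty : (2 : WithTop ℕ∞) ≤ ∞ := WithTop.coe_le_coe.2 (le_top : (2 : ℕ∞) ≤ ⊤)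

/-- The exterior derivative can be computed in any chart. -/
lemma SmoothOneForm.d_eq (hα : SmoothOneForm α) {x₀ x : M}
    (hx : x ∈ (chartAt (Model n) x₀).source) (u v : TangentSpace (𝓡 (2 * n + 1)) x) :
    α.d x u v =
      fderiv ℝ (α.inChart x₀) (extChartAt (𝓡 (2 * n + 1)) x₀ x) (chartDeriv x₀ x u)
          (chartDeriv x₀ x v) -
        fderiv ℝ (α.inChart x₀) (extChartAt (𝓡 (2 * n + 1)) x₀ x) (chartDeriv x₀ x v)
          (chartDeriv x₀ x u) := by
  set φ := extChartAt (𝓡 (2 * n + 1)) x₀ with hφ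
  set ψ := extChartAt (𝓡 (2 * n + 1)) x with hψ
  have hxt : ψ x ∈ ψ.target := mem_extChartAt_target x
  have hxs : φ x ∈ φ.target := φ.map_source (by rwa [hφ, extChartAt_source])
  have hxψ : ψ.symm (ψ x) = x := extChartAt_to_inv x
  -- `α.d x` is defined by the chart at `x` itself. The transition map `τ` pulls the expression in
  -- the chart at `x₀` back to that one, and `d` commutes with pullback.
  let τ : Model n → Model n := fun y ↦ φ (ψ.symm y)
  have hev : ∀ᶠ y in nhds (ψ x), y ∈ ψ.target ∧ ψ.symm y ∈ (chartAt (Model n) x₀).source := by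
    refine Filter.Eventually.and (extChartAt_target_mem_nhds x) ?_
    refine (continuousAt_extChartAt_symm x).eventually ?_
    rw [← hψ, hxψ]
    exact (chartAt (Model n) x₀).open_source.mem_nhds hx
  have hτ : ContDiffAt ℝ ∞ τ (ψ x) := by
    rw [← contMDiffAt_iff_contDiffAt]
    refine ContMDiffAt.comp (ψ x) (I' := 𝓡 (2 * n + 1)) (g := φ) ?_
      (contMDiffAt_extChartAt_symm hxt)
    refine contMDiffAt_extChartAt' ?_
    rw [hxψ]; exact hx
  have hpull : (fun y ↦ ContinuousAlternatingMap.ofSubsingleton ℝ (Model n) ℝ (0 : Fin 1)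
      (α.inChart x y)) =ᶠ[nhds (ψ x)]
      fun y ↦ (ContinuousAlternatingMap.ofSubsingleton ℝ (Model n) ℝ (0 : Fin 1)
        (α.inChart x₀ (τ y))).compContinuousLinearMap (fderiv ℝ τ y) := by
    filter_upwards [hev] with y ⟨hy, hy'⟩
    ext w
    change α (ψ.symm y) (vderiv ψ.symm y (w 0)) =
      α.inChart x₀ (φ (ψ.symm y)) (fderiv ℝ τ y (w 0))
    rw [← inChart_extChartAt α hy']
    exact congrArg _ (chartDeriv_vderiv
      ((contMDiffAt_extChartAt_symm hy).mdifferentiableAt (by simp)) hy' _)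
  have hdiff : DifferentiableAt ℝ (α.inChart x₀) (τ (ψ x)) := by
    have : τ (ψ x) = φ x := congrArg φ hxψ
    rw [this]
    exact (hα.contDiffAt_inChart x₀ hxs).differentiableAt (by simp)
  have hτx : τ (ψ x) = φ x := congrArg φ hxψ
  have hD : ∀ w : TangentSpace (𝓡 (2 * n + 1)) x,
      fderiv ℝ τ (ψ x) (chartDeriv x x w) = chartDeriv x₀ x w := by
    intro w
    have hdτ : MDifferentiableAt 𝓘(ℝ, Model n) 𝓘(ℝ, Model n) τ (ψ x) :=
      (hτ.differentiableAt (by simp)).mdifferentiableAt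
    have h1 : (fun z ↦ τ (ψ z)) =ᶠ[nhds x] φ := by
      filter_upwards [extChartAt_source_mem_nhds (I := 𝓡 (2 * n + 1)) x] with z hz
      exact congrArg φ (ψ.left_inv hz)
    have h2 := mfderiv_comp x hdτ (mdifferentiableAt_extChartAt' (mem_chart_source _ x))
    have h3 := h1.mfderiv_eq (I := 𝓡 (2 * n + 1)) (I' := 𝓘(ℝ, Model n))
    rw [mfderiv_eq_fderiv] at h2
    have h4 := h2.symm.trans h3
    exact congrArg (fun L ↦ L w) h4
  have h0 : α.d x u v = extDeriv (fun y ↦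
      ContinuousAlternatingMap.ofSubsingleton ℝ (Model n) ℝ (0 : Fin 1) (α.inChart x y)) (ψ x)
      ![chartDeriv x x u, chartDeriv x x v] := rfl
  have hω : DifferentiableAt ℝ (fun y ↦
      ContinuousAlternatingMap.ofSubsingleton ℝ (Model n) ℝ (0 : Fin 1) (α.inChart x₀ y))
      (τ (ψ x)) :=
    ((ContinuousAlternatingMap.ofSubsingletonLIE (𝕜 := ℝ) (E := Model n) (F := ℝ)
      (0 : Fin 1)).toContinuousLinearEquiv.differentiableAt).comp _ hdiff
  rw [h0, hpull.extDeriv_eq, extDeriv_pullback hω hτ (by simpa using two_le_infty), hτx]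
  change extDeriv _ (φ x) (fderiv ℝ τ (ψ x) ∘ ![chartDeriv x x u, chartDeriv x x v]) = _
  have hcomp : fderiv ℝ τ (ψ x) ∘ ![chartDeriv x x u, chartDeriv x x v] =
      ![chartDeriv x₀ x u, chartDeriv x₀ x v] := by
    rw [← hD u, ← hD v]
    ext i : 1
    fin_cases i <;> rfl
  rw [hcomp]
  exact extDeriv_ofSubsingleton_apply (hτx ▸ hdiff) _ _

end ChartForms

/-! ### The mixed derivative formula for `dα`, and smoothness of solutions of the contact equation.
-/

section ContactForms

variable {n : ℕ} {M : Type*} [TopologicalSpace M] [ChartedSpace (Model n) M]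
  [IsManifold (𝓡 (2 * n + 1)) ∞ M] {α : OneForm n M} {ξ : Distribution n M}

/-- Two-parameter form of the exterior derivative: for a map `f` from a normed space,
`∂ᵤ(α(∂ᵥ f)) - ∂ᵥ(α(∂ᵤ f)) = dα(∂ᵤ f, ∂ᵥ f)`. -/
lemma SmoothOneForm.fderiv_sub_fderiv (hα : SmoothOneForm α) {F : Type*} [NormedAddCommGroup F]
    [NormedSpace ℝ F] {f : F → M} {p : F} (hf : ContMDiffAt 𝓘(ℝ, F) (𝓡 (2 * n + 1)) ∞ f p)
    (u v : F) :
    fderiv ℝ (fun q ↦ α (f q) (vderiv f q v)) p u - fderiv ℝ (fun q ↦ α (f q) (vderiv f q u)) p v =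
      α.d (f p) (vderiv f p u) (vderiv f p v) := by
  have : IsManifold (𝓡 (2 * n + 1)) 1 M := .of_le (n := ∞) (by simp)
  have hf1 : ∀ᶠ q in nhds p, ContMDiffAt 𝓘(ℝ, F) (𝓡 (2 * n + 1)) 1 f q :=
    (contMDiffAt_iff_contMDiffAt_nhds (by simp)).1 (hf.of_le (m := 1) (by simp))
  set φ := extChartAt (𝓡 (2 * n + 1)) (f p) with hφ
  have hsrc : ∀ᶠ q in nhds p, f q ∈ (chartAt (Model n) (f p)).source :=
    hf.continuousAt.eventually ((chartAt (Model n) (f p)).open_source.mem_nhds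
      (mem_chart_source _ _))
  set g : F → Model n := fun q ↦ φ (f q) with hg
  have hgs : ContDiffAt ℝ ∞ g p := by
    rw [← contMDiffAt_iff_contDiffAt]
    exact contMDiffAt_extChartAt.comp p hf
  set a := α.inChart (f p) with ha
  have has : ContDiffAt ℝ ∞ a (g p) := hα.contDiffAt_inChart _ (mem_extChartAt_target _)
  have key : ∀ w : F, (fun q ↦ α (f q) (vderiv f q w)) =ᶠ[nhds p]
      fun q ↦ a (g q) (fderiv ℝ g q w) := by
    intro w
    filter_upwards [hf1, hsrc] with q hq hqs
    rw [← inChart_extChartAt α hqs, chartDeriv_vderiv (hq.mdifferentiableAt (by simp)) hqs]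
  have hd2 : DifferentiableAt ℝ (fderiv ℝ g) p :=
    (hgs.fderiv_right (m := 1) two_le_infty).differentiableAt (by simp)
  have hga : HasFDerivAt (fun q ↦ a (g q)) ((fderiv ℝ a (g p)).comp (fderiv ℝ g p)) p :=
    (has.differentiableAt (by simp)).hasFDerivAt.comp p (hgs.differentiableAt (by simp)).hasFDerivAt
  have hder : ∀ w z : F, fderiv ℝ (fun q ↦ a (g q) (fderiv ℝ g q w)) p z =
      fderiv ℝ a (g p) (fderiv ℝ g p z) (fderiv ℝ g p w) +
        a (g p) (fderiv ℝ (fderiv ℝ g) p z w) := by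
    intro w z
    have h1 : HasFDerivAt (fun q ↦ fderiv ℝ g q w) _ p :=
      hd2.hasFDerivAt.clm_apply (hasFDerivAt_const w p)
    rw [(hga.clm_apply h1).fderiv]
    simp [add_comm]
  have hsymm : fderiv ℝ (fderiv ℝ g) p u v = fderiv ℝ (fderiv ℝ g) p v u :=
    (hgs.isSymmSndFDerivAt (by simpa using two_le_infty)) u v
  rw [(key v).fderiv_eq, (key u).fderiv_eq, hder, hder, hsymm,
    hα.d_eq (mem_chart_source _ (f p)),
    chartDeriv_vderiv (hf.mdifferentiableAt (by simp)) (mem_chart_source _ _),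
    chartDeriv_vderiv (hf.mdifferentiableAt (by simp)) (mem_chart_source _ _)]
  ring

/-- The exterior derivative of a smooth `1`-form, as a bilinear form. -/
lemma SmoothOneForm.exists_bilin (hα : SmoothOneForm α) (x : M) :
    ∃ B : TangentSpace (𝓡 (2 * n + 1)) x →ₗ[ℝ] TangentSpace (𝓡 (2 * n + 1)) x →ₗ[ℝ] ℝ,
      ∀ u v, B u v = α.d x u v :=
  ⟨LinearMap.mk₂ ℝ (α.d x)
    (fun u v w ↦ by
      simp only [hα.d_eq (mem_chart_source _ x), map_add, add_apply]
      ring)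
    (fun c u v ↦ by
      simp only [hα.d_eq (mem_chart_source _ x), map_smul, smul_apply,
        smul_eq_mul]
      ring)
    (fun u v w ↦ by
      simp only [hα.d_eq (mem_chart_source _ x), map_add, add_apply]
      ring)
    (fun c u v ↦ by
      simp only [hα.d_eq (mem_chart_source _ x), map_smul, smul_apply,
        smul_eq_mul]
      ring), fun _ _ ↦ rfl⟩

lemma IsContactForm.exists_isContactPair (hα : IsContactForm ξ α) (x : M) :
    ∃ B : TangentSpace (𝓡 (2 * n + 1)) x →ₗ[ℝ] TangentSpace (𝓡 (2 * n + 1)) x →ₗ[ℝ] ℝ,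
      (∀ u v, B u v = α.d x u v) ∧ IsContactPair n (α x).toLinearMap B := by
  obtain ⟨B, hB⟩ := hα.smooth.exists_bilin x
  refine ⟨B, hB, ?_, fun v ↦ ?_, ?_⟩
  · exact (finrank_euclideanSpace_fin (𝕜 := ℝ) : Module.finrank ℝ (Model n) = 2 * n + 1)
  · rw [hB, hα.smooth.d_eq (mem_chart_source _ x), sub_self]
  · obtain ⟨w, hw⟩ := hα.wedge_ne_zero x
    refine ⟨w, fun h0 ↦ hw ?_⟩
    rw [MultilinearMap.alternatization_apply] at h0
    rw [OneForm.wedgePow]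
    refine mul_eq_zero_of_right _ (Eq.trans (Finset.sum_congr rfl fun σ _ ↦ ?_) h0)
    rw [Units.smul_def, zsmul_eq_mul]
    congr 1
    refine congrArg _ (Finset.prod_congr rfl fun i _ ↦ ?_)
    exact (hB _ _).symm

lemma _root_.ContDiffAt.clm_flip {E F G H : Type*} [NormedAddCommGroup E] [NormedSpace ℝ E]
    [NormedAddCommGroup F] [NormedSpace ℝ F] [NormedAddCommGroup G] [NormedSpace ℝ G]
    [NormedAddCommGroup H] [NormedSpace ℝ H] {k : WithTop ℕ∞} {f : H → E →L[ℝ] F →L[ℝ] G} {x : H}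
    (hf : ContDiffAt ℝ k f x) : ContDiffAt ℝ k (fun y ↦ (f y).flip) x := by
  have h := LinearIsometryEquiv.contDiff (n := k) (𝕜 := ℝ) (E := E →L[ℝ] F →L[ℝ] G)
    (F := F →L[ℝ] E →L[ℝ] G)
    (ContinuousLinearMap.flipₗᵢ ℝ E F G)
  exact ContDiffAt.comp (F := E →L[ℝ] F →L[ℝ] G) (G := F →L[ℝ] E →L[ℝ] G) x h.contDiffAt hf

/-- A vector field determined by a smooth linear equation involving a contact form is smooth. -/
lemma IsContactForm.contMDiff_of_d_add_eq (hα : IsContactForm ξ α) {β : OneForm n M}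
    (hβ : ∀ x₀ : M, ContDiffOn ℝ ∞ (β.inChart x₀) (extChartAt (𝓡 (2 * n + 1)) x₀).target)
    {X : (x : M) → TangentSpace (𝓡 (2 * n + 1)) x}
    (hX : ∀ x u, α.d x (X x) u + α x (X x) * α x u = β x u) :
    ContMDiff (𝓡 (2 * n + 1)) (𝓡 (2 * n + 1)).tangent ∞
      (fun x ↦ (⟨x, X x⟩ : TangentBundle (𝓡 (2 * n + 1)) M)) := by
  intro x₀
  set φ := extChartAt (𝓡 (2 * n + 1)) x₀ with hφ
  set a := α.inChart x₀ with ha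
  have hsrc : ∀ᶠ x in nhds x₀, x ∈ (chartAt (Model n) x₀).source :=
    (chartAt (Model n) x₀).open_source.mem_nhds (mem_chart_source _ _)
  -- the linear equation written in the chart
  let T : Model n → Model n →L[ℝ] Model n →L[ℝ] ℝ := fun y ↦
    fderiv ℝ a y - (fderiv ℝ a y).flip + (a y).smulRight (a y)
  have hT : ∀ x ∈ (chartAt (Model n) x₀).source, ∀ v u : TangentSpace (𝓡 (2 * n + 1)) x,
      T (φ x) (chartDeriv x₀ x v) (chartDeriv x₀ x u) = α.d x v u + α x v * α x u := by
    intro x hx v u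
    rw [hα.smooth.d_eq hx, ← inChart_extChartAt α hx v, ← inChart_extChartAt α hx u]
    rfl
  have hTs : ContDiffAt ℝ ∞ T (φ x₀) := by
    have h1 : ContDiffAt ℝ ∞ a (φ x₀) := hα.smooth.contDiffAt_inChart _ (mem_extChartAt_target _)
    have h2 : ContDiffAt ℝ ∞ (fderiv ℝ a) (φ x₀) := h1.fderiv_right (by simp)
    exact (h2.sub h2.clm_flip).add (h1.smulRight h1)
  have hinv : ∀ x ∈ (chartAt (Model n) x₀).source, (T (φ x)).IsInvertible := by
    intro x hx
    have hinj : Function.Injective (T (φ x)) := by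
      intro v w hvw
      obtain ⟨v, rfl⟩ := (chartDeriv_bijective (E := Model n) hx).2 v
      obtain ⟨w, rfl⟩ := (chartDeriv_bijective (E := Model n) hx).2 w
      obtain ⟨B, hB, hp⟩ := hα.exists_isContactPair x
      congr 1
      refine hp.eq_of_apply_add_eq fun u ↦ ?_
      have := congrArg (fun l ↦ l (chartDeriv x₀ x u)) hvw
      simp only [hT x hx] at this
      rw [hB, hB]
      exact this
    have hfin : Module.finrank ℝ (Model n) = Module.finrank ℝ (Model n →L[ℝ] ℝ) := by
      rw [← (LinearMap.toContinuousLinearMap (𝕜 := ℝ) (E := Model n) (F' := ℝ)).finrank_eq]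
      exact (Subspace.dual_finrank_eq (K := ℝ) (V := Model n)).symm
    let e := (LinearEquiv.ofBijective (T (φ x)).toLinearMap ⟨hinj,
      (LinearMap.injective_iff_surjective_of_finrank_eq_finrank hfin).1
        hinj⟩).toContinuousLinearEquiv
    exact ⟨e, by ext; rfl⟩
  have hsol : ∀ x ∈ (chartAt (Model n) x₀).source,
      chartDeriv x₀ x (X x) = (T (φ x)).inverse (β.inChart x₀ (φ x)) := by
    intro x hx
    have h1 : T (φ x) (chartDeriv x₀ x (X x)) = β.inChart x₀ (φ x) := by
      refine ContinuousLinearMap.ext fun u ↦ ?_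
      obtain ⟨u, rfl⟩ := (chartDeriv_bijective (E := Model n) hx).2 u
      rw [hT x hx, hX, inChart_extChartAt β hx]
    obtain ⟨e, he⟩ := hinv x hx
    rw [← h1, ← he, ContinuousLinearMap.inverse_equiv]
    exact (e.symm_apply_apply _).symm
  rw [contMDiffAt_vectorField_iff (mem_chart_source _ x₀)]
  -- Inversion of continuous linear maps is smooth at an invertible map.
  have hsm : ContDiffAt ℝ ∞ (fun y ↦ (T y).inverse (β.inChart x₀ y)) (φ x₀) := by
    obtain ⟨e, he⟩ := hinv x₀ (mem_chart_source _ x₀)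
    have h1 : ContDiffAt ℝ ∞ (ContinuousLinearMap.inverse : (Model n →L[ℝ] Model n →L[ℝ] ℝ) → _)
        (T (φ x₀)) := he ▸ contDiffAt_map_inverse e
    exact (h1.comp _ hTs).clm_apply ((hβ x₀).contDiffAt (extChartAt_target_mem_nhds x₀))
  refine (hsm.contMDiffAt.comp x₀ contMDiffAt_extChartAt).congr_of_eventuallyEq ?_
  filter_upwards [hsrc] with x hx
  exact hsol x hx

end ContactForms

/-! ### The Reeb field and contact vector fields with given Hamiltonian. -/

section ContactVectorFields

variable {n : ℕ} {M : Type*} [TopologicalSpace M] [ChartedSpace (Model n) M]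
  [IsManifold (𝓡 (2 * n + 1)) ∞ M] {α : OneForm n M} {ξ : Distribution n M}

lemma IsContactForm.eq_of_d_add_eq (hα : IsContactForm ξ α) {x : M}
    {v w : TangentSpace (𝓡 (2 * n + 1)) x}
    (h : ∀ u, α.d x v u + α x v * α x u = α.d x w u + α x w * α x u) : v = w := by
  obtain ⟨B, hB, hp⟩ := hα.exists_isContactPair x
  refine hp.eq_of_apply_add_eq fun u ↦ ?_
  rw [hB, hB]
  exact h u

/-- The Reeb field solves the equation `dα(R, ·) + α(R) α = α`, whose right-hand side is smooth;
this is what makes the pointwise choice smooth. -/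
lemma IsContactForm.exists_reeb (hα : IsContactForm ξ α) :
    ∃ R : (x : M) → TangentSpace (𝓡 (2 * n + 1)) x,
      (∀ x, α x (R x) = 1 ∧ ∀ v, α.d x (R x) v = 0) ∧
      ContMDiff (𝓡 (2 * n + 1)) (𝓡 (2 * n + 1)).tangent ∞
        (fun x ↦ (⟨x, R x⟩ : TangentBundle (𝓡 (2 * n + 1)) M)) := by
  have h : ∀ x, ∃ R : TangentSpace (𝓡 (2 * n + 1)) x, α x R = 1 ∧ ∀ v, α.d x R v = 0 := by
    intro x
    obtain ⟨B, hB, hp⟩ := hα.exists_isContactPair x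
    obtain ⟨R, h1, h2⟩ := hp.exists_reeb
    exact ⟨R, h1, fun v ↦ (hB R v).symm.trans (h2 v)⟩
  choose R hR using h
  refine ⟨R, hR, hα.contMDiff_of_d_add_eq (β := α) hα.smooth.contDiffOn_inChart fun x u ↦ ?_⟩
  rw [(hR x).1, (hR x).2, zero_add, one_mul]

lemma IsContactForm.reeb_unique (hα : IsContactForm ξ α) {x : M}
    {R S : TangentSpace (𝓡 (2 * n + 1)) x} (hR : α x R = 1 ∧ ∀ v, α.d x R v = 0)
    (hS : α x S = 1 ∧ ∀ v, α.d x S v = 0) : R = S :=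
  hα.eq_of_d_add_eq fun u ↦ by rw [hR.1, hR.2, hS.1, hS.2]

/-- The differential of a function, as a `1`-form. -/
noncomputable def differential (H : M → ℝ) : OneForm n M := fun x ↦
  mfderiv (𝓡 (2 * n + 1)) 𝓘(ℝ, ℝ) H x

lemma differential_inChart {H : M → ℝ} (hH : ContMDiff (𝓡 (2 * n + 1)) 𝓘(ℝ, ℝ) ∞ H) {x₀ : M}
    {y : Model n} (hy : y ∈ (extChartAt (𝓡 (2 * n + 1)) x₀).target) :
    (differential H).inChart x₀ y =
      fderiv ℝ (fun z ↦ H ((extChartAt (𝓡 (2 * n + 1)) x₀).symm z)) y := by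
  rw [← mfderiv_eq_fderiv]
  exact (mfderiv_comp (I' := 𝓡 (2 * n + 1)) y (hH.mdifferentiableAt (by simp))
    ((contMDiffAt_extChartAt_symm hy).mdifferentiableAt (by simp))).symm

lemma contDiffOn_inChart_differential {H : M → ℝ} (hH : ContMDiff (𝓡 (2 * n + 1)) 𝓘(ℝ, ℝ) ∞ H)
    (x₀ : M) : ContDiffOn ℝ ∞ ((differential H).inChart x₀)
      (extChartAt (𝓡 (2 * n + 1)) x₀).target := by
  have h : ContDiffOn ℝ ∞ (fun z ↦ H ((extChartAt (𝓡 (2 * n + 1)) x₀).symm z))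
      (extChartAt (𝓡 (2 * n + 1)) x₀).target := fun y hy ↦
    ((hH.contMDiffAt.comp (I' := 𝓡 (2 * n + 1)) y
      (contMDiffAt_extChartAt_symm hy)).contDiffAt).contDiffWithinAt
  exact (h.fderiv_of_isOpen (isOpen_extChartAt_target x₀) (by simp)).congr
    fun y hy ↦ differential_inChart hH hy

/-- The value of the differential of a smooth function on a smooth vector field is smooth. -/
lemma contMDiff_differential_apply {H : M → ℝ} (hH : ContMDiff (𝓡 (2 * n + 1)) 𝓘(ℝ, ℝ) ∞ H)
    {X : (x : M) → TangentSpace (𝓡 (2 * n + 1)) x}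
    (hX : ContMDiff (𝓡 (2 * n + 1)) (𝓡 (2 * n + 1)).tangent ∞
      (fun x ↦ (⟨x, X x⟩ : TangentBundle (𝓡 (2 * n + 1)) M))) :
    ContMDiff (𝓡 (2 * n + 1)) 𝓘(ℝ, ℝ) ∞ (fun x ↦ differential H x (X x)) := by
  intro x₀
  have h1 := (contMDiffAt_vectorField_iff (mem_chart_source (Model n) x₀)).1 (hX x₀)
  have h2 : ContMDiffAt (𝓡 (2 * n + 1)) 𝓘(ℝ, Model n →L[ℝ] ℝ) ∞
      (fun x ↦ (differential H).inChart x₀ (extChartAt (𝓡 (2 * n + 1)) x₀ x)) x₀ :=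
    ((contDiffOn_inChart_differential hH x₀).contDiffAt
      (extChartAt_target_mem_nhds x₀)).contMDiffAt.comp x₀ contMDiffAt_extChartAt
  refine (h2.clm_apply h1).congr_of_eventuallyEq ?_
  filter_upwards [(chartAt (Model n) x₀).open_source.mem_nhds (mem_chart_source _ x₀)] with x hx
  exact (inChart_extChartAt _ hx _).symm

/-- Every smooth function is the Hamiltonian of a smooth contact vector field. -/
lemma IsContactForm.exists_contactVectorField (hα : IsContactForm ξ α)
    {R : (x : M) → TangentSpace (𝓡 (2 * n + 1)) x}
    (hR : ∀ x, α x (R x) = 1 ∧ ∀ v, α.d x (R x) v = 0) {H : M → ℝ}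
    (hH : ContMDiff (𝓡 (2 * n + 1)) 𝓘(ℝ, ℝ) ∞ H) :
    ∃ X : (x : M) → TangentSpace (𝓡 (2 * n + 1)) x,
      (∀ x, α x (X x) = H x) ∧
      (∀ x u, α.d x (X x) u = differential H x (R x) * α x u - differential H x u) ∧
      ContMDiff (𝓡 (2 * n + 1)) (𝓡 (2 * n + 1)).tangent ∞
        (fun x ↦ (⟨x, X x⟩ : TangentBundle (𝓡 (2 * n + 1)) M)) := by
  have hRs : ContMDiff (𝓡 (2 * n + 1)) (𝓡 (2 * n + 1)).tangent ∞
      (fun x ↦ (⟨x, R x⟩ : TangentBundle (𝓡 (2 * n + 1)) M)) :=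
    hα.contMDiff_of_d_add_eq (β := α) hα.smooth.contDiffOn_inChart fun x u ↦ by
      rw [(hR x).1, (hR x).2, zero_add, one_mul]
  -- The two conditions `α(X) = H` and `dα(X, ·) = dH(R) α - dH` combine into one equation with
  -- right-hand side `(dH(R) + H) α - dH`. Evaluating it on `R` recovers the first condition, and
  -- then subtraction recovers the second.
  let f : M → ℝ := fun x ↦ differential H x (R x) + H x
  have hf : ContMDiff (𝓡 (2 * n + 1)) 𝓘(ℝ, ℝ) ∞ f := (contMDiff_differential_apply hH hRs).add hH
  let β : OneForm n M := fun x ↦ f x • α x - differential H x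
  have hex : ∀ x, ∃ X : TangentSpace (𝓡 (2 * n + 1)) x,
      ∀ u, α.d x X u + α x X * α x u = β x u := by
    intro x
    obtain ⟨B, hB, hp⟩ := hα.exists_isContactPair x
    obtain ⟨X, hX⟩ := hp.exists_apply_add_eq (β x).toLinearMap
    refine ⟨X, fun u ↦ ?_⟩
    rw [← hB]
    exact hX u
  choose X hX using hex
  have hβ : ∀ x u, β x u = f x * α x u - differential H x u := fun _ _ ↦ rfl
  have hd : ∀ x, α.d x (X x) (R x) = 0 := by
    intro x
    obtain ⟨B, hB, hp⟩ := hα.exists_isContactPair x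
    rw [← hB, hp.swap, hB, (hR x).2, neg_zero]
  have hXH : ∀ x, α x (X x) = H x := by
    intro x
    have := hX x (R x)
    rw [hd, hβ, (hR x).1] at this
    simp only [f] at this
    linarith
  refine ⟨X, hXH, fun x u ↦ ?_, hα.contMDiff_of_d_add_eq (β := β) (fun x₀ ↦ ?_) hX⟩
  · have := hX x u
    rw [hβ, hXH] at this
    simp only [f] at this
    linarith
  · have h1 : ContDiffOn ℝ ∞ (fun y ↦ f ((extChartAt (𝓡 (2 * n + 1)) x₀).symm y))
        (extChartAt (𝓡 (2 * n + 1)) x₀).target := fun y hy ↦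
      ((hf.contMDiffAt.comp (I' := 𝓡 (2 * n + 1)) y
        (contMDiffAt_extChartAt_symm hy)).contDiffAt).contDiffWithinAt
    exact (h1.smul (hα.smooth.contDiffOn_inChart x₀)).sub (contDiffOn_inChart_differential hH x₀)

end ContactVectorFields

/-! ### Flows that preserve the contact structure. -/

section ContactFlows

variable {n : ℕ} {M : Type*} [TopologicalSpace M] [ChartedSpace (Model n) M]
  [IsManifold (𝓡 (2 * n + 1)) ∞ M] {α : OneForm n M} {ξ : Distribution n M}

/-- To prove a property of tangent vectors it is enough to consider velocity vectors of
parametrizations. -/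
lemma tangent_induction {P : (x : M) → TangentSpace (𝓡 (2 * n + 1)) x → Prop}
    (h : ∀ (c : Model n → M) (y w : Model n), ContMDiffAt 𝓘(ℝ, Model n) (𝓡 (2 * n + 1)) ∞ c y →
      P (c y) (vderiv c y w)) (x : M) (v : TangentSpace (𝓡 (2 * n + 1)) x) : P x v := by
  have key : ∀ (x₀ : M), ∀ y ∈ (extChartAt (𝓡 (2 * n + 1)) x₀).target,
      ∀ v, P ((extChartAt (𝓡 (2 * n + 1)) x₀).symm y) v := by
    intro x₀ y hy v
    have := h (extChartAt (𝓡 (2 * n + 1)) x₀).symm y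
      (chartDeriv x₀ ((extChartAt (𝓡 (2 * n + 1)) x₀).symm y) v) (contMDiffAt_extChartAt_symm hy)
    rwa [vderiv_symm_chartDeriv hy] at this
  have := key x _ (mem_extChartAt_target x)
  rw [extChartAt_to_inv x] at this
  exact this v

omit [IsManifold (𝓡 (2 * n + 1)) ∞ M] in
lemma apply_mfderiv_of_eq_id {φ : M → M} (h : φ = id) (x : M)
    (v : TangentSpace (𝓡 (2 * n + 1)) x) :
    α (φ x) (mfderiv (𝓡 (2 * n + 1)) (𝓡 (2 * n + 1)) φ x v) = α x v := by
  subst h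
  exact congrArg (fun L ↦ α x (L v)) mfderiv_id

lemma SmoothOneForm.contDiffAt_apply_vderiv (hα : SmoothOneForm α) {F : Type*}
    [NormedAddCommGroup F] [NormedSpace ℝ F] {f : F → M} {p : F}
    (hf : ContMDiffAt 𝓘(ℝ, F) (𝓡 (2 * n + 1)) ∞ f p) (w : F) :
    ContDiffAt ℝ ∞ (fun q ↦ α (f q) (vderiv f q w)) p := by
  have : IsManifold (𝓡 (2 * n + 1)) 1 M := .of_le (n := ∞) (by simp)
  have hf1 : ∀ᶠ q in nhds p, ContMDiffAt 𝓘(ℝ, F) (𝓡 (2 * n + 1)) 1 f q :=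
    (contMDiffAt_iff_contMDiffAt_nhds (by simp)).1 (hf.of_le (m := 1) (by simp))
  have hsrc : ∀ᶠ q in nhds p, f q ∈ (chartAt (Model n) (f p)).source :=
    hf.continuousAt.eventually ((chartAt (Model n) (f p)).open_source.mem_nhds
      (mem_chart_source _ _))
  have hgs : ContDiffAt ℝ ∞ (fun q ↦ extChartAt (𝓡 (2 * n + 1)) (f p) (f q)) p := by
    rw [← contMDiffAt_iff_contDiffAt]
    exact contMDiffAt_extChartAt.comp p hf
  have has : ContDiffAt ℝ ∞ (α.inChart (f p)) (extChartAt (𝓡 (2 * n + 1)) (f p) (f p)) :=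
    hα.contDiffAt_inChart _ (mem_extChartAt_target _)
  have h := (has.comp p hgs).clm_apply
    ((hgs.fderiv_right (m := ∞) (by simp)).clm_apply (contDiffAt_const (c := w)))
  refine h.congr_of_eventuallyEq ?_
  filter_upwards [hf1, hsrc] with q hq hqs
  rw [← inChart_extChartAt α hqs, chartDeriv_vderiv (hq.mdifferentiableAt (by simp)) hqs]
  rfl

omit [IsManifold (𝓡 (2 * n + 1)) ∞ M] in
/-- The derivative of a composition with a map between manifolds. -/
lemma mfderiv_vderiv {F : Type*} [NormedAddCommGroup F] [NormedSpace ℝ F] {c : F → M} {y : F}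
    {φ : M → M} (hc : MDifferentiableAt 𝓘(ℝ, F) (𝓡 (2 * n + 1)) c y)
    (hφ : MDifferentiableAt (𝓡 (2 * n + 1)) (𝓡 (2 * n + 1)) φ (c y)) (w : F) :
    vderiv (fun q ↦ φ (c q)) y w =
      mfderiv (𝓡 (2 * n + 1)) (𝓡 (2 * n + 1)) φ (c y) (vderiv c y w) :=
  congrArg (fun L ↦ L w) (mfderiv_comp y hφ hc)

omit [IsManifold (𝓡 (2 * n + 1)) ∞ M] in
lemma vderiv_comp_apply {F G : Type*} [NormedAddCommGroup F] [NormedSpace ℝ F]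
    [NormedAddCommGroup G] [NormedSpace ℝ G] {f : F → M} {g : G → F} {y : G} {g' : G →L[ℝ] F}
    (hf : MDifferentiableAt 𝓘(ℝ, F) (𝓡 (2 * n + 1)) f (g y)) (hg : HasFDerivAt g g' y) (w : G) :
    vderiv (n := n) (fun q ↦ f (g q)) y w = vderiv (n := n) f (g y) (g' w) :=
  congrArg (fun L ↦ L w) (hf.hasMFDerivAt.comp y hg.hasMFDerivAt).mfderiv

omit [IsManifold (𝓡 (2 * n + 1)) ∞ M] in
lemma vderiv_eq_of_isMIntegralCurve {γ : ℝ → M} {X : (x : M) → TangentSpace (𝓡 (2 * n + 1)) x}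
    (h : IsMIntegralCurve (I := 𝓡 (2 * n + 1)) γ X) (t : ℝ) : vderiv γ t 1 = X (γ t) := by
  have := congrArg (fun L ↦ L (1 : ℝ)) (h t).mfderiv
  exact this.trans (one_smul ℝ (X (γ t)))

/-- If `L_X α = k α`, then the flow `θ` of `X` satisfies `θ_t^* α = exp (∫ k) α`. -/
lemma SmoothOneForm.apply_mfderiv_flow (hα : SmoothOneForm α)
    {X : (x : M) → TangentSpace (𝓡 (2 * n + 1)) x} {k : M → ℝ} (hk : Continuous k)
    (hX : ContMDiff (𝓡 (2 * n + 1)) (𝓡 (2 * n + 1)).tangent ∞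
        (fun x ↦ (⟨x, X x⟩ : TangentBundle (𝓡 (2 * n + 1)) M)))
    (hXk : ∀ x u, α.d x (X x) u + differential (fun y ↦ α y (X y)) x u = k x * α x u)
    {θ : ℝ → M → M} (h0 : ∀ x, θ 0 x = x)
    (hθ : ContMDiff (𝓘(ℝ, ℝ).prod (𝓡 (2 * n + 1))) (𝓡 (2 * n + 1)) ∞
      (fun p : ℝ × M ↦ θ p.1 p.2))
    (hint : ∀ x, IsMIntegralCurve (I := 𝓡 (2 * n + 1)) (fun t ↦ θ t x) X) (t : ℝ) (x : M)
    (v : TangentSpace (𝓡 (2 * n + 1)) x) :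
    α (θ t x) (mfderiv (𝓡 (2 * n + 1)) (𝓡 (2 * n + 1)) (θ t) x v) =
      Real.exp (∫ s in (0 : ℝ)..t, k (θ s x)) * α x v := by
  refine tangent_induction (P := fun x v ↦
    α (θ t x) (mfderiv (𝓡 (2 * n + 1)) (𝓡 (2 * n + 1)) (θ t) x v) =
      Real.exp (∫ s in (0 : ℝ)..t, k (θ s x)) * α x v) (fun c y w hc ↦ ?_) x v
  have : IsManifold (𝓡 (2 * n + 1)) 1 M := .of_le (n := ∞) (by simp)
  let f : ℝ × Model n → M := fun q ↦ θ q.1 (c q.2)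
  have hf : ∀ s, ContMDiffAt 𝓘(ℝ, ℝ × Model n) (𝓡 (2 * n + 1)) ∞ f (s, y) := fun s ↦
    hθ.contMDiffAt.comp (I' := 𝓘(ℝ, ℝ).prod (𝓡 (2 * n + 1))) (s, y)
      (f := fun q : ℝ × Model n ↦ (q.1, c q.2)) (contDiff_fst.contMDiff.contMDiffAt.prodMk
        (hc.comp (s, y) contDiff_snd.contMDiff.contMDiffAt))
  have hθt : ∀ s, ContMDiff (𝓡 (2 * n + 1)) (𝓡 (2 * n + 1)) ∞ (θ s) := fun s ↦
    hθ.comp (contMDiff_const.prodMk contMDiff_id)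
  let H : M → ℝ := fun y ↦ α y (X y)
  have hH : ContMDiff (𝓡 (2 * n + 1)) 𝓘(ℝ, ℝ) ∞ H := fun z ↦
    hα.contMDiffWithinAt_apply le_rfl (hX z)
  have hft : ∀ s, ∀ᶠ q in nhds (s, y), vderiv f q (1, 0) = X (f q) := by
    intro s
    filter_upwards [(contMDiffAt_iff_contMDiffAt_nhds (by simp)).1
      ((hf s).of_le (m := 1) (by simp))] with q hq
    have h1 : HasFDerivAt (fun r : ℝ ↦ (r, q.2)) (ContinuousLinearMap.inl ℝ ℝ (Model n)) q.1 :=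
      hasFDerivAt_prodMk_left _ _
    have h2 := vderiv_comp_apply (f := f) (g := fun r : ℝ ↦ (r, q.2)) (y := q.1)
      (hq.mdifferentiableAt (by simp)) h1 1
    exact h2.symm.trans (vderiv_eq_of_isMIntegralCurve (hint (c q.2)) q.1)
  have hfw : ∀ s, vderiv f (s, y) (0, w) =
      mfderiv (𝓡 (2 * n + 1)) (𝓡 (2 * n + 1)) (θ s) (c y) (vderiv c y w) := by
    intro s
    have h1 : HasFDerivAt (fun z : Model n ↦ (s, z)) (ContinuousLinearMap.inr ℝ ℝ (Model n)) y :=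
      hasFDerivAt_prodMk_right _ _
    have h2 := vderiv_comp_apply (f := f) (g := fun z : Model n ↦ (s, z)) (y := y)
      ((hf s).mdifferentiableAt (by simp)) h1 w
    exact h2.symm.trans (mfderiv_vderiv (hc.mdifferentiableAt (by simp))
      ((hθt s).mdifferentiableAt (by simp)) w)
  -- `G (s, y)` is `α` on the transported vector. The mixed derivative formula for `∂ₛ` and `∂_w`,
  -- together with `hXk`, turns into the scalar equation `∂ₛ G = k G`.
  let G : ℝ × Model n → ℝ := fun q ↦ α (f q) (vderiv f q (0, w))
  have hG : ∀ s, HasDerivAt (fun r ↦ G (r, y)) (k (θ s (c y)) * G (s, y)) s := by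
    intro s
    have h1 := hα.fderiv_sub_fderiv (hf s) (1, 0) (0, w)
    have h2 : (fun q ↦ α (f q) (vderiv f q (1, 0))) =ᶠ[nhds (s, y)] fun q ↦ H (f q) :=
      (hft s).mono fun q hq ↦ congrArg (α (f q)) hq
    have h3 : fderiv ℝ (fun q ↦ H (f q)) (s, y) (0, w) =
        differential H (f (s, y)) (vderiv (n := n) f (s, y) (0, w)) := by
      rw [← mfderiv_eq_fderiv]
      exact congrArg (fun L ↦ L (0, w)) (mfderiv_comp (s, y) (hH.mdifferentiableAt (by simp))
        ((hf s).mdifferentiableAt (by simp)))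
    rw [h2.fderiv_eq, h3, (hft s).self_of_nhds] at h1
    have h4 := hXk (f (s, y)) (vderiv f (s, y) (0, w))
    have h5 : fderiv ℝ G (s, y) (1, 0) = k (θ s (c y)) * G (s, y) :=
      (sub_eq_iff_eq_add.1 h1).trans h4
    rw [← h5]
    have h6 : HasFDerivAt G (fderiv ℝ G (s, y)) (s, y) :=
      ((hα.contDiffAt_apply_vderiv (hf s) (0, w)).differentiableAt (by simp)).hasFDerivAt
    exact h6.comp_hasDerivAt s ((hasDerivAt_id s).prodMk (hasDerivAt_const s y))
  have hkc : Continuous fun s ↦ k (θ s (c y)) :=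
    hk.comp (hθ.continuous.comp (continuous_id.prodMk continuous_const))
  have hE : ∀ s, HasDerivAt (fun r ↦ G (r, y) * Real.exp (-∫ s in (0 : ℝ)..r, k (θ s (c y))))
      0 s := by
    intro s
    refine ((hG s).mul ((hkc.integral_hasStrictDerivAt 0 s).hasDerivAt.neg.exp)).congr_deriv ?_
    ring
  have hconst := is_const_of_deriv_eq_zero (fun s ↦ (hE s).differentiableAt)
    (fun s ↦ (hE s).deriv) t 0
  simp only [intervalIntegral.integral_same, neg_zero, Real.exp_zero, mul_one] at hconst
  have hG0 : G (0, y) = α (c y) (vderiv c y w) := by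
    refine (congrArg (α (f (0, y))) (hfw 0)).trans ?_
    exact apply_mfderiv_of_eq_id (funext h0) (c y) (vderiv c y w)
  rw [Real.exp_neg, ← div_eq_mul_inv, div_eq_iff (Real.exp_ne_zero _), hG0] at hconst
  refine (congrArg (α (f (t, y))) (hfw t)).symm.trans (hconst.trans (mul_comm _ _))

lemma IsContactForm.apply_eq_zero_iff (hα : IsContactForm ξ α) {x : M}
    {v : TangentSpace (𝓡 (2 * n + 1)) x} : α x v = 0 ↔ v ∈ ξ x := by
  rw [← hα.ker_eq x]
  exact LinearMap.mem_ker.symm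

omit [IsManifold (𝓡 (2 * n + 1)) ∞ M] in
lemma mfderiv_inverse_apply {φ ψ : M → M} (hφ : ContMDiff (𝓡 (2 * n + 1)) (𝓡 (2 * n + 1)) ∞ φ)
    (hψ : ContMDiff (𝓡 (2 * n + 1)) (𝓡 (2 * n + 1)) ∞ ψ) (h : ∀ x, ψ (φ x) = x) (x : M)
    (v : TangentSpace (𝓡 (2 * n + 1)) x) :
    mfderiv (𝓡 (2 * n + 1)) (𝓡 (2 * n + 1)) ψ (φ x)
      (mfderiv (𝓡 (2 * n + 1)) (𝓡 (2 * n + 1)) φ x v) = v := by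
  have e : ψ ∘ φ = id := funext h
  have h1 := mfderiv_comp (I' := 𝓡 (2 * n + 1)) x (hψ.mdifferentiableAt (by simp))
    (hφ.mdifferentiableAt (by simp))
  have h2 := e ▸ h1
  rw [mfderiv_id] at h2
  exact (congrArg (fun L ↦ L v) h2).symm

omit [IsManifold (𝓡 (2 * n + 1)) ∞ M] in
lemma mfderiv_bijective {φ : Equiv.Perm M}
    (hφ : ContMDiff (𝓡 (2 * n + 1)) (𝓡 (2 * n + 1)) ∞ φ)
    (hψ : ContMDiff (𝓡 (2 * n + 1)) (𝓡 (2 * n + 1)) ∞ φ.symm) (x : M) :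
    Function.Bijective (mfderiv (𝓡 (2 * n + 1)) (𝓡 (2 * n + 1)) φ x) := by
  have hinj : Function.Injective (mfderiv (𝓡 (2 * n + 1)) (𝓡 (2 * n + 1)) φ x) :=
    Function.LeftInverse.injective (mfderiv_inverse_apply hφ hψ φ.symm_apply_apply x)
  have hfin : ∀ z : M, FiniteDimensional ℝ (TangentSpace (𝓡 (2 * n + 1)) z) := fun z ↦
    inferInstanceAs (FiniteDimensional ℝ (Model n))
  have := hfin x
  have := hfin (φ x)
  exact ⟨hinj, (LinearMap.injective_iff_surjective_of_finrank_eq_finrank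
    (f := (mfderiv (𝓡 (2 * n + 1)) (𝓡 (2 * n + 1)) φ x).toLinearMap) rfl).1 hinj⟩

/-- A diffeomorphism is a contactomorphism iff it preserves the kernel of the contact form. -/
lemma IsContactForm.mem_cont_iff (hα : IsContactForm ξ α) {φ : Equiv.Perm M}
    (hφ : ContMDiff (𝓡 (2 * n + 1)) (𝓡 (2 * n + 1)) ∞ φ)
    (hψ : ContMDiff (𝓡 (2 * n + 1)) (𝓡 (2 * n + 1)) ∞ φ.symm) :
    φ ∈ Cont ξ ↔ ∀ x v,
      α (φ x) (mfderiv (𝓡 (2 * n + 1)) (𝓡 (2 * n + 1)) φ x v) = 0 ↔ α x v = 0 := by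
  refine ⟨fun h x v ↦ ?_, fun h ↦ ⟨hφ, hψ, fun x ↦ ?_⟩⟩
  · rw [hα.apply_eq_zero_iff, hα.apply_eq_zero_iff, ← h.2.2 x]
    refine ⟨fun hv ↦ ?_, fun hv ↦ ⟨v, hv, rfl⟩⟩
    obtain ⟨w, hw, hwv⟩ := hv
    rwa [← (mfderiv_bijective hφ hψ x).1 hwv]
  · ext w
    constructor
    · rintro ⟨v, hv, rfl⟩
      exact hα.apply_eq_zero_iff.1 ((h x v).2 (hα.apply_eq_zero_iff.2 hv))
    · intro hw
      obtain ⟨v, rfl⟩ := (mfderiv_bijective hφ hψ x).2 w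
      exact ⟨v, hα.apply_eq_zero_iff.1 ((h x v).1 (hα.apply_eq_zero_iff.2 hw)), rfl⟩

variable [T2Space M] [CompactSpace M]

/-- By Cartan's formula `hXk` says `L_X α = k α`, so the flow rescales `α` by a positive factor and
preserves its kernel. The path `s ↦ θ (s * t)` joins each time map to the identity. -/
lemma IsContactForm.exists_flow (hα : IsContactForm ξ α)
    {X : (x : M) → TangentSpace (𝓡 (2 * n + 1)) x} {k : M → ℝ} (hk : Continuous k)
    (hX : ContMDiff (𝓡 (2 * n + 1)) (𝓡 (2 * n + 1)).tangent ∞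
        (fun x ↦ (⟨x, X x⟩ : TangentBundle (𝓡 (2 * n + 1)) M)))
    (hXk : ∀ x u, α.d x (X x) u + differential (fun y ↦ α y (X y)) x u = k x * α x u) :
    ∃ θ : ℝ → Equiv.Perm M, θ 0 = 1 ∧ (∀ s t, θ (s + t) = θ s * θ t) ∧
      ContMDiff (𝓘(ℝ, ℝ).prod (𝓡 (2 * n + 1))) (𝓡 (2 * n + 1)) ∞
        (fun p : ℝ × M ↦ θ p.1 p.2) ∧
      (∀ x, IsMIntegralCurve (I := 𝓡 (2 * n + 1)) (fun t ↦ θ t x) X) ∧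
      (∀ t, θ t ∈ Cont₀ ξ) ∧
      ∀ t x v, α (θ t x) (mfderiv (𝓡 (2 * n + 1)) (𝓡 (2 * n + 1)) (θ t) x v) =
        Real.exp (∫ s in (0 : ℝ)..t, k (θ s x)) * α x v := by
  obtain ⟨φ, h0, hadd, hφ, hint⟩ := exists_smooth_flow hX
  have hleft : ∀ t x, φ (-t) (φ t x) = x := fun t x ↦ by rw [← hadd, neg_add_cancel, h0]
  have hright : ∀ t x, φ t (φ (-t) x) = x := fun t x ↦ by rw [← hadd, add_neg_cancel, h0]
  let θ : ℝ → Equiv.Perm M := fun t ↦ ⟨φ t, φ (-t), hleft t, hright t⟩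
  have hφt : ∀ t, ContMDiff (𝓡 (2 * n + 1)) (𝓡 (2 * n + 1)) ∞ (φ t) := fun t ↦
    hφ.comp (contMDiff_const.prodMk contMDiff_id)
  have hpull := hα.smooth.apply_mfderiv_flow hk hX hXk h0 hφ hint
  have hcont : ∀ t, θ t ∈ Cont ξ := by
    intro t
    refine (hα.mem_cont_iff (φ := θ t) (hφt t) (hφt (-t))).2 fun x v ↦ ?_
    rw [show α (θ t x) (mfderiv (𝓡 (2 * n + 1)) (𝓡 (2 * n + 1)) (θ t) x v) = _ from hpull t x v]
    exact mul_eq_zero_iff_left (Real.exp_ne_zero _)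
  have hθ0 : θ 0 = 1 := Equiv.ext h0
  refine ⟨θ, hθ0, fun s t ↦ Equiv.ext (hadd s t), hφ, hint, fun t ↦
    ⟨fun s ↦ θ (s * t), ⟨?_, fun s _ ↦ hcont _⟩, by simp [hθ0], by simp⟩, hpull⟩
  have h1 : ContMDiff 𝓘(ℝ, ℝ) 𝓘(ℝ, ℝ) ∞ (fun s : ℝ ↦ s * t) :=
    (contDiff_id.mul contDiff_const).contMDiff
  exact (hφ.comp (f := fun p : ℝ × M ↦ (p.1 * t, p.2))
    ((h1.comp contMDiff_fst).prodMk contMDiff_snd)).contMDiffOn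

end ContactFlows

/-! ### Transitivity of `Cont₀ ξ` on a connected manifold. -/

section Transitivity

variable {n : ℕ} {M : Type*} [TopologicalSpace M] [ChartedSpace (Model n) M]
  [IsManifold (𝓡 (2 * n + 1)) ∞ M] {α : OneForm n M} {ξ : Distribution n M}

/-- A smooth function with prescribed value and differential at a point. -/
lemma exists_smooth_function_with_differential [T2Space M] (z : M) (a : ℝ)
    (l : TangentSpace (𝓡 (2 * n + 1)) z →ₗ[ℝ] ℝ) :
    ∃ H : M → ℝ, ContMDiff (𝓡 (2 * n + 1)) 𝓘(ℝ, ℝ) ∞ H ∧ H z = a ∧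
      ∀ v, differential H z v = l v := by
  let D : TangentSpace (𝓡 (2 * n + 1)) z ≃ₗ[ℝ] Model n :=
    LinearEquiv.ofBijective (chartDeriv z z).toLinearMap
      (chartDeriv_bijective (E := Model n) (mem_chart_source _ z))
  let L : Model n →L[ℝ] ℝ := LinearMap.toContinuousLinearMap (l.comp D.symm.toLinearMap)
  have hL : ∀ v, L (chartDeriv z z v) = l v := fun v ↦ congrArg l (D.symm_apply_apply v)
  obtain ⟨b⟩ : Nonempty (SmoothBumpFunction (𝓡 (2 * n + 1)) z) := inferInstance
  let g : M → ℝ := fun x ↦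
    a + L (extChartAt (𝓡 (2 * n + 1)) z x - extChartAt (𝓡 (2 * n + 1)) z z)
  let g₀ : Model n → ℝ := fun y ↦ a + L (y - extChartAt (𝓡 (2 * n + 1)) z z)
  have hg₀ : ContDiff ℝ ∞ g₀ :=
    contDiff_const.add (L.contDiff.comp (contDiff_id.sub contDiff_const))
  have hgs : ∀ x ∈ (chartAt (Model n) z).source, ContMDiffAt (𝓡 (2 * n + 1)) 𝓘(ℝ, ℝ) ∞ g x :=
    fun x hx ↦ hg₀.contMDiff.contMDiffAt.comp x (contMDiffAt_extChartAt' hx)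
  have hev : (fun x ↦ b x • g x) =ᶠ[nhds z] g := by
    filter_upwards [b.eventuallyEq_one] with x hx
    rw [hx, Pi.one_apply, one_smul]
  refine ⟨fun x ↦ b x • g x, b.contMDiff_smul fun x hx ↦ (hgs x hx).contMDiffWithinAt, ?_, ?_⟩
  · rw [hev.self_of_nhds]
    simp [g]
  · intro v
    have h1 : HasFDerivAt g₀ L (extChartAt (𝓡 (2 * n + 1)) z z) :=
      (L.hasFDerivAt.comp _ ((hasFDerivAt_id _).sub_const _)).const_add a
    have h2 := h1.hasMFDerivAt.comp z
      (mdifferentiableAt_extChartAt' (mem_chart_source _ z)).hasMFDerivAt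
    have h3 : mfderiv (𝓡 (2 * n + 1)) 𝓘(ℝ, ℝ) (fun x ↦ b x • g x) z = _ :=
      hev.mfderiv_eq.trans h2.mfderiv
    exact (congrArg (fun A ↦ A v) h3).trans (hL v)

variable [T2Space M] [CompactSpace M]

/-- Every tangent vector is the velocity of a flow of contactomorphisms. -/
lemma IsContactForm.exists_flow_with_velocity (hα : IsContactForm ξ α) (z : M)
    (w : TangentSpace (𝓡 (2 * n + 1)) z) :
    ∃ θ : ℝ → Equiv.Perm M, θ 0 = 1 ∧ ContMDiff (𝓘(ℝ, ℝ).prod (𝓡 (2 * n + 1)))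
        (𝓡 (2 * n + 1)) ∞ (fun p : ℝ × M ↦ θ p.1 p.2) ∧ (∀ t, θ t ∈ Cont₀ ξ) ∧
      HasDerivAt (fun t ↦ extChartAt (𝓡 (2 * n + 1)) z (θ t z)) (chartDeriv z z w) 0 := by
  obtain ⟨R, hR, hRs⟩ := hα.exists_reeb
  obtain ⟨B, hB, hp⟩ := hα.exists_isContactPair z
  -- With `H(z) = α(w)` and `dH = -dα(w, ·)` at `z` one has `dH(R) = 0` there, so the contact vector
  -- field of `H` satisfies at `z` the equations that characterise `w`.
  obtain ⟨H, hH, hHz, hdH⟩ := exists_smooth_function_with_differential z (α z w) (-B w)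
  obtain ⟨X, hX, hdX, hXs⟩ := hα.exists_contactVectorField hR hH
  have hXz : X z = w := by
    refine hα.eq_of_d_add_eq fun u ↦ ?_
    have h1 : differential H z (R z) = 0 := by
      rw [hdH, LinearMap.neg_apply, hp.swap, hB, (hR z).2, neg_zero, neg_zero]
    rw [hdX, h1, hdH, hX, hHz, LinearMap.neg_apply, hB]
    ring
  have hk : ContMDiff (𝓡 (2 * n + 1)) 𝓘(ℝ, ℝ) ∞ (fun x ↦ differential H x (R x)) :=
    contMDiff_differential_apply hH hRs
  obtain ⟨θ, h0, -, hθ, hint, hmem, -⟩ := hα.exists_flow hk.continuous hXs fun x u ↦ by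
    have : (fun y ↦ α y (X y)) = H := funext hX
    rw [this, hdX]
    ring
  refine ⟨θ, h0, hθ, hmem, ?_⟩
  have h2 : ContMDiffAt 𝓘(ℝ, ℝ) (𝓡 (2 * n + 1)) ∞ (fun t ↦ θ t z) 0 :=
    (hθ.comp (contMDiff_id.prodMk contMDiff_const)).contMDiffAt
  have hz : θ 0 z = z := by rw [h0]; rfl
  have h4 : ContDiffAt ℝ ∞ (fun t ↦ extChartAt (𝓡 (2 * n + 1)) z (θ t z)) 0 := by
    rw [← contMDiffAt_iff_contDiffAt]
    refine ContMDiffAt.comp (0 : ℝ) (I' := 𝓡 (2 * n + 1)) (g := extChartAt (𝓡 (2 * n + 1)) z) ?_ h2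
    rw [hz]
    exact contMDiffAt_extChartAt
  have h5 := chartDeriv_vderiv (x₀ := z) (h2.mdifferentiableAt (by simp))
    (by rw [hz]; exact mem_chart_source _ z) 1
  rw [vderiv_eq_of_isMIntegralCurve (hint z) 0] at h5
  have h6 : ∀ y, y = z → chartDeriv z y (X y) = chartDeriv z z w := by
    rintro _ rfl
    rw [hXz]
  rw [h6 _ hz] at h5
  rw [h5]
  exact (h4.differentiableAt (by simp)).hasDerivAt

omit [T2Space M] [CompactSpace M] in
/-- Composition of flows, applied to a point: the derivative in the flow parameters. -/
lemma hasStrictFDerivAt_list_prod {ι : Type*} [Fintype ι] {z : M} {w : ι → Model n}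
    {θ : ι → ℝ → Equiv.Perm M} (h0 : ∀ i, θ i 0 = 1)
    (hθ : ∀ i, ContMDiff (𝓘(ℝ, ℝ).prod (𝓡 (2 * n + 1))) (𝓡 (2 * n + 1)) ∞
      (fun p : ℝ × M ↦ θ i p.1 p.2))
    (hw : ∀ i, HasDerivAt (fun t ↦ extChartAt (𝓡 (2 * n + 1)) z (θ i t z)) (w i) 0)
    (l : List ι) :
    Continuous (fun s : ι → ℝ ↦ (l.map fun i ↦ θ i (s i)).prod z) ∧
    (l.map fun i ↦ θ i ((0 : ι → ℝ) i)).prod z = z ∧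
    HasStrictFDerivAt
      (fun s : ι → ℝ ↦ extChartAt (𝓡 (2 * n + 1)) z ((l.map fun i ↦ θ i (s i)).prod z))
      (l.map fun i ↦ (ContinuousLinearMap.proj (R := ℝ) (φ := fun _ : ι ↦ ℝ) i).smulRight
        (w i)).sum 0 := by
  induction l with
  | nil =>
    refine ⟨continuous_const, rfl, ?_⟩
    exact hasStrictFDerivAt_const (extChartAt (𝓡 (2 * n + 1)) z z) (0 : ι → ℝ)
  | cons i l ih =>
    obtain ⟨ihc, ihz, ihd⟩ := ih
    set g : (ι → ℝ) → M := fun s ↦ (l.map fun i ↦ θ i (s i)).prod z with hg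
    set ψ := extChartAt (𝓡 (2 * n + 1)) z with hψ
    simp only [List.map_cons, List.sum_cons, List.prod_cons, Equiv.Perm.mul_apply]
    have hz : g 0 = z := ihz
    have h00 : ∀ x, θ i ((0 : ι → ℝ) i) x = x := fun x ↦ by rw [Pi.zero_apply, h0]; rfl
    refine ⟨(hθ i).continuous.comp ((continuous_apply i).prodMk ihc), (h00 _).trans hz, ?_⟩
    -- Since `θ i 0 = 1`, the flow in the chart has differential `(r, u) ↦ r • w i + u` at `(0, ψ
    -- z)`. Each further flow in the list adds one term to the total derivative.
    let F : ℝ × Model n → Model n := fun q ↦ ψ (θ i q.1 (ψ.symm q.2))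
    have hsymm : ψ.symm (ψ z) = z := extChartAt_to_inv z
    have hFs : ContDiffAt ℝ ∞ F (0, ψ z) := by
      rw [← contMDiffAt_iff_contDiffAt]
      have h1 : ContMDiffAt 𝓘(ℝ, ℝ × Model n) (𝓡 (2 * n + 1)) ∞
          (fun q : ℝ × Model n ↦ θ i q.1 (ψ.symm q.2)) (0, ψ z) :=
        (hθ i).contMDiffAt.comp (I' := 𝓘(ℝ, ℝ).prod (𝓡 (2 * n + 1))) ((0 : ℝ), ψ z)
          (f := fun q : ℝ × Model n ↦ (q.1, ψ.symm q.2))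
          (contDiff_fst.contMDiff.contMDiffAt.prodMk
            ((contMDiffAt_extChartAt_symm (mem_extChartAt_target z)).comp ((0 : ℝ), ψ z)
              contDiff_snd.contMDiff.contMDiffAt))
      refine ContMDiffAt.comp ((0 : ℝ), ψ z) (I' := 𝓡 (2 * n + 1)) (g := ψ) ?_ h1
      have : θ i ((0 : ℝ), ψ z).1 (ψ.symm ((0 : ℝ), ψ z).2) = z := by
        simp only [h0, hsymm]; rfl
      rw [this]
      exact contMDiffAt_extChartAt
    have hFd := hFs.hasStrictFDerivAt (by simp)
    have hF1 : ∀ r, fderiv ℝ F (0, ψ z) (r, 0) = r • w i := by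
      intro r
      have h1 : HasDerivAt (fun t : ℝ ↦ F (t, ψ z)) (fderiv ℝ F (0, ψ z) (1, 0)) 0 :=
        HasFDerivAt.comp_hasDerivAt (f := fun t : ℝ ↦ (t, ψ z)) (0 : ℝ) hFd.hasFDerivAt
          ((hasDerivAt_id (0 : ℝ)).prodMk (hasDerivAt_const (0 : ℝ) (ψ z)))
      have h2 : (fun t : ℝ ↦ F (t, ψ z)) = fun t ↦ ψ (θ i t z) := by
        simp only [F, hsymm]
      rw [h2] at h1
      rw [← h1.unique (hw i), ← map_smul]
      simp
    have hF2 : ∀ u, fderiv ℝ F (0, ψ z) (0, u) = u := by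
      intro u
      have h1 : HasFDerivAt (fun y : Model n ↦ F (0, y))
          ((fderiv ℝ F (0, ψ z)).comp (ContinuousLinearMap.inr ℝ ℝ (Model n))) (ψ z) :=
        hFd.hasFDerivAt.comp (ψ z) (hasFDerivAt_prodMk_right _ _)
      have h2 : (fun y : Model n ↦ F (0, y)) =ᶠ[nhds (ψ z)] id := by
        filter_upwards [extChartAt_target_mem_nhds (I := 𝓡 (2 * n + 1)) z] with y hy
        simp only [F, h0]
        exact ψ.right_inv hy
      exact congrArg (fun A ↦ A u) ((h1.congr_of_eventuallyEq h2.symm).unique (hasFDerivAt_id _))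
    have hev : (fun s : ι → ℝ ↦ F (s i, ψ (g s))) =ᶠ[nhds 0] fun s ↦ ψ (θ i (s i) (g s)) := by
      have : ∀ᶠ s in nhds (0 : ι → ℝ), g s ∈ ψ.source :=
        ihc.continuousAt.eventually (by rw [hz]; exact extChartAt_source_mem_nhds z)
      filter_upwards [this] with s hs
      simp only [F, ψ.left_inv hs]
    have hFd' : HasStrictFDerivAt F (fderiv ℝ F (0, ψ z)) ((0 : ι → ℝ) i, ψ (g 0)) := by
      rw [hz]; exact hFd
    have hcomp := hFd'.comp (0 : ι → ℝ)
      (((ContinuousLinearMap.proj (R := ℝ) (φ := fun _ : ι ↦ ℝ) i).hasStrictFDerivAt).prodMk ihd)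
    refine (hcomp.congr_of_eventuallyEq hev).congr_fderiv ?_
    ext1 s
    have hF : ∀ r u, fderiv ℝ F (0, ψ z) (r, u) = r • w i + u := fun r u ↦ by
      rw [← hF1, ← hF2 u, ← map_add, hF2, Prod.mk_add_mk, add_zero, zero_add]
    have hz0 : ψ (g 0) = ψ z := congrArg ψ hz
    exact hF _ _

/-- Choose contact flows whose velocities at `z` form a basis. Their composition, as a function of
all the flow times, has surjective derivative at `0`, hence covers a neighbourhood of `z`. -/
lemma IsContactForm.orbit_mem_nhds (hα : IsContactForm ξ α) (z : M) :
    {x | ∃ ψ ∈ Cont₀ ξ, ψ z = x} ∈ nhds z := by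
  let b := Module.finBasis ℝ (Model n)
  choose w hw using fun i ↦
    (chartDeriv_bijective (E := Model n) (mem_chart_source (Model n) z)).2 (b i)
  choose θ h0 hθ hmem hd using fun i ↦ hα.exists_flow_with_velocity z (w i)
  simp only [hw] at hd
  obtain ⟨hc, hz, hD⟩ := hasStrictFDerivAt_list_prod h0 hθ hd Finset.univ.toList
  set g : (Fin (Module.finrank ℝ (Model n)) → ℝ) → M := fun s ↦
    (Finset.univ.toList.map fun i ↦ θ i (s i)).prod z with hg
  have hsurj : LinearMap.range ((Finset.univ.toList.map fun i ↦
      (ContinuousLinearMap.proj (R := ℝ) (φ := fun _ ↦ ℝ) i).smulRight (b i)).sum).toLinearMap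
      = ⊤ := by
    refine LinearMap.range_eq_top.2 fun v ↦ ⟨b.repr v, ?_⟩
    rw [Finset.sum_map_toList]
    refine Eq.trans ?_ (b.sum_repr v)
    simp
  have hmap := hD.map_nhds_eq_of_surj hsurj
  have hmem' : ∀ s : Fin (Module.finrank ℝ (Model n)) → ℝ,
      (Finset.univ.toList.map fun i ↦ θ i (s i)).prod ∈ Cont₀ ξ := fun s ↦
    Subgroup.list_prod_mem _ fun x hx ↦ by
      obtain ⟨i, -, rfl⟩ := List.mem_map.1 hx
      exact hmem _ _
  have h1 : ∀ᶠ y in nhds (extChartAt (𝓡 (2 * n + 1)) z z), ∃ ψ ∈ Cont₀ ξ,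
      ψ z = (extChartAt (𝓡 (2 * n + 1)) z).symm y := by
    have hgz : g 0 = z := hz
    rw [← congrArg (extChartAt (𝓡 (2 * n + 1)) z) hgz, ← hmap, Filter.eventually_map]
    have : ∀ᶠ s in nhds (0 : Fin (Module.finrank ℝ (Model n)) → ℝ),
        g s ∈ (extChartAt (𝓡 (2 * n + 1)) z).source :=
      hc.continuousAt.eventually (by
        change _ ∈ nhds (g 0); rw [hgz]; exact extChartAt_source_mem_nhds z)
    filter_upwards [this] with s hs
    exact ⟨_, hmem' s, ((extChartAt (𝓡 (2 * n + 1)) z).left_inv hs).symm⟩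
  have h2 := (continuousAt_extChartAt (I := 𝓡 (2 * n + 1)) z).eventually h1
  filter_upwards [h2, extChartAt_source_mem_nhds (I := 𝓡 (2 * n + 1)) z] with x hx hxs
  rwa [(extChartAt (𝓡 (2 * n + 1)) z).left_inv hxs] at hx

/-- The identity component of the contactomorphism group acts transitively on a connected
manifold. -/
theorem IsContactForm.exists_cont₀_apply_eq [ConnectedSpace M] (hα : IsContactForm ξ α) (x y : M) :
    ∃ ψ ∈ Cont₀ ξ, ψ x = y := by
  let O : M → Set M := fun z ↦ {x | ∃ ψ ∈ Cont₀ ξ, ψ z = x}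
  have hO : ∀ a b c, b ∈ O a → c ∈ O b → c ∈ O a := by
    rintro a b c ⟨ψ, hψ, rfl⟩ ⟨χ, hχ, rfl⟩
    exact ⟨χ * ψ, mul_mem hχ hψ, rfl⟩
  have hs : ∀ a b, b ∈ O a → a ∈ O b := by
    rintro a b ⟨ψ, hψ, rfl⟩
    exact ⟨ψ⁻¹, inv_mem hψ, by simp⟩
  have hopen : ∀ a, IsOpen (O a) := fun a ↦ isOpen_iff_mem_nhds.2 fun b hb ↦
    Filter.mem_of_superset (hα.orbit_mem_nhds b) fun c hc ↦ hO a b c hb hc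
  have hclosed : IsClosed (O x) := by
    refine ⟨isOpen_iff_mem_nhds.2 fun b hb ↦ ?_⟩
    exact Filter.mem_of_superset (hα.orbit_mem_nhds b) fun c hc hcx ↦ hb (hO x c b hcx (hs b c hc))
  have huniv := IsClopen.eq_univ ⟨hclosed, hopen x⟩ ⟨x, 1, one_mem _, rfl⟩
  exact (huniv ▸ mem_univ y : y ∈ O x)

end Transitivity

/-! ### Isotopies defined for all times and calculus of their Hamiltonians. -/

section SmoothIsotopies

variable {n : ℕ} {M : Type*} [TopologicalSpace M] [ChartedSpace (Model n) M]

/-- The function `α(X_t)` of an isotopy defined for all times, at the point `Γ_t(x)`. -/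
noncomputable def ham (α : OneForm n M) (Γ : ℝ → Equiv.Perm M) (t : ℝ) (x : M) : ℝ :=
  α (Γ t x) (vderiv (fun s ↦ Γ s x) t 1)

variable [IsManifold (𝓡 (2 * n + 1)) ∞ M] {α : OneForm n M} {ξ : Distribution n M}

/-- A smooth isotopy, defined for all times, in the identity component of the group of
contactomorphisms. -/
structure IsSmoothIsotopy (ξ : Distribution n M) (Γ : ℝ → Equiv.Perm M) : Prop where
  smooth : ContMDiff (𝓘(ℝ, ℝ).prod (𝓡 (2 * n + 1))) (𝓡 (2 * n + 1)) ∞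
    (fun p : ℝ × M ↦ Γ p.1 p.2)
  mem : ∀ t, Γ t ∈ Cont₀ ξ

lemma mem_cont_of_mem_cont₀ {φ : Equiv.Perm M} (h : φ ∈ Cont₀ ξ) : φ ∈ Cont ξ := by
  obtain ⟨γ, hγ, -, rfl⟩ := h
  exact hγ.mem 1 (by simp)

/-- The isotopy run only up to time `t`, and multiplied on the right by `(γ 0)⁻¹`, starts at the
identity. -/
lemma IsContactIsotopy.mem_cont₀ {γ : ℝ → Equiv.Perm M} (hγ : IsContactIsotopy ξ γ)
    (h0 : γ 0 ∈ Cont₀ ξ) {t : ℝ} (ht : t ∈ Icc (0 : ℝ) 1) : γ t ∈ Cont₀ ξ := by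
  have hc := mem_cont_of_mem_cont₀ h0
  have hI : ∀ s ∈ Icc (0 : ℝ) 1, s * t ∈ Icc (0 : ℝ) 1 := fun s hs ↦
    ⟨mul_nonneg hs.1 ht.1, mul_le_one₀ hs.2 ht.1 ht.2⟩
  have h1 : γ t * (γ 0)⁻¹ ∈ Cont₀ ξ := by
    refine ⟨fun s ↦ γ (s * t) * (γ 0)⁻¹, ⟨?_, fun s hs ↦ mul_mem (hγ.mem _ (hI s hs))
      (inv_mem hc)⟩, by simp, by simp⟩
    have hs : ContMDiff 𝓘(ℝ, ℝ) 𝓘(ℝ, ℝ) ∞ (fun s : ℝ ↦ s * t) :=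
      (contDiff_id.mul contDiff_const).contMDiff
    exact hγ.smooth.comp
      (t := Icc 0 1 ×ˢ univ) (f := fun p : ℝ × M ↦ ((p.1 * t, (γ 0).symm p.2) : ℝ × M))
      ((hs.comp contMDiff_fst).prodMk (hc.2.1.comp contMDiff_snd)).contMDiffOn
      (fun p hp ↦ ⟨hI _ hp.1, mem_univ _⟩)
  simpa using mul_mem h1 h0

namespace IsSmoothIsotopy

variable {Γ Δ : ℝ → Equiv.Perm M}

lemma contMDiff_curve (hΓ : IsSmoothIsotopy ξ Γ) (x : M) :
    ContMDiff 𝓘(ℝ, ℝ) (𝓡 (2 * n + 1)) ∞ (fun t ↦ Γ t x) :=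
  hΓ.smooth.comp (contMDiff_id.prodMk contMDiff_const)

lemma contMDiff (hΓ : IsSmoothIsotopy ξ Γ) (t : ℝ) :
    ContMDiff (𝓡 (2 * n + 1)) (𝓡 (2 * n + 1)) ∞ (Γ t) :=
  hΓ.smooth.comp (contMDiff_const.prodMk contMDiff_id)

lemma isContactIsotopy (hΓ : IsSmoothIsotopy ξ Γ) : IsContactIsotopy ξ Γ :=
  ⟨hΓ.smooth.contMDiffOn, fun t _ ↦ mem_cont_of_mem_cont₀ (hΓ.mem t)⟩

lemma hamiltonian_eq (hΓ : IsSmoothIsotopy ξ Γ) {t : ℝ} (ht : t ∈ Icc (0 : ℝ) 1) (x : M) :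
    hamiltonian α Γ t x = ham α Γ t x := by
  have h : UniqueMDiffWithinAt 𝓘(ℝ, ℝ) (Icc (0 : ℝ) 1) t :=
    (uniqueDiffOn_Icc zero_lt_one t ht).uniqueMDiffWithinAt
  exact congrArg (fun L ↦ α (Γ t x) (L 1)) (mfderivWithin_eq_mfderiv h
    ((hΓ.contMDiff_curve x).mdifferentiableAt (by simp)))

lemma const {φ : Equiv.Perm M} (hφ : φ ∈ Cont₀ ξ) : IsSmoothIsotopy ξ (fun _ ↦ φ) :=
  ⟨(mem_cont_of_mem_cont₀ hφ).1.comp contMDiff_snd, fun _ ↦ hφ⟩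

lemma comp (hΓ : IsSmoothIsotopy ξ Γ) {u : ℝ → ℝ} (hu : ContDiff ℝ ∞ u) :
    IsSmoothIsotopy ξ (fun t ↦ Γ (u t)) :=
  ⟨hΓ.smooth.comp (f := fun p : ℝ × M ↦ (u p.1, p.2))
    ((hu.contMDiff.comp contMDiff_fst).prodMk contMDiff_snd), fun _ ↦ hΓ.mem _⟩

lemma mul (hΓ : IsSmoothIsotopy ξ Γ) (hΔ : IsSmoothIsotopy ξ Δ) :
    IsSmoothIsotopy ξ (fun t ↦ Γ t * Δ t) :=
  ⟨hΓ.smooth.comp (contMDiff_fst.prodMk hΔ.smooth), fun _ ↦ mul_mem (hΓ.mem _) (hΔ.mem _)⟩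

end IsSmoothIsotopy

omit [IsManifold (𝓡 (2 * n + 1)) ∞ M] in
lemma ham_const (φ : Equiv.Perm M) (t : ℝ) (x : M) : ham α (fun _ ↦ φ) t x = 0 := by
  have : vderiv (n := n) (fun _ : ℝ ↦ φ x) t = 0 := mfderiv_const
  exact (congrArg (fun L ↦ α (φ x) (L 1)) this).trans (map_zero _)

omit [IsManifold (𝓡 (2 * n + 1)) ∞ M] in
lemma ham_congr {Γ Δ : ℝ → Equiv.Perm M} {t : ℝ} (h : Γ =ᶠ[nhds t] Δ) (x : M) :
    ham α Γ t x = ham α Δ t x := by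
  have h1 : (fun s ↦ Γ s x) =ᶠ[nhds t] fun s ↦ Δ s x := h.mono fun s hs ↦ by simp only [hs]
  have h2 : ∀ (y z : M) (L : ℝ →L[ℝ] TangentSpace (𝓡 (2 * n + 1)) y)
      (K : ℝ →L[ℝ] TangentSpace (𝓡 (2 * n + 1)) z), y = z → HEq L K → α y (L 1) = α z (K 1) := by
    rintro y _ L K rfl h
    rw [eq_of_heq h]
  refine h2 _ _ _ _ h1.self_of_nhds ?_
  exact heq_of_eq h1.mfderiv_eq

lemma IsSmoothIsotopy.ham_comp {Γ : ℝ → Equiv.Perm M} (hΓ : IsSmoothIsotopy ξ Γ) {u : ℝ → ℝ}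
    (hu : ContDiff ℝ ∞ u) (t : ℝ) (x : M) :
    ham α (fun t ↦ Γ (u t)) t x = deriv u t * ham α Γ (u t) x := by
  have h1 := vderiv_comp_apply (f := fun s ↦ Γ s x) (g := u) (y := t)
    ((hΓ.contMDiff_curve x).mdifferentiableAt (by simp))
    (hu.differentiable (by simp) t).hasDerivAt.hasFDerivAt 1
  have h2 : (ContinuousLinearMap.toSpanSingleton ℝ (deriv u t)) 1 = deriv u t • (1 : ℝ) := by simp
  refine (congrArg (α (Γ (u t) x)) (h1.trans (congrArg _ h2))).trans ?_
  rw [map_smul, map_smul]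
  rfl

/-- A contact isotopy is controlled only on `[0, 1]`. A reparametrisation with values there makes it
smooth for all times, so that two-sided derivatives can be used. -/
lemma IsContactIsotopy.isSmoothIsotopy_comp {γ : ℝ → Equiv.Perm M} (hγ : IsContactIsotopy ξ γ)
    (h0 : γ 0 ∈ Cont₀ ξ) {u : ℝ → ℝ} (hu : ContDiff ℝ ∞ u) (huI : ∀ t, u t ∈ Icc (0 : ℝ) 1) :
    IsSmoothIsotopy ξ (fun t ↦ γ (u t)) :=
  ⟨contMDiffOn_univ.1 (hγ.smooth.comp (f := fun p : ℝ × M ↦ (u p.1, p.2))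
    ((hu.contMDiff.comp contMDiff_fst).prodMk contMDiff_snd).contMDiffOn
      fun _ _ ↦ ⟨huI _, mem_univ _⟩), fun t ↦ hγ.mem_cont₀ h0 (huI t)⟩

lemma IsContactIsotopy.ham_comp {γ : ℝ → Equiv.Perm M} (hγ : IsContactIsotopy ξ γ) {u : ℝ → ℝ}
    (hu : ContDiff ℝ ∞ u) (huI : ∀ t, u t ∈ Icc (0 : ℝ) 1) (t : ℝ) (x : M) :
    ham α (fun t ↦ γ (u t)) t x = deriv u t * hamiltonian α γ (u t) x := by
  have hc : ContMDiffOn 𝓘(ℝ, ℝ) (𝓡 (2 * n + 1)) ∞ (fun s ↦ γ s x) (Icc 0 1) :=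
    hγ.smooth.comp (contMDiff_id.prodMk contMDiff_const).contMDiffOn
      fun s hs ↦ ⟨hs, mem_univ _⟩
  have h1 := ((hc (u t) (huI t)).mdifferentiableWithinAt (by simp)).hasMFDerivWithinAt
  have h2 : HasMFDerivWithinAt 𝓘(ℝ, ℝ) 𝓘(ℝ, ℝ) u univ t _ :=
    (hu.differentiable (by simp) t).hasDerivAt.hasFDerivAt.hasMFDerivAt.hasMFDerivWithinAt
  have h3 := (h1.comp t h2 fun s _ ↦ huI s)
  rw [hasMFDerivWithinAt_univ] at h3
  have h4 : (ContinuousLinearMap.toSpanSingleton ℝ (deriv u t)) 1 = deriv u t • (1 : ℝ) := by simp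
  refine (congrArg (fun L ↦ α (γ (u t) x) (L (1 : ℝ))) h3.mfderiv).trans ?_
  refine (congrArg (fun r ↦ α (γ (u t) x)
    (mfderivWithin 𝓘(ℝ, ℝ) (𝓡 (2 * n + 1)) (fun s ↦ γ s x) (Icc 0 1) (u t) r)) h4).trans ?_
  refine (congrArg _ (map_smul (mfderivWithin 𝓘(ℝ, ℝ) (𝓡 (2 * n + 1)) (fun s ↦ γ s x)
    (Icc 0 1) (u t)) (deriv u t) (1 : ℝ))).trans ?_
  exact map_smul (α (γ (u t) x)) _ _

/-- The Hamiltonian of a product of isotopies. -/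
lemma IsSmoothIsotopy.ham_mul {Γ Δ : ℝ → Equiv.Perm M} (hΓ : IsSmoothIsotopy ξ Γ)
    (hΔ : IsSmoothIsotopy ξ Δ) (t : ℝ) (x : M) :
    ham α (fun t ↦ Γ t * Δ t) t x = ham α Γ t (Δ t x) +
      α (Γ t (Δ t x)) (mfderiv (𝓡 (2 * n + 1)) (𝓡 (2 * n + 1)) (Γ t) (Δ t x)
        (vderiv (fun s ↦ Δ s x) t 1)) := by
  let f : ℝ × ℝ → M := fun q ↦ Γ q.1 (Δ q.2 x)
  have hf : MDifferentiableAt 𝓘(ℝ, ℝ × ℝ) (𝓡 (2 * n + 1)) f (t, t) := by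
    have : ContMDiffAt 𝓘(ℝ, ℝ × ℝ) (𝓡 (2 * n + 1)) ∞ f (t, t) :=
      hΓ.smooth.contMDiffAt.comp (I' := 𝓘(ℝ, ℝ).prod (𝓡 (2 * n + 1))) (t, t)
        (f := fun q : ℝ × ℝ ↦ (q.1, Δ q.2 x))
        (contDiff_fst.contMDiff.contMDiffAt.prodMk
          ((hΔ.contMDiff_curve x).contMDiffAt.comp (t, t) contDiff_snd.contMDiff.contMDiffAt))
    exact this.mdifferentiableAt (by simp)
  have h1 := vderiv_comp_apply (f := f) (g := fun s : ℝ ↦ (s, s)) (y := t) hf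
    ((hasFDerivAt_id t).prodMk (hasFDerivAt_id t)) 1
  have h2 := vderiv_comp_apply (f := f) (g := fun s : ℝ ↦ (s, t)) (y := t) hf
    (hasFDerivAt_prodMk_left _ _) 1
  have h3 := vderiv_comp_apply (f := f) (g := fun s : ℝ ↦ (t, s)) (y := t) hf
    (hasFDerivAt_prodMk_right _ _) 1
  have h4 := mfderiv_vderiv (c := fun s ↦ Δ s x) (φ := Γ t) (y := t)
    ((hΔ.contMDiff_curve x).mdifferentiableAt (by simp))
    ((hΓ.contMDiff t).mdifferentiableAt (by simp)) 1
  have h5 : ((1 : ℝ), (1 : ℝ)) = (1, 0) + (0, 1) := by simp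
  have h6 : vderiv (n := n) f (t, t) (1, 1) =
      vderiv (n := n) f (t, t) (1, 0) + vderiv (n := n) f (t, t) (0, 1) := by
    rw [h5, map_add]
  refine (congrArg (α (Γ t (Δ t x))) (h1.trans h6)).trans ?_
  rw [map_add]
  exact congrArg₂ (· + ·) (congrArg (α (Γ t (Δ t x))) h2.symm)
    (congrArg (α (Γ t (Δ t x))) (h3.symm.trans h4))

end SmoothIsotopies

/-! ### Positivity of the conformal factor, and isotopies with zero Hamiltonian. -/

section ConformalFactor

variable {n : ℕ} {M : Type*} [TopologicalSpace M] [ChartedSpace (Model n) M]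
  [IsManifold (𝓡 (2 * n + 1)) ∞ M] {α : OneForm n M} {ξ : Distribution n M}
  {Γ Δ : ℝ → Equiv.Perm M}

section Parametrized

variable {c : Model n → M} {y : Model n}

lemma IsSmoothIsotopy.contMDiffAt_parametrized (hΓ : IsSmoothIsotopy ξ Γ)
    (hc : ContMDiffAt 𝓘(ℝ, Model n) (𝓡 (2 * n + 1)) ∞ c y) (t : ℝ) :
    ContMDiffAt 𝓘(ℝ, ℝ × Model n) (𝓡 (2 * n + 1)) ∞ (fun q : ℝ × Model n ↦ Γ q.1 (c q.2))
      (t, y) :=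
  hΓ.smooth.contMDiffAt.comp (I' := 𝓘(ℝ, ℝ).prod (𝓡 (2 * n + 1))) (t, y)
    (f := fun q : ℝ × Model n ↦ (q.1, c q.2)) (contDiff_fst.contMDiff.contMDiffAt.prodMk
      (hc.comp (t, y) contDiff_snd.contMDiff.contMDiffAt))

omit [IsManifold (𝓡 (2 * n + 1)) ∞ M] in
lemma vderiv_parametrized_left {q : ℝ × Model n}
    (hq : MDifferentiableAt 𝓘(ℝ, ℝ × Model n) (𝓡 (2 * n + 1))
      (fun q : ℝ × Model n ↦ Γ q.1 (c q.2)) q) :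
    vderiv (n := n) (fun q : ℝ × Model n ↦ Γ q.1 (c q.2)) q (1, 0) =
      vderiv (n := n) (fun s ↦ Γ s (c q.2)) q.1 1 :=
  (vderiv_comp_apply (f := fun q : ℝ × Model n ↦ Γ q.1 (c q.2)) (g := fun r : ℝ ↦ (r, q.2))
    (y := q.1) hq (hasFDerivAt_prodMk_left _ _) 1).symm

lemma IsSmoothIsotopy.vderiv_parametrized_right (hΓ : IsSmoothIsotopy ξ Γ)
    (hc : ContMDiffAt 𝓘(ℝ, Model n) (𝓡 (2 * n + 1)) ∞ c y) (t : ℝ) (w : Model n) :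
    vderiv (fun q : ℝ × Model n ↦ Γ q.1 (c q.2)) (t, y) (0, w) =
      mfderiv (𝓡 (2 * n + 1)) (𝓡 (2 * n + 1)) (Γ t) (c y) (vderiv c y w) :=
  (vderiv_comp_apply (f := fun q : ℝ × Model n ↦ Γ q.1 (c q.2)) (g := fun z : Model n ↦ (t, z))
    (y := y) ((hΓ.contMDiffAt_parametrized hc t).mdifferentiableAt (by simp))
    (hasFDerivAt_prodMk_right _ _) w).symm.trans (mfderiv_vderiv (hc.mdifferentiableAt (by simp))
      ((hΓ.contMDiff t).mdifferentiableAt (by simp)) w)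

end Parametrized

lemma IsSmoothIsotopy.continuous_apply_mfderiv (hΓ : IsSmoothIsotopy ξ Γ) (hα : SmoothOneForm α)
    (x : M) (v : TangentSpace (𝓡 (2 * n + 1)) x) :
    Continuous fun t ↦ α (Γ t x) (mfderiv (𝓡 (2 * n + 1)) (𝓡 (2 * n + 1)) (Γ t) x v) := by
  refine tangent_induction (P := fun x v ↦
    Continuous fun t ↦ α (Γ t x) (mfderiv (𝓡 (2 * n + 1)) (𝓡 (2 * n + 1)) (Γ t) x v))
    (fun c y w hc ↦ continuous_iff_continuousAt.2 fun t ↦ ?_) x v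
  have h1 := (hα.contDiffAt_apply_vderiv (hΓ.contMDiffAt_parametrized hc t) (0, w)).continuousAt
  have h2 : ContinuousAt (fun t ↦ α (Γ t (c y)) (vderiv (n := n)
      (fun q : ℝ × Model n ↦ Γ q.1 (c q.2)) (t, y) (0, w))) t :=
    h1.comp (f := fun t : ℝ ↦ (t, y)) (continuousAt_id.prodMk continuousAt_const)
  refine h2.congr (Filter.Eventually.of_forall fun s ↦ ?_)
  exact congrArg (α (Γ s (c y))) (hΓ.vderiv_parametrized_right hc s w)

/-- Contactomorphisms in the identity component preserve the co-orientation. -/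
lemma IsContactForm.exists_conformalFactor (hα : IsContactForm ξ α) {φ : Equiv.Perm M}
    (hφ : φ ∈ Cont₀ ξ) : ∃ l : M → ℝ, (∀ x, 0 < l x) ∧ ∀ x v,
      α (φ x) (mfderiv (𝓡 (2 * n + 1)) (𝓡 (2 * n + 1)) φ x v) = l x * α x v := by
  obtain ⟨R, hR, -⟩ := hα.exists_reeb
  obtain ⟨γ, hγ, h0, rfl⟩ := id hφ
  have hΓ := hγ.isSmoothIsotopy_comp (h0 ▸ one_mem _) Real.smoothTransition.contDiff
    fun t ↦ ⟨Real.smoothTransition.nonneg t, Real.smoothTransition.le_one t⟩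
  have hcont : ∀ {ψ : Equiv.Perm M}, ψ ∈ Cont₀ ξ → ∀ x v,
      α (ψ x) (mfderiv (𝓡 (2 * n + 1)) (𝓡 (2 * n + 1)) ψ x v) = 0 ↔ α x v = 0 := fun hψ ↦
    have h := mem_cont_of_mem_cont₀ hψ
    (hα.mem_cont_iff h.1 h.2.1).1 h
  refine ⟨fun x ↦ α (γ 1 x) (mfderiv (𝓡 (2 * n + 1)) (𝓡 (2 * n + 1)) (γ 1) x (R x)),
    fun x ↦ ?_, fun x v ↦ ?_⟩
  -- Along an isotopy from the identity, `α` on the transported Reeb vector starts at `1`. It never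
  -- vanishes, because `R` is not in `ξ`, so by the intermediate value theorem it stays positive.
  · let G : ℝ → ℝ := fun r ↦
      α (γ r x) (mfderiv (𝓡 (2 * n + 1)) (𝓡 (2 * n + 1)) (γ r) x (R x))
    let g : ℝ → ℝ := fun t ↦ G (Real.smoothTransition t)
    have hgc : Continuous g := hΓ.continuous_apply_mfderiv hα.smooth x (R x)
    have hne : ∀ t, g t ≠ 0 := fun t h ↦ by
      have := (hcont (hΓ.mem t) x (R x)).1 h
      rw [(hR x).1] at this
      exact one_ne_zero this
    have hg0 : g 0 = 1 := (congrArg G Real.smoothTransition.zero).trans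
      ((apply_mfderiv_of_eq_id (by rw [h0]; rfl) x (R x)).trans (hR x).1)
    have hg1 : g 1 = G 1 := congrArg G Real.smoothTransition.one
    change 0 < G 1
    rw [← hg1]
    by_contra hneg
    obtain ⟨t, -, ht⟩ := intermediate_value_Icc' (zero_le_one' ℝ) hgc.continuousOn
      (⟨not_lt.1 hneg, by rw [hg0]; exact zero_le_one⟩ : (0 : ℝ) ∈ Icc (g 1) (g 0))
    exact hne t ht
  · have h1 : α x (v - α x v • R x) = 0 := by
      rw [map_sub, map_smul, (hR x).1, smul_eq_mul, mul_one, sub_self]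
    have h2 := (hcont hφ x _).2 h1
    rw [map_sub, map_smul, map_sub, map_smul, smul_eq_mul, sub_eq_zero] at h2
    rw [h2, mul_comm]

/-- The Hamiltonian of a product of isotopies of contactomorphisms. -/
lemma IsContactForm.ham_mul (hα : IsContactForm ξ α) (hΓ : IsSmoothIsotopy ξ Γ)
    (hΔ : IsSmoothIsotopy ξ Δ) (t : ℝ) (x : M) :
    ∃ l : ℝ, 0 < l ∧ ham α (fun t ↦ Γ t * Δ t) t x = ham α Γ t (Δ t x) + l * ham α Δ t x := by
  obtain ⟨l, hl, h⟩ := hα.exists_conformalFactor (hΓ.mem t)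
  exact ⟨l (Δ t x), hl _, by rw [hΓ.ham_mul hΔ, h]; rfl⟩

/-- A curve with vanishing velocity is constant. -/
lemma eq_of_vderiv_eq_zero [T2Space M] {γ : ℝ → M}
    (hγ : ContMDiff 𝓘(ℝ, ℝ) (𝓡 (2 * n + 1)) ∞ γ) (h : ∀ t, vderiv (n := n) γ t 1 = 0) (s t : ℝ) :
    γ s = γ t := by
  have : IsManifold (𝓡 (2 * n + 1)) 1 M := .of_le (n := ∞) (by simp)
  have h0 : ContMDiff (𝓡 (2 * n + 1)) (𝓡 (2 * n + 1)).tangent 1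
      (fun x ↦ (⟨x, 0⟩ : TangentBundle (𝓡 (2 * n + 1)) M)) :=
    Bundle.contMDiff_zeroSection ℝ (TangentSpace (𝓡 (2 * n + 1)) : M → Type _)
  have h1 : IsMIntegralCurve (I := 𝓡 (2 * n + 1)) γ (fun _ ↦ 0) := by
    intro r
    have h2 := ((hγ r).mdifferentiableAt (by simp)).hasMFDerivAt
    have h3 : mfderiv 𝓘(ℝ, ℝ) (𝓡 (2 * n + 1)) γ r =
        (1 : ℝ →L[ℝ] ℝ).smulRight (0 : TangentSpace (𝓡 (2 * n + 1)) (γ r)) := by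
      exact ContinuousLinearMap.ext_ring ((h r).trans
        (smul_zero (A := TangentSpace (𝓡 (2 * n + 1)) (γ r)) (1 : ℝ)).symm)
    rwa [h3] at h2
  have h4 : IsMIntegralCurve (I := 𝓡 (2 * n + 1)) (fun _ : ℝ ↦ γ t)
      (fun x ↦ (0 : TangentSpace (𝓡 (2 * n + 1)) x)) := by
    intro r
    have h2 : HasMFDerivAt 𝓘(ℝ, ℝ) (𝓡 (2 * n + 1)) (fun _ : ℝ ↦ γ t) r _ :=
      hasMFDerivAt_const (γ t) r
    have h3 : (0 : ℝ →L[ℝ] TangentSpace (𝓡 (2 * n + 1)) (γ t)) =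
        (1 : ℝ →L[ℝ] ℝ).smulRight (0 : TangentSpace (𝓡 (2 * n + 1)) (γ t)) := by
      exact ContinuousLinearMap.ext_ring
        (smul_zero (A := TangentSpace (𝓡 (2 * n + 1)) (γ t)) (1 : ℝ)).symm
    exact h3 ▸ h2
  exact congrFun (isMIntegralCurve_Ioo_eq_of_contMDiff_boundaryless (t₀ := t) h0 h1 h4 rfl) s

/-- An isotopy with vanishing Hamiltonian is constant. -/
lemma IsContactForm.eq_of_ham_eq_zero [T2Space M] (hα : IsContactForm ξ α)
    (hΓ : IsSmoothIsotopy ξ Γ) (h : ∀ t x, ham α Γ t x = 0) (s t : ℝ) : Γ s = Γ t := by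
  obtain ⟨R, hR, -⟩ := hα.exists_reeb
  have : IsManifold (𝓡 (2 * n + 1)) 1 M := .of_le (n := ∞) (by simp)
  -- Both `α(∂ₜΓ)` and, for `v` in `ξ`, `α(dΓₜ v)` vanish identically in the relevant parameters, so
  -- the mixed derivative formula leaves `dα(∂ₜΓ, dΓₜ v) = 0`.
  have hd : ∀ (t : ℝ) (x : M) (v : TangentSpace (𝓡 (2 * n + 1)) x), α x v = 0 →
      α.d (Γ t x) (vderiv (fun s ↦ Γ s x) t 1)
        (mfderiv (𝓡 (2 * n + 1)) (𝓡 (2 * n + 1)) (Γ t) x v) = 0 := by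
    intro t x v
    refine tangent_induction (P := fun x v ↦ α x v = 0 → α.d (Γ t x) (vderiv (fun s ↦ Γ s x) t 1)
        (mfderiv (𝓡 (2 * n + 1)) (𝓡 (2 * n + 1)) (Γ t) x v) = 0) (fun c y w hc hw ↦ ?_) x v
    have hf := hΓ.contMDiffAt_parametrized hc
    set f : ℝ × Model n → M := fun q ↦ Γ q.1 (c q.2) with hfdef
    have h1 := hα.smooth.fderiv_sub_fderiv (hf t) (1, 0) (0, w)
    have h2 : (fun q ↦ α (f q) (vderiv (n := n) f q (1, 0))) =ᶠ[nhds (t, y)] fun _ ↦ 0 := by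
      filter_upwards [(contMDiffAt_iff_contMDiffAt_nhds (by simp)).1
        ((hf t).of_le (m := 1) (by simp))] with q hq
      exact (congrArg (α (f q)) (vderiv_parametrized_left
        (hq.mdifferentiableAt (by simp)))).trans (h q.1 (c q.2))
    have h3 : fderiv ℝ (fun q ↦ α (f q) (vderiv (n := n) f q (0, w))) (t, y) (1, 0) = 0 := by
      have h4 : HasFDerivAt (fun q ↦ α (f q) (vderiv (n := n) f q (0, w))) _ (t, y) :=
        ((hα.smooth.contDiffAt_apply_vderiv (hf t) (0, w)).differentiableAt
          (by simp)).hasFDerivAt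
      have h5 := HasFDerivAt.comp_hasDerivAt (f := fun s : ℝ ↦ (s, y)) t h4
        ((hasDerivAt_id t).prodMk (hasDerivAt_const t y))
      have h6 : (fun q ↦ α (f q) (vderiv (n := n) f q (0, w))) ∘ (fun s : ℝ ↦ (s, y)) =
          fun _ ↦ 0 := by
        funext s
        obtain ⟨l, -, hl⟩ := hα.exists_conformalFactor (hΓ.mem s)
        refine (congrArg (α (f (s, y))) (hΓ.vderiv_parametrized_right hc s w)).trans ?_
        exact (hl _ _).trans (by rw [hw, mul_zero])
      rw [h6] at h5
      exact h5.unique (hasDerivAt_const _ _)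
    rw [h2.fderiv_eq, h3, fderiv_const_apply, zero_apply, sub_zero] at h1
    refine Eq.trans ?_ h1.symm
    exact congrArg₂ (α.d (f (t, y)))
      (vderiv_parametrized_left ((hf t).mdifferentiableAt (by simp))).symm
      (hΓ.vderiv_parametrized_right hc t w).symm
  -- The velocity lies in the kernel of `α` and is `dα`-orthogonal to `R` and to `dΓₜ(ξ) = ξ`, which
  -- together span the tangent space.
  have hv : ∀ t x, vderiv (n := n) (fun s ↦ Γ s x) t 1 = 0 := by
    intro t x
    obtain ⟨B, hB, hp⟩ := hα.exists_isContactPair (Γ t x)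
    have hc := mem_cont_of_mem_cont₀ (hΓ.mem t)
    refine hp.eq_zero (h t x) fun u ↦ ?_
    have h1 : B (vderiv (fun s ↦ Γ s x) t 1) (u - α (Γ t x) u • R (Γ t x)) = 0 := by
      obtain ⟨v, hv⟩ := (mfderiv_bijective hc.1 hc.2.1 x).2 (u - α (Γ t x) u • R (Γ t x))
      rw [hB, ← hv]
      refine hd t x v (((hα.mem_cont_iff hc.1 hc.2.1).1 hc x v).1 ?_)
      rw [hv, map_sub, map_smul, (hR _).1, smul_eq_mul, mul_one, sub_self]
    have h2 : B (vderiv (fun s ↦ Γ s x) t 1) (R (Γ t x)) = 0 := by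
      rw [hp.swap, hB, (hR _).2, neg_zero]
    rw [map_sub, map_smul, h2, smul_zero, sub_zero] at h1
    exact h1
  exact Equiv.ext fun x ↦ eq_of_vderiv_eq_zero (hΓ.contMDiff_curve x) (fun t ↦ hv t x) s t

end ConformalFactor

/-! ### Orderability and constancy of nonnegative loops. -/

section Orderability

variable {n : ℕ} {M : Type*} [TopologicalSpace M] [ChartedSpace (Model n) M]
  [IsManifold (𝓡 (2 * n + 1)) ∞ M] {α : OneForm n M} {ξ : Distribution n M}
  {Γ Δ γ : ℝ → Equiv.Perm M} {φ ψ χ : Equiv.Perm M}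

omit [IsManifold (𝓡 (2 * n + 1)) ∞ M] in
lemma ham_mul_const (Γ : ℝ → Equiv.Perm M) (φ : Equiv.Perm M) (t : ℝ) (x : M) :
    ham α (fun t ↦ Γ t * φ) t x = ham α Γ t (φ x) := rfl

lemma IsContactForm.ham_const_mul (hα : IsContactForm ξ α) (hφ : φ ∈ Cont₀ ξ)
    (hΓ : IsSmoothIsotopy ξ Γ) (t : ℝ) (x : M) :
    ∃ l : ℝ, 0 < l ∧ ham α (fun t ↦ φ * Γ t) t x = l * ham α Γ t x := by
  obtain ⟨l, hl, h⟩ := hα.ham_mul (.const hφ) hΓ t x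
  exact ⟨l, hl, by rw [h, ham_const, zero_add]⟩

lemma IsSmoothIsotopy.isNonnegPath (hΓ : IsSmoothIsotopy ξ Γ) (h0 : Γ 0 = φ) (h1 : Γ 1 = ψ)
    (h : ∀ t ∈ Icc (0 : ℝ) 1, ∀ x, 0 ≤ ham α Γ t x) : IsNonnegPath ξ α φ ψ Γ :=
  ⟨hΓ.isContactIsotopy, h0, h1, fun t ht x ↦ by rw [hΓ.hamiltonian_eq ht]; exact h t ht x⟩

lemma IsNonnegPath.isSmoothIsotopy_comp (hγ : IsNonnegPath ξ α φ ψ γ) (hφ : φ ∈ Cont₀ ξ)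
    {u : ℝ → ℝ} (hu : ContDiff ℝ ∞ u) (huI : ∀ t, u t ∈ Icc (0 : ℝ) 1) :
    IsSmoothIsotopy ξ (fun t ↦ γ (u t)) :=
  hγ.isotopy.isSmoothIsotopy_comp (hγ.source ▸ hφ) hu huI

lemma IsNonnegPath.ham_comp_nonneg (hγ : IsNonnegPath ξ α φ ψ γ)
    {u : ℝ → ℝ} (hu : ContDiff ℝ ∞ u) (huI : ∀ t, u t ∈ Icc (0 : ℝ) 1) (hm : Monotone u)
    (t : ℝ) (x : M) : 0 ≤ ham α (fun t ↦ γ (u t)) t x := by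
  rw [hγ.isotopy.ham_comp hu huI]
  exact mul_nonneg hm.deriv_nonneg (hγ.nonneg _ (huI t) x)

lemma smoothTransition_mem_Icc (t : ℝ) : Real.smoothTransition t ∈ Icc (0 : ℝ) 1 :=
  ⟨Real.smoothTransition.nonneg t, Real.smoothTransition.le_one t⟩

lemma exists_smoothTransition_eq {r : ℝ} (hr : r ∈ Icc (0 : ℝ) 1) :
    ∃ t, Real.smoothTransition t = r := by
  have := intermediate_value_Icc (zero_le_one' ℝ) Real.smoothTransition.continuous.continuousOn
  rw [Real.smoothTransition.zero, Real.smoothTransition.one] at this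
  obtain ⟨t, -, ht⟩ := this hr
  exact ⟨t, ht⟩

/-- Nonnegative paths can be chosen to be defined and nonnegative for all times. -/
lemma IsNonnegPath.exists_smooth (hγ : IsNonnegPath ξ α φ ψ γ) (hφ : φ ∈ Cont₀ ξ) :
    ∃ Γ, IsSmoothIsotopy ξ Γ ∧ (∀ t ≤ 0, Γ t = φ) ∧ (∀ t, 1 ≤ t → Γ t = ψ) ∧
      ∀ t x, 0 ≤ ham α Γ t x := by
  refine ⟨_, hγ.isSmoothIsotopy_comp hφ Real.smoothTransition.contDiff smoothTransition_mem_Icc,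
    fun t ht ↦ ?_, fun t ht ↦ ?_, hγ.ham_comp_nonneg Real.smoothTransition.contDiff
      smoothTransition_mem_Icc Real.smoothTransition.monotone⟩
  · rw [Real.smoothTransition.zero_of_nonpos ht, hγ.source]
  · rw [Real.smoothTransition.one_of_one_le ht, hγ.target]

/-- If every nonnegative loop at the identity is constant, the group is orderable. -/
theorem IsContactForm.orderable_of_loops [T2Space M] (hα : IsContactForm ξ α)
    (h : ∀ γ : ℝ → Equiv.Perm M, IsNonnegPath ξ α 1 1 γ → ∀ t ∈ Icc (0 : ℝ) 1, γ t = 1) :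
    Orderable ξ α := by
  refine { refl := fun φ ↦ ?_, trans := ?_, antisymm := ?_ }
  · exact ⟨_, (IsSmoothIsotopy.const φ.2).isNonnegPath rfl rfl fun t _ x ↦ (ham_const _ t x).ge⟩
  · rintro φ ψ χ ⟨γ, hγ⟩ ⟨δ, hδ⟩
    obtain ⟨Γ, hΓ, hΓ0, hΓ1, hΓn⟩ := hγ.exists_smooth φ.2
    obtain ⟨Δ, hΔ, hΔ0, hΔ1, hΔn⟩ := hδ.exists_smooth ψ.2
    -- The path `Δ t * ψ⁻¹ * Γ t` from `φ` to `χ` replaces concatenation, so there is no junction to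
    -- smooth.
    have hΔ' := hΔ.mul (.const (inv_mem ψ.2))
    refine ⟨_, (hΔ'.mul hΓ).isNonnegPath ?_ ?_ fun t _ x ↦ ?_⟩
    · simp [hΓ0, hΔ0]
    · simp [hΓ1, hΔ1]
    · obtain ⟨l, hl, h⟩ := hα.ham_mul hΔ' hΓ t x
      rw [h, ham_mul_const]
      exact add_nonneg (hΔn _ _) (mul_nonneg hl.le (hΓn _ _))
  · rintro φ ψ ⟨γ, hγ⟩ ⟨δ, hδ⟩
    obtain ⟨Γ, hΓ, hΓ0, hΓ1, hΓn⟩ := hγ.exists_smooth φ.2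
    obtain ⟨Δ, hΔ, hΔ0, hΔ1, hΔn⟩ := hδ.exists_smooth ψ.2
    have hΔ' := hΔ.mul (.const (inv_mem ψ.2))
    have hΛ := hΔ'.mul hΓ
    set Λ : ℝ → Equiv.Perm M := fun t ↦ (Δ t * (ψ : Equiv.Perm M)⁻¹) * Γ t with hΛdef
    have hsum : ∀ t x, ∃ l : ℝ, 0 < l ∧
        ham α Λ t x = ham α Δ t ((ψ : Equiv.Perm M)⁻¹ (Γ t x)) + l * ham α Γ t x := fun t x ↦
      hα.ham_mul hΔ' hΓ t x
    have hΛn : ∀ t x, 0 ≤ ham α Λ t x := fun t x ↦ by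
      obtain ⟨l, hl, h⟩ := hsum t x
      rw [h]
      exact add_nonneg (hΔn _ _) (mul_nonneg hl.le (hΓn _ _))
    have hloop : IsNonnegPath ξ α 1 1 (fun t ↦ Λ t * (φ : Equiv.Perm M)⁻¹) :=
      (hΛ.mul (.const (inv_mem φ.2))).isNonnegPath (by simp [hΛdef, hΓ0, hΔ0])
        (by simp [hΛdef, hΓ1, hΔ1]) fun t _ x ↦ hΛn t _
    -- Constancy is needed for all times, since derivatives at the ends of `[0, 1]` are two-sided;
    -- outside the interval both factors are stationary.
    have hΛc : ∀ t, Λ t = φ := by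
      intro t
      rcases le_total t 0 with ht | ht
      · simp [hΛdef, hΓ0 t ht, hΔ0 t ht]
      rcases le_total 1 t with ht' | ht'
      · simp [hΛdef, hΓ1 t ht', hΔ1 t ht']
      · exact mul_inv_eq_one.1 (h _ hloop t ⟨ht, ht'⟩)
    have hΓz : ∀ t x, ham α Γ t x = 0 := by
      intro t x
      obtain ⟨l, hl, h⟩ := hsum t x
      rw [show Λ = fun _ ↦ (φ : Equiv.Perm M) from funext hΛc, ham_const] at h
      have h1 := hΔn t ((ψ : Equiv.Perm M)⁻¹ (Γ t x))
      have h2 := mul_nonneg hl.le (hΓn t x)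
      exact (mul_eq_zero.1 (by linarith : l * ham α Γ t x = 0)).resolve_left hl.ne'
    have := hα.eq_of_ham_eq_zero hΓ hΓz 0 1
    rw [hΓ0 0 le_rfl, hΓ1 1 le_rfl] at this
    exact Subtype.ext this

/-- In the orderable case every nonnegative loop at the identity is constant. -/
theorem Orderable.loop_eq_one (ho : Orderable ξ α) (hγ : IsNonnegPath ξ α 1 1 γ) {s : ℝ}
    (hs : s ∈ Icc (0 : ℝ) 1) : γ s = 1 := by
  have hmem : γ s ∈ Cont₀ ξ := hγ.isotopy.mem_cont₀ (hγ.source ▸ one_mem _) hs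
  have hT := fun t ↦ smoothTransition_mem_Icc t
  -- The piece of the loop over `[0, s]`; the piece over `[s, 1]` gives the opposite relation `h2`.
  have h1 : NonnegRel ξ α 1 ⟨γ s, hmem⟩ := by
    have hu : ContDiff ℝ ∞ (fun t ↦ s * Real.smoothTransition t) :=
      contDiff_const.mul Real.smoothTransition.contDiff
    have huI : ∀ t, s * Real.smoothTransition t ∈ Icc (0 : ℝ) 1 := fun t ↦
      ⟨mul_nonneg hs.1 (hT t).1, mul_le_one₀ hs.2 (hT t).1 (hT t).2⟩
    refine ⟨_, (hγ.isSmoothIsotopy_comp (one_mem _) hu huI).isNonnegPath ?_ ?_ fun t _ ↦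
      hγ.ham_comp_nonneg hu huI (Real.smoothTransition.monotone.const_mul hs.1) t⟩
    · simp [hγ.source]
    · simp
  have h2 : NonnegRel ξ α ⟨γ s, hmem⟩ 1 := by
    have hu : ContDiff ℝ ∞ (fun t ↦ s + (1 - s) * Real.smoothTransition t) :=
      contDiff_const.add (contDiff_const.mul Real.smoothTransition.contDiff)
    have huI : ∀ t, s + (1 - s) * Real.smoothTransition t ∈ Icc (0 : ℝ) 1 := fun t ↦
      ⟨add_nonneg hs.1 (mul_nonneg (sub_nonneg.2 hs.2) (hT t).1), by
        nlinarith [(hT t).2, (hT t).1, hs.2, hs.1,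
          mul_nonneg (sub_nonneg.2 hs.2) (sub_nonneg.2 (hT t).2)]⟩
    refine ⟨_, (hγ.isSmoothIsotopy_comp (one_mem _) hu huI).isNonnegPath ?_ ?_ fun t _ ↦
      hγ.ham_comp_nonneg hu huI
        ((Real.smoothTransition.monotone.const_mul (sub_nonneg.2 hs.2)).const_add s) t⟩
    · simp
    · simp [hγ.target]
  exact congrArg Subtype.val (IsPartialOrder.toAntisymm (self := ho) |>.antisymm _ _ h2 h1)

/-- Positive loops are not constant. -/
lemma not_isPosPath_of_loops [Nonempty M]
    (h : ∀ γ : ℝ → Equiv.Perm M, IsNonnegPath ξ α 1 1 γ → ∀ t ∈ Icc (0 : ℝ) 1, γ t = 1) :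
    ¬ ∃ γ, IsPosPath ξ α 1 1 γ := by
  rintro ⟨γ, hγ⟩
  have hn : IsNonnegPath ξ α 1 1 γ :=
    ⟨hγ.isotopy, hγ.source, hγ.target, fun t ht x ↦ (hγ.pos t ht x).le⟩
  obtain ⟨x⟩ := ‹Nonempty M›
  have h0 : (0 : ℝ) ∈ Icc (0 : ℝ) 1 := by simp
  have hconst : mfderivWithin 𝓘(ℝ, ℝ) (𝓡 (2 * n + 1)) (fun s ↦ γ s x) (Icc 0 1) 0 =
      mfderivWithin 𝓘(ℝ, ℝ) (𝓡 (2 * n + 1)) (fun _ : ℝ ↦ x) (Icc 0 1) 0 :=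
    mfderivWithin_congr (fun s hs ↦ by rw [h γ hn s hs]; rfl) (by rw [h γ hn 0 h0]; rfl)
  have h1 : hamiltonian α γ 0 x = 0 :=
    (congrArg (fun L ↦ α (γ 0 x) (L (1 : ℝ)))
      (hconst.trans mfderivWithin_const)).trans (map_zero _)
  exact (hγ.pos 0 h0 x).ne' h1

end Orderability

/-! ### Continuity of the Hamiltonian and of its minimum. -/

section Continuity

variable {n : ℕ} {M : Type*} [TopologicalSpace M] [ChartedSpace (Model n) M]
  [IsManifold (𝓡 (2 * n + 1)) ∞ M] {α : OneForm n M} {ξ : Distribution n M}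
  {γ : ℝ → Equiv.Perm M}

/-- The Hamiltonian of an isotopy is continuous in time and space. -/
lemma SmoothOneForm.continuousOn_apply_mfderivWithin (hα : SmoothOneForm α) {s : Set ℝ}
    (hs : UniqueDiffOn ℝ s) (hγ : ContMDiffOn (𝓘(ℝ, ℝ).prod (𝓡 (2 * n + 1))) (𝓡 (2 * n + 1)) ∞
      (fun p : ℝ × M ↦ γ p.1 p.2) (s ×ˢ univ)) :
    ContinuousOn (fun p : ℝ × M ↦ α (γ p.1 p.2)
      (mfderivWithin 𝓘(ℝ, ℝ) (𝓡 (2 * n + 1)) (fun r : ℝ ↦ γ r p.2) s p.1 (1 : ℝ)))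
      (s ×ˢ univ) := by
  have : IsManifold (𝓡 (2 * n + 1)) 1 M := .of_le (n := ∞) (by simp)
  intro p₀ hp₀
  set z₀ := γ p₀.1 p₀.2 with hz₀
  have h1 : ContMDiffWithinAt (𝓘(ℝ, ℝ).prod (𝓡 (2 * n + 1))) 𝓘(ℝ, ℝ →L[ℝ] Model n) 0 _
      (s ×ˢ univ) p₀ := ContMDiffWithinAt.mfderivWithin (I' := 𝓡 (2 * n + 1)) (n := 1)
    (f := fun (p : ℝ × M) (r : ℝ) ↦ γ r p.2) (g := Prod.fst) (u := s) (t := s ×ˢ univ)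
    (((hγ (p₀.1, p₀.2) ⟨hp₀.1, mem_univ _⟩).of_le (by simp)).comp (p₀, p₀.1)
      (f := fun q : (ℝ × M) × ℝ ↦ (q.2, q.1.2))
      (contMDiff_snd.prodMk (contMDiff_snd.comp contMDiff_fst)).contMDiffAt.contMDiffWithinAt
      fun q hq ↦ ⟨hq.2, mem_univ _⟩)
    contMDiffWithinAt_fst hp₀ (fun p hp ↦ hp.1) (by simp) hs.uniqueMDiffOn
  have hcont : ContinuousWithinAt (fun p : ℝ × M ↦ γ p.1 p.2) (s ×ˢ univ) p₀ :=
    (hγ p₀ hp₀).continuousWithinAt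
  have hsrc : ∀ᶠ p in nhdsWithin p₀ (s ×ˢ univ), γ p.1 p.2 ∈ (chartAt (Model n) z₀).source :=
    hcont.eventually ((chartAt (Model n) z₀).open_source.mem_nhds (mem_chart_source _ _))
  have h2 : ContinuousWithinAt (fun p : ℝ × M ↦ α.inChart z₀
      (extChartAt (𝓡 (2 * n + 1)) z₀ (γ p.1 p.2))) (s ×ˢ univ) p₀ :=
    ContinuousAt.comp_continuousWithinAt (f := fun p : ℝ × M ↦ γ p.1 p.2)
      (g := fun z ↦ α.inChart z₀ (extChartAt (𝓡 (2 * n + 1)) z₀ z))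
      ((hα.contDiffAt_inChart z₀ (mem_extChartAt_target z₀)).continuousAt.comp
        (continuousAt_extChartAt z₀)) hcont
  have h3 := h2.clm_apply (h1.continuousWithinAt.clm_apply
    (continuousWithinAt_const (b := (1 : ℝ))))
  have key : ∀ p : ℝ × M, γ p.1 p.2 ∈ (chartAt (Model n) z₀).source →
      α (γ p.1 p.2) (mfderivWithin 𝓘(ℝ, ℝ) (𝓡 (2 * n + 1)) (fun r : ℝ ↦ γ r p.2) s p.1 (1 : ℝ)) =
        α.inChart z₀ (extChartAt (𝓡 (2 * n + 1)) z₀ (γ p.1 p.2))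
          (inTangentCoordinates 𝓘(ℝ, ℝ) (𝓡 (2 * n + 1)) Prod.fst (fun p : ℝ × M ↦ γ p.1 p.2)
            (fun p ↦ mfderivWithin 𝓘(ℝ, ℝ) (𝓡 (2 * n + 1)) (fun r : ℝ ↦ γ r p.2) s p.1) p₀ p
            (1 : ℝ)) := by
    intro p hp
    rw [← inChart_extChartAt α hp, ← chartDeriv_eq_continuousLinearMapAt hp]
    simp only [inTangentCoordinates, ContinuousLinearMap.inCoordinates,
      TangentBundle.symmL_model_space]
    rfl
  refine h3.congr_of_eventuallyEq ?_ (key p₀ (mem_chart_source _ _))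
  filter_upwards [hsrc] with p hp
  exact key p hp

lemma IsContactIsotopy.continuousOn_hamiltonian (hα : SmoothOneForm α)
    (hγ : IsContactIsotopy ξ γ) :
    ContinuousOn (fun p : ℝ × M ↦ hamiltonian α γ p.1 p.2) (Icc 0 1 ×ˢ univ) :=
  hα.continuousOn_apply_mfderivWithin (uniqueDiffOn_Icc zero_lt_one) hγ.smooth

lemma IsSmoothIsotopy.continuous_ham (hα : SmoothOneForm α) (hγ : IsSmoothIsotopy ξ γ) :
    Continuous (fun p : ℝ × M ↦ ham α γ p.1 p.2) := by
  have h := hα.continuousOn_apply_mfderivWithin (s := univ) uniqueDiffOn_univ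
    hγ.smooth.contMDiffOn
  rw [univ_prod_univ, continuousOn_univ] at h
  simp only [mfderivWithin_univ] at h
  exact h

/-- The minimum over a compact space of a jointly continuous function is continuous. -/
lemma continuousOn_iInf {X : Type*} [TopologicalSpace X] [CompactSpace X] [Nonempty X]
    {f : ℝ → X → ℝ} {s : Set ℝ}
    (hf : ContinuousOn (fun p : ℝ × X ↦ f p.1 p.2) (s ×ˢ univ)) :
    ContinuousOn (fun t ↦ ⨅ x, f t x) s := by
  have h : ContinuousOn (fun t ↦ sInf (f t '' univ)) s := by
    rw [continuousOn_iff_continuous_domRestrict]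
    refine isCompact_univ.continuous_sInf (f := fun (t : s) x ↦ f t x) ?_
    exact hf.comp_continuous ((continuous_subtype_val.comp continuous_fst).prodMk continuous_snd)
      fun p ↦ ⟨p.1.2, mem_univ _⟩
  simpa only [image_univ, sInf_range] using h

end Continuity

/-! ### From a nonconstant nonnegative loop to a positive loop. -/

section Loops

variable {n : ℕ} {M : Type*} [TopologicalSpace M] [ChartedSpace (Model n) M]
  [IsManifold (𝓡 (2 * n + 1)) ∞ M] {α : OneForm n M} {ξ : Distribution n M}
  {Γ Δ γ : ℝ → Equiv.Perm M} {φ : Equiv.Perm M}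

/-- A smooth nonnegative loop of contactomorphisms based at the identity, of period `1`. -/
structure IsNonnegLoop (ξ : Distribution n M) (α : OneForm n M) (Γ : ℝ → Equiv.Perm M) : Prop where
  isotopy : IsSmoothIsotopy ξ Γ
  zero : Γ 0 = 1
  periodic : ∀ t, Γ (t + 1) = Γ t
  nonneg : ∀ t x, 0 ≤ ham α Γ t x

namespace IsNonnegLoop

lemma one : IsNonnegLoop ξ α (fun _ ↦ 1) :=
  ⟨.const (one_mem _), rfl, fun _ ↦ rfl, fun t x ↦ (ham_const _ t x).ge⟩

lemma mul (hα : IsContactForm ξ α) (hΓ : IsNonnegLoop ξ α Γ) (hΔ : IsNonnegLoop ξ α Δ) :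
    IsNonnegLoop ξ α (fun t ↦ Γ t * Δ t) := by
  refine ⟨hΓ.isotopy.mul hΔ.isotopy, by simp [hΓ.zero, hΔ.zero],
    fun t ↦ by simp only [hΓ.periodic, hΔ.periodic], fun t x ↦ ?_⟩
  obtain ⟨l, hl, h⟩ := hα.ham_mul hΓ.isotopy hΔ.isotopy t x
  rw [h]
  exact add_nonneg (hΓ.nonneg _ _) (mul_nonneg hl.le (hΔ.nonneg _ _))

lemma conj (hα : IsContactForm ξ α) (hΓ : IsNonnegLoop ξ α Γ) (hφ : φ ∈ Cont₀ ξ) :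
    IsNonnegLoop ξ α (fun t ↦ φ * (Γ t * φ⁻¹)) := by
  refine ⟨(IsSmoothIsotopy.const hφ).mul (hΓ.isotopy.mul (.const (inv_mem hφ))),
    by simp [hΓ.zero], fun t ↦ by simp only [hΓ.periodic], fun t x ↦ ?_⟩
  obtain ⟨l, hl, h⟩ := hα.ham_const_mul hφ (hΓ.isotopy.mul (.const (inv_mem hφ))) t x
  rw [h]
  exact mul_nonneg hl.le (hΓ.nonneg _ _)

lemma ham_shift (hΓ : IsNonnegLoop ξ α Γ) (s t : ℝ) (x : M) :
    ham α (fun t ↦ Γ (t + s) * (Γ s)⁻¹) t x = ham α Γ (t + s) ((Γ s)⁻¹ x) := by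
  have h := hΓ.isotopy.ham_comp (α := α) (contDiff_id.add (contDiff_const (c := s))) t
    ((Γ s)⁻¹ x)
  have h1 : deriv (fun t : ℝ ↦ id t + s) t = 1 := by simp
  rw [h1, one_mul] at h
  exact h

/-- Restarting a loop at time `s` and renormalising it to begin at the identity moves behaviour at
time `s` to time `0`. -/
lemma shift (hΓ : IsNonnegLoop ξ α Γ) (s : ℝ) :
    IsNonnegLoop ξ α (fun t ↦ Γ (t + s) * (Γ s)⁻¹) := by
  refine ⟨(hΓ.isotopy.comp (contDiff_id.add contDiff_const)).mul
    (.const (inv_mem (hΓ.isotopy.mem s))), by simp, fun t ↦ ?_, fun t x ↦ ?_⟩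
  · rw [add_right_comm, hΓ.periodic]
  · rw [hΓ.ham_shift]
    exact hΓ.nonneg _ _

lemma periodic_ham (hΓ : IsNonnegLoop ξ α Γ) (x : M) :
    Function.Periodic (fun t ↦ ham α Γ t x) 1 := by
  intro t
  have h := hΓ.isotopy.ham_comp (α := α) (contDiff_id.add (contDiff_const (c := (1 : ℝ)))) t x
  have h1 : deriv (fun t : ℝ ↦ id t + 1) t = 1 := by simp
  rw [h1, one_mul] at h
  refine h.symm.trans (ham_congr (Filter.Eventually.of_forall fun s ↦ hΓ.periodic s) x)

/-- The shift by `t` makes the Hamiltonian positive at time `0` at the point `Γ t x`. Conjugation by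
a contactomorphism taking that point to `y` then carries the positivity to `y`. -/
lemma exists_ham_zero_pos_at [T2Space M] [CompactSpace M] [ConnectedSpace M]
    (hα : IsContactForm ξ α) (hΓ : IsNonnegLoop ξ α Γ)
    {t : ℝ} {x : M} (h : 0 < ham α Γ t x) (y : M) :
    ∃ Δ, IsNonnegLoop ξ α Δ ∧ 0 < ham α Δ 0 y := by
  obtain ⟨φ, hφ, rfl⟩ := hα.exists_cont₀_apply_eq (Γ t x) y
  refine ⟨_, (hΓ.shift t).conj hα hφ, ?_⟩
  obtain ⟨l, hl, h'⟩ := hα.ham_const_mul hφ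
    ((hΓ.shift t).isotopy.mul (.const (inv_mem hφ))) 0 (φ (Γ t x))
  rw [h', ham_mul_const, hΓ.ham_shift]
  refine mul_pos hl ?_
  simpa using h

/-- The existence of a nonconstant nonnegative loop implies that of a positive loop. -/
theorem exists_pos [T2Space M] [CompactSpace M] [ConnectedSpace M]
    (hα : IsContactForm ξ α) (hΓ : IsNonnegLoop ξ α Γ)
    {t : ℝ} {x : M} (h : 0 < ham α Γ t x) :
    ∃ Δ, IsNonnegLoop ξ α Δ ∧ ∀ t x, 0 < ham α Δ t x := by
  -- Products of loops handle unions of sets. At time `0` the second factor is the identity, so it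
  -- does not displace the set on which the first is positive.
  obtain ⟨Δ, hΔ, hΔ0⟩ : ∃ Δ, IsNonnegLoop ξ α Δ ∧ ∀ x ∈ (univ : Set M), 0 < ham α Δ 0 x := by
    refine isCompact_univ.induction_on (p := fun S ↦ ∃ Δ, IsNonnegLoop ξ α Δ ∧
      ∀ x ∈ S, 0 < ham α Δ 0 x) ⟨_, one, fun x hx ↦ hx.elim⟩ ?_ ?_ fun y _ ↦ ?_
    · rintro S T hST ⟨Δ, hΔ, h⟩
      exact ⟨Δ, hΔ, fun x hx ↦ h x (hST hx)⟩
    · rintro S T ⟨Δ, hΔ, hS⟩ ⟨Λ, hΛ, hT⟩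
      refine ⟨_, hΔ.mul hα hΛ, fun x hx ↦ ?_⟩
      obtain ⟨l, hl, h⟩ := hα.ham_mul hΔ.isotopy hΛ.isotopy 0 x
      rw [h, hΛ.zero]
      rcases hx with hx | hx
      · exact add_pos_of_pos_of_nonneg (hS x hx) (mul_nonneg hl.le (hΛ.nonneg _ _))
      · exact add_pos_of_nonneg_of_pos (hΔ.nonneg _ _) (mul_pos hl (hT x hx))
    · obtain ⟨Δ, hΔ, hy⟩ := hΓ.exists_ham_zero_pos_at hα h y
      have hc : Continuous fun x ↦ ham α Δ 0 x :=
        (hΔ.isotopy.continuous_ham hα.smooth).comp (continuous_const.prodMk continuous_id)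
      exact ⟨{x | 0 < ham α Δ 0 x}, mem_nhdsWithin_of_mem_nhds
        (hc.continuousAt.eventually (lt_mem_nhds hy)), Δ, hΔ, fun x hx ↦ hx⟩
  -- Positivity on all of `M` persists for times near `0`, and the shift by `-s` carries it to times
  -- near `s`. Displacement by the second factor is now harmless, because positivity holds on the
  -- whole of `M`.
  obtain ⟨Λ, hΛ, hΛp⟩ : ∃ Λ, IsNonnegLoop ξ α Λ ∧
      ∀ t ∈ Icc (0 : ℝ) 1, ∀ x, 0 < ham α Λ t x := by
    refine isCompact_Icc.induction_on (p := fun S ↦ ∃ Δ, IsNonnegLoop ξ α Δ ∧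
      ∀ t ∈ S, ∀ x, 0 < ham α Δ t x) ⟨_, one, fun x hx ↦ hx.elim⟩ ?_ ?_ fun s _ ↦ ?_
    · rintro S T hST ⟨Δ, hΔ, h⟩
      exact ⟨Δ, hΔ, fun x hx ↦ h x (hST hx)⟩
    · rintro S T ⟨Δ, hΔ, hS⟩ ⟨Λ, hΛ, hT⟩
      refine ⟨_, hΔ.mul hα hΛ, fun t ht x ↦ ?_⟩
      obtain ⟨l, hl, h⟩ := hα.ham_mul hΔ.isotopy hΛ.isotopy t x
      rw [h]
      rcases ht with ht | ht
      · exact add_pos_of_pos_of_nonneg (hS t ht _) (mul_nonneg hl.le (hΛ.nonneg _ _))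
      · exact add_pos_of_nonneg_of_pos (hΔ.nonneg _ _) (mul_pos hl (hT t ht _))
    · have hc := hΔ.isotopy.continuous_ham hα.smooth
      have hev : ∀ᶠ r in nhds (0 : ℝ), ∀ x ∈ (univ : Set M), 0 < ham α Δ r x :=
        isCompact_univ.eventually_forall_of_forall_eventually fun x hx ↦
          hc.continuousAt.eventually (lt_mem_nhds (hΔ0 x hx))
      have hev' : ∀ᶠ t in nhds s, ∀ x ∈ (univ : Set M), 0 < ham α Δ (t + -s) x := by
        have : Filter.Tendsto (fun t : ℝ ↦ t + -s) (nhds s) (nhds 0) :=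
          Continuous.tendsto' (by fun_prop) _ _ (add_neg_cancel s)
        exact this.eventually hev
      exact ⟨_, mem_nhdsWithin_of_mem_nhds hev', _, hΔ.shift (-s), fun t ht x ↦ by
        rw [hΔ.ham_shift]; exact ht _ (mem_univ _)⟩
  refine ⟨Λ, hΛ, fun t x ↦ ?_⟩
  obtain ⟨r, hr, h⟩ := (hΛ.periodic_ham x).exists_mem_Ico₀ zero_lt_one t
  exact h.symm ▸ hΛp r ⟨hr.1, hr.2.le⟩ x

end IsNonnegLoop

/-- A nonconstant nonnegative loop gives rise to a smooth periodic one. -/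
lemma IsNonnegPath.exists_isNonnegLoop [T2Space M] (hα : IsContactForm ξ α)
    (hγ : IsNonnegPath ξ α 1 1 γ) {r : ℝ} (hr : r ∈ Icc (0 : ℝ) 1) (hne : γ r ≠ 1) :
    ∃ Γ, IsNonnegLoop ξ α Γ ∧ ∃ t x, 0 < ham α Γ t x := by
  -- This profile is flat on `t ≤ 1/3` and on `t ≥ 2/3`, so the periodic extension rests at the
  -- identity around every integer and is smooth there.
  let v : ℝ → ℝ := fun t ↦ Real.smoothTransition (3 * t - 1)
  have hv : ContDiff ℝ ∞ v :=
    Real.smoothTransition.contDiff.comp ((contDiff_const.mul contDiff_id).sub contDiff_const)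
  have hv0 : ∀ t ≤ 1 / 3, v t = 0 := fun t ht ↦
    Real.smoothTransition.zero_of_nonpos (by linarith)
  have hv1 : ∀ t, 2 / 3 ≤ t → v t = 1 := fun t ht ↦
    Real.smoothTransition.one_of_one_le (by linarith)
  have hvm : Monotone v := Real.smoothTransition.monotone.comp
    fun a b hab ↦ by linarith
  let u : ℤ → ℝ → ℝ := fun k t ↦ v (t - k)
  have hu : ∀ k, ContDiff ℝ ∞ (u k) := fun k ↦ hv.comp (contDiff_id.sub contDiff_const)
  have huI : ∀ k t, u k t ∈ Icc (0 : ℝ) 1 := fun k t ↦ smoothTransition_mem_Icc _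
  have hum : ∀ k, Monotone (u k) := fun k ↦ hvm.comp fun a b hab ↦ by linarith
  have hΓk := fun k ↦ hγ.isSmoothIsotopy_comp (one_mem _) (hu k) (huI k)
  let Γ : ℝ → Equiv.Perm M := fun t ↦ γ (v (Int.fract t))
  have hloc : ∀ t : ℝ, ∀ᶠ s in nhds t, Γ s = γ (u ⌊t⌋ s) := by
    intro t
    have h1 : ∀ᶠ s in nhds t, (⌊t⌋ : ℝ) - 1 / 3 < s ∧ s < ⌊t⌋ + 1 :=
      (lt_mem_nhds (by linarith [Int.floor_le t])).and (gt_mem_nhds (Int.lt_floor_add_one t))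
    filter_upwards [h1] with s ⟨hs1, hs2⟩
    rcases le_or_gt (⌊t⌋ : ℝ) s with h | h
    · have : ⌊s⌋ = ⌊t⌋ := Int.floor_eq_iff.2 ⟨h, hs2⟩
      simp only [Γ, u, Int.fract, this]
    · have : ⌊s⌋ = ⌊t⌋ - 1 := Int.floor_eq_iff.2 (by push_cast; constructor <;> linarith)
      simp only [Γ, u, Int.fract, this]
      rw [hv1 _ (by push_cast; linarith), hv0 _ (by linarith), hγ.source, hγ.target]
  have hΓ : IsSmoothIsotopy ξ Γ := by
    refine ⟨fun p ↦ ?_, fun t ↦ ?_⟩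
    · refine ((hΓk ⌊p.1⌋).smooth p).congr_of_eventuallyEq ?_
      filter_upwards [continuousAt_fst.eventually (hloc p.1)] with q hq
      rw [hq]
    · rw [(hloc t).self_of_nhds]
      exact (hΓk _).mem t
  have hΓn : ∀ t x, 0 ≤ ham α Γ t x := fun t x ↦ by
    rw [ham_congr (hloc t)]
    exact hγ.ham_comp_nonneg (hu _) (huI _) (hum _) t x
  have hΓ0 : Γ 0 = 1 := by
    simp only [Γ, Int.fract_zero]
    rw [hv0 0 (by norm_num), hγ.source]
  refine ⟨Γ, ⟨hΓ, hΓ0, fun t ↦ by simp only [Γ, Int.fract_add_one], hΓn⟩, ?_⟩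
  -- If the Hamiltonian vanished identically, `Γ` would be constant, although it takes the value `γ
  -- r ≠ 1` at time `(t + 1) / 3`.
  by_contra! hcon
  obtain ⟨t, ht⟩ := exists_smoothTransition_eq hr
  have hvt : v ((t + 1) / 3) = r := by
    simp only [v]
    rw [← ht]
    congr 1
    ring
  have hne0 : ¬ (t + 1) / 3 ≤ 0 := fun hle ↦ hne (by
    rw [← hvt, hv0 _ (by linarith), hγ.source])
  have hne1 : ¬ 1 ≤ (t + 1) / 3 := fun hle ↦ hne (by
    rw [← hvt, hv1 _ (by linarith), hγ.target])
  have hfr : Int.fract ((t + 1) / 3) = (t + 1) / 3 :=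
    Int.fract_eq_self.2 ⟨(not_le.1 hne0).le, not_le.1 hne1⟩
  have h1 := hα.eq_of_ham_eq_zero hΓ (fun t x ↦ (hcon t x).antisymm (hΓn t x)) ((t + 1) / 3) 0
  rw [hΓ0] at h1
  simp only [Γ, hfr, hvt] at h1
  exact hne h1

end Loops

/-! ### The Reeb flow and bounds for the Lorentzian distance. -/

section LorentzDistance

variable {n : ℕ} {M : Type*} [TopologicalSpace M] [ChartedSpace (Model n) M]
  [IsManifold (𝓡 (2 * n + 1)) ∞ M] {α : OneForm n M} {ξ : Distribution n M}
  {Γ Δ γ δ θ : ℝ → Equiv.Perm M} {φ ψ : Equiv.Perm M}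

/-- The Reeb flow of a contact form on a compact manifold. -/
theorem IsContactForm.exists_reebFlow [T2Space M] [CompactSpace M] (hα : IsContactForm ξ α) :
    ∃ R : (x : M) → TangentSpace (𝓡 (2 * n + 1)) x,
      (∀ x, α x (R x) = 1 ∧ ∀ v, α.d x (R x) v = 0) ∧
      ContMDiff (𝓡 (2 * n + 1)) (𝓡 (2 * n + 1)).tangent ∞
        (fun x ↦ (⟨x, R x⟩ : TangentBundle (𝓡 (2 * n + 1)) M)) ∧
      ∃ θ : ℝ → Equiv.Perm M, IsSmoothIsotopy ξ θ ∧ θ 0 = 1 ∧ (∀ s t, θ (s + t) = θ s * θ t) ∧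
        (∀ x, IsMIntegralCurve (I := 𝓡 (2 * n + 1)) (fun t ↦ θ t x) R) ∧
        (∀ t x, ham α θ t x = 1) ∧
        ∀ t x v, α (θ t x) (mfderiv (𝓡 (2 * n + 1)) (𝓡 (2 * n + 1)) (θ t) x v) = α x v := by
  obtain ⟨R, hR, hRs⟩ := hα.exists_reeb
  refine ⟨R, hR, hRs, ?_⟩
  obtain ⟨θ, h0, hadd, hθ, hint, hmem, hpull⟩ := hα.exists_flow (k := fun _ ↦ 0)
    continuous_const hRs fun x u ↦ by
      have h1 : (fun y ↦ α y (R y)) = fun _ ↦ (1 : ℝ) := funext fun y ↦ (hR y).1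
      have h2 : differential (n := n) (fun _ : M ↦ (1 : ℝ)) x = 0 := mfderiv_const
      rw [h1, h2, (hR x).2, zero_mul, zero_add]
      rfl
  refine ⟨θ, ⟨hθ, hmem⟩, h0, hadd, hint, fun t x ↦ ?_, fun t x v ↦ ?_⟩
  · rw [ham, vderiv_eq_of_isMIntegralCurve (hint x), (hR _).1]
  · rw [hpull]
    simp

/-- The conformal factor is `1` because `θ` preserves `α`. Hence a reparametrised Reeb flow can add
or remove a prescribed amount of Hamiltonian, the same at all points of `M`. -/
lemma IsSmoothIsotopy.ham_mul_of_preserves (hθ : IsSmoothIsotopy ξ θ)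
    (hham : ∀ t x, ham α θ t x = 1)
    (hpull : ∀ t x v, α (θ t x) (mfderiv (𝓡 (2 * n + 1)) (𝓡 (2 * n + 1)) (θ t) x v) = α x v)
    (hΓ : IsSmoothIsotopy ξ Γ) {u : ℝ → ℝ} (hu : ContDiff ℝ ∞ u) (t : ℝ) (x : M) :
    ham α (fun t ↦ θ (u t) * Γ t) t x = deriv u t + ham α Γ t x := by
  rw [(hθ.comp hu).ham_mul hΓ, hθ.ham_comp hu, hham, mul_one]
  exact congrArg _ (hpull _ _ _)

lemma IsContactIsotopy.continuousOn_iInf_hamiltonian [CompactSpace M] [Nonempty M]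
    (hα : SmoothOneForm α) (hγ : IsContactIsotopy ξ γ) :
    ContinuousOn (fun t ↦ ⨅ x, hamiltonian α γ t x) (Icc 0 1) :=
  continuousOn_iInf (hγ.continuousOn_hamiltonian hα)

lemma IsContactIsotopy.intervalIntegrable_iInf_hamiltonian [CompactSpace M] [Nonempty M]
    (hα : SmoothOneForm α) (hγ : IsContactIsotopy ξ γ) :
    IntervalIntegrable (fun t ↦ ⨅ x, hamiltonian α γ t x) MeasureTheory.volume 0 1 :=
  ContinuousOn.intervalIntegrable (by
    rw [uIcc_of_le zero_le_one]; exact hγ.continuousOn_iInf_hamiltonian hα)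

lemma IsSmoothIsotopy.le_lorentzLength [CompactSpace M] [Nonempty M] (hα : SmoothOneForm α)
    (hΓ : IsSmoothIsotopy ξ Γ) {c : ℝ} (h : ∀ t ∈ Icc (0 : ℝ) 1, ∀ x, c ≤ ham α Γ t x) :
    c ≤ lorentzLength α Γ := by
  have h1 : ∫ _ in (0 : ℝ)..1, c = c := by simp
  rw [← h1]
  refine intervalIntegral.integral_mono_on zero_le_one (by simp)
    (hΓ.isContactIsotopy.intervalIntegrable_iInf_hamiltonian hα) fun t ht ↦ le_ciInf fun x ↦ ?_
  rw [hΓ.hamiltonian_eq ht]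
  exact h t ht x

lemma IsNonnegPath.ofReal_lorentzLength_le {φ ψ : Cont₀ ξ} (hγ : IsNonnegPath ξ α φ ψ γ) :
    ENNReal.ofReal (lorentzLength α γ) ≤ lorentzDist ξ α φ ψ := by
  rw [lorentzDist, if_pos ⟨γ, hγ⟩]
  exact le_iSup₂ (f := fun (γ : ℝ → Equiv.Perm M)
    (_ : γ ∈ {γ : ℝ → Equiv.Perm M | IsNonnegPath ξ α φ ψ γ}) ↦
      ENNReal.ofReal (lorentzLength α γ)) γ hγ

/-- Every continuous function on `[0, 1]` has a smooth approximate primitive from below. -/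
lemma exists_smooth_primitive_le {m : ℝ → ℝ} (hm : ContinuousOn m (Icc 0 1)) {C : ℝ}
    (hC : C < ∫ t in (0 : ℝ)..1, m t) :
    ∃ σ : ℝ → ℝ, ContDiff ℝ ∞ σ ∧ σ 0 = 0 ∧ C < σ 1 ∧ ∀ t ∈ Icc (0 : ℝ) 1, deriv σ t ≤ m t := by
  -- A polynomial within `ε` of `m - ε` lies between `m - 2 * ε` and `m`, so its integral loses at
  -- most half of the gap `4 * ε` above `C`.
  set ε := ((∫ t in (0 : ℝ)..1, m t) - C) / 4 with hε
  have hεp : 0 < ε := by rw [hε]; linarith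
  obtain ⟨p, hp⟩ := exists_polynomial_near_of_continuousOn 0 1 (fun t ↦ m t - ε)
    (hm.sub continuousOn_const) ε hεp
  have hd : ∀ t, HasDerivAt (fun t ↦ ∫ s in (0 : ℝ)..t, p.eval s) (p.eval t) t := fun t ↦
    (p.continuous.integral_hasStrictDerivAt 0 t).hasDerivAt
  have hmi : IntervalIntegrable m MeasureTheory.volume 0 1 :=
    ContinuousOn.intervalIntegrable (by rwa [uIcc_of_le zero_le_one])
  refine ⟨fun t ↦ ∫ s in (0 : ℝ)..t, p.eval s, ?_, by simp, ?_, fun t ht ↦ ?_⟩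
  · rw [contDiff_infty_iff_deriv]
    refine ⟨fun t ↦ (hd t).differentiableAt, ?_⟩
    rw [show deriv (fun t ↦ ∫ s in (0 : ℝ)..t, p.eval s) = fun t ↦ p.eval t from
      funext fun t ↦ (hd t).deriv]
    simpa using p.contDiff_aeval (𝕜 := ℝ) (R := ℝ) ∞
  · have h1 : ∫ t in (0 : ℝ)..1, (m t - 2 * ε) ≤ ∫ t in (0 : ℝ)..1, p.eval t := by
      refine intervalIntegral.integral_mono_on zero_le_one (hmi.sub (by simp))
        (p.continuous.intervalIntegrable _ _) fun t ht ↦ ?_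
      have := (abs_lt.1 (hp t ht)).1
      linarith
    rw [intervalIntegral.integral_sub hmi (by simp), intervalIntegral.integral_const] at h1
    simp only [sub_zero, smul_eq_mul, one_mul] at h1
    linarith
  · rw [(hd t).deriv]
    have := (abs_lt.1 (hp t ht)).2
    linarith

/-- In the orderable case, the length of a nonnegative path is bounded by the Hamiltonian of any
path joining its endpoints in the opposite direction. -/
theorem Orderable.lorentzLength_le [T2Space M] [CompactSpace M] [Nonempty M]
    (ho : Orderable ξ α) (hα : IsContactForm ξ α) (hφ : φ ∈ Cont₀ ξ)
    (hγ : IsNonnegPath ξ α φ ψ γ) (hδ : IsSmoothIsotopy ξ δ) (hδ0 : δ 0 = ψ) (hδ1 : δ 1 = φ)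
    {C : ℝ} (hC : ∀ t ∈ Icc (0 : ℝ) 1, ∀ x, -C ≤ ham α δ t x) :
    lorentzLength α γ ≤ C := by
  obtain ⟨R, -, -, θ, hθ, hθ0, hadd, -, hham, hpull⟩ := hα.exists_reebFlow
  by_contra! hlt
  -- The minimum of the Hamiltonian is only known to be continuous in time, so its primitive is
  -- replaced by a smooth `σ` that grows no faster and still ends above `C`.
  obtain ⟨σ, hσ, hσ0, hσ1, hσm⟩ := exists_smooth_primitive_le
    (hγ.isotopy.continuousOn_iInf_hamiltonian hα.smooth) hlt
  have hψ : ψ ∈ Cont₀ ξ := hδ0 ▸ hδ.mem 0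
  have hT := Real.smoothTransition.contDiff (n := ⊤)
  have hΓ := hγ.isSmoothIsotopy_comp hφ hT smoothTransition_mem_Icc
  have hu : ContDiff ℝ ∞ (fun t ↦ -σ (Real.smoothTransition t)) := (hσ.comp hT).neg
  have hθS : θ (-σ 1) ∈ Cont₀ ξ := hθ.mem _
  have hrel1 : NonnegRel ξ α ⟨φ, hφ⟩ ⟨θ (-σ 1) * ψ, mul_mem hθS hψ⟩ := by
    refine ⟨_, ((hθ.comp hu).mul hΓ).isNonnegPath ?_ ?_ fun t _ x ↦ ?_⟩
    · simp [hσ0, hθ0, hγ.source]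
    · simp [hγ.target]
    · rw [hθ.ham_mul_of_preserves hham hpull hΓ hu, hγ.isotopy.ham_comp hT smoothTransition_mem_Icc]
      have h1 : deriv (fun t ↦ -σ (Real.smoothTransition t)) t =
          -(deriv σ (Real.smoothTransition t) * deriv Real.smoothTransition t) := by
        have h2 := ((hσ.differentiable (by simp) (Real.smoothTransition t)).hasDerivAt).comp t
          ((hT.differentiable (by simp) t).hasDerivAt)
        exact h2.neg.deriv
      have h3 : deriv σ (Real.smoothTransition t) ≤
          hamiltonian α γ (Real.smoothTransition t) x :=
        (hσm _ (smoothTransition_mem_Icc t)).trans (ciInf_le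
          ⟨0, by rintro _ ⟨y, rfl⟩; exact hγ.nonneg _ (smoothTransition_mem_Icc t) y⟩ x)
      have h4 : 0 ≤ deriv Real.smoothTransition t := Real.smoothTransition.monotone.deriv_nonneg
      rw [h1]
      nlinarith
  -- The way back: forward Reeb flow at constant speed `σ 1 > C` outweighs the Hamiltonian of `δ`,
  -- which is at least `-C`.
  have hw : ContDiff ℝ ∞ (fun t ↦ σ 1 * t + -σ 1) :=
    (contDiff_const.mul contDiff_id).add contDiff_const
  have hΛ := (hθ.comp hw).mul hδ
  have hpos : ∀ t ∈ Icc (0 : ℝ) 1, ∀ x, 0 < ham α (fun t ↦ θ (σ 1 * t + -σ 1) * δ t) t x := by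
    intro t ht x
    rw [hθ.ham_mul_of_preserves hham hpull hδ hw]
    have h1 : deriv (fun t ↦ σ 1 * t + -σ 1) t = σ 1 := by simp
    rw [h1]
    linarith [hC t ht x]
  have hrel2 : NonnegRel ξ α ⟨θ (-σ 1) * ψ, mul_mem hθS hψ⟩ ⟨φ, hφ⟩ :=
    ⟨_, hΛ.isNonnegPath (by simp [hδ0]) (by simp [hδ1, hθ0]) fun t ht x ↦ (hpos t ht x).le⟩
  -- Antisymmetry identifies the two ends of the positive way back, so right translation by `φ⁻¹`
  -- makes it a positive loop at the identity.
  have heq : φ = θ (-σ 1) * ψ :=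
    congrArg Subtype.val (IsPartialOrder.toAntisymm (self := ho) |>.antisymm _ _ hrel1 hrel2)
  have hΛ' := hΛ.mul (.const (inv_mem hφ))
  refine not_isPosPath_of_loops (fun γ hγ t ht ↦ ho.loop_eq_one hγ ht)
    ⟨_, hΛ'.isContactIsotopy, ?_, ?_, fun t ht x ↦ ?_⟩
  · simp [hδ0, ← heq]
  · simp [hδ1, hθ0]
  · rw [hΛ'.hamiltonian_eq ht]
    exact hpos t ht _

/-- Any two elements of the identity component are joined by a smooth isotopy. -/
lemma exists_isSmoothIsotopy (hφ : φ ∈ Cont₀ ξ) (hψ : ψ ∈ Cont₀ ξ) :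
    ∃ Γ, IsSmoothIsotopy ξ Γ ∧ Γ 0 = φ ∧ Γ 1 = ψ := by
  obtain ⟨γ, hγ, h0, h1⟩ := mul_mem hψ (inv_mem hφ)
  refine ⟨_, (hγ.isSmoothIsotopy_comp (h0 ▸ one_mem _) Real.smoothTransition.contDiff
    smoothTransition_mem_Icc).mul (.const hφ), ?_, ?_⟩
  · simp [h0]
  · simp [h1]

/-- One fixed isotopy from `ψ` back to `φ` has Hamiltonian bounded below by compactness, and this
bounds the lengths of all nonnegative paths from `φ` to `ψ` at once. -/
theorem Orderable.lorentzDist_lt_top [T2Space M] [CompactSpace M] [Nonempty M]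
    (ho : Orderable ξ α) (hα : IsContactForm ξ α) (φ ψ : Cont₀ ξ) :
    lorentzDist ξ α φ ψ < ⊤ := by
  obtain ⟨δ, hδ, hδ0, hδ1⟩ := exists_isSmoothIsotopy ψ.2 φ.2
  obtain ⟨C, hC⟩ := ((isCompact_Icc (a := (0 : ℝ)) (b := 1)).prod
    (isCompact_univ (X := M))).bddBelow_image (hδ.continuous_ham hα.smooth).continuousOn
  rw [lorentzDist]
  split_ifs with h
  · refine lt_of_le_of_lt (iSup₂_le fun γ hγ ↦ ENNReal.ofReal_le_ofReal
      (ho.lorentzLength_le hα φ.2 hγ hδ hδ0 hδ1 (C := -C) fun t ht x ↦ ?_)) ENNReal.ofReal_lt_top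
    rw [neg_neg]
    exact hC ⟨(t, x), ⟨ht, mem_univ _⟩, rfl⟩
  · exact ENNReal.zero_lt_top

/-- A positive loop makes the Lorentzian distance infinite. -/
lemma IsNonnegLoop.lorentzDist_eq_top [CompactSpace M] [Nonempty M] (hα : SmoothOneForm α)
    (hΓ : IsNonnegLoop ξ α Γ) (hpos : ∀ t x, 0 < ham α Γ t x) : lorentzDist ξ α 1 1 = ⊤ := by
  obtain ⟨⟨t₀, x₀⟩, -, hmin⟩ := ((isCompact_Icc (a := (0 : ℝ)) (b := 1)).prod
    (isCompact_univ (X := M))).exists_isMinOn ⟨(0, Classical.arbitrary M), by simp⟩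
    (hΓ.isotopy.continuous_ham hα).continuousOn
  have hle : ∀ t x, ham α Γ t₀ x₀ ≤ ham α Γ t x := fun t x ↦ by
    obtain ⟨r, hr, h⟩ := (hΓ.periodic_ham x).exists_mem_Ico₀ zero_lt_one t
    exact h.symm ▸ hmin (show ((r, x) : ℝ × M) ∈ _ from ⟨⟨hr.1, hr.2.le⟩, mem_univ _⟩)
  refine ENNReal.eq_top_of_forall_nnreal_le fun C ↦ ?_
  -- Traversing the loop `k` times within unit time multiplies its Hamiltonian by `k`, so every `C`
  -- is reached.
  obtain ⟨k, hk⟩ := exists_nat_ge ((C : ℝ) / ham α Γ t₀ x₀)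
  rw [div_le_iff₀ (hpos _ _)] at hk
  have hu : ContDiff ℝ ∞ (fun t : ℝ ↦ (k : ℝ) * t) := contDiff_const.mul contDiff_id
  have hham : ∀ t x, (C : ℝ) ≤ ham α (fun t ↦ Γ (k * t)) t x := fun t x ↦ by
    rw [hΓ.isotopy.ham_comp hu]
    have h1 : deriv (fun t : ℝ ↦ (k : ℝ) * t) t = k := by simp
    rw [h1]
    exact hk.trans (mul_le_mul_of_nonneg_left (hle _ _) k.cast_nonneg)
  have hk1 : Γ k = 1 := by
    have : Function.Periodic Γ 1 := hΓ.periodic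
    have h := this.nat_mul_eq k
    rwa [mul_one, hΓ.zero] at h
  have hpath : IsNonnegPath ξ α ((1 : Cont₀ ξ) : Equiv.Perm M) ((1 : Cont₀ ξ) : Equiv.Perm M)
      (fun t ↦ Γ (k * t)) :=
    (hΓ.isotopy.comp hu).isNonnegPath (by simp [hΓ.zero]) (by simp [hk1])
      fun t _ x ↦ C.coe_nonneg.trans (hham t x)
  refine le_trans ?_ hpath.ofReal_lorentzLength_le
  rw [← ENNReal.ofReal_coe_nnreal]
  exact ENNReal.ofReal_le_ofReal ((hΓ.isotopy.comp hu).le_lorentzLength hα fun t _ x ↦ hham t x)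

/-- If the group is not orderable, there is a positive loop. -/
theorem IsContactForm.exists_pos_loop [T2Space M] [CompactSpace M] [ConnectedSpace M]
    (hα : IsContactForm ξ α) (h : ¬ Orderable ξ α) :
    ∃ Γ, IsNonnegLoop ξ α Γ ∧ ∀ t x, 0 < ham α Γ t x := by
  have h1 := mt hα.orderable_of_loops h
  push Not at h1
  obtain ⟨γ, hγ, t, ht, hne⟩ := h1
  obtain ⟨Γ, hΓ, s, x, hpos⟩ := hγ.exists_isNonnegLoop hα ht hne
  exact hΓ.exists_pos hα hpos

lemma IsNonnegLoop.isPosPath (hΓ : IsNonnegLoop ξ α Γ) (hpos : ∀ t x, 0 < ham α Γ t x) :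
    IsPosPath ξ α 1 1 Γ :=
  ⟨hΓ.isotopy.isContactIsotopy, hΓ.zero, by rw [← zero_add (1 : ℝ), hΓ.periodic, hΓ.zero],
    fun t ht x ↦ by rw [hΓ.isotopy.hamiltonian_eq ht]; exact hpos t x⟩

theorem IsContactForm.exists_isReebFlow [T2Space M] [CompactSpace M] (hα : IsContactForm ξ α) :
    ∃ θ : ℝ → Cont₀ ξ, IsReebFlow ξ α θ := by
  obtain ⟨R, hR, -, θ, hθ, hθ0, -, hint, -⟩ := hα.exists_reebFlow
  exact ⟨fun t ↦ ⟨θ t, hθ.mem t⟩, R, hR, Subtype.ext hθ0, hint⟩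

/-- In the orderable case the Reeb flow realises the Lorentzian distance. -/
theorem Orderable.lorentzDist_reebFlow [T2Space M] [CompactSpace M] [Nonempty M]
    (ho : Orderable ξ α) (hα : IsContactForm ξ α) {η : ℝ → Cont₀ ξ} (hη : IsReebFlow ξ α η)
    (φ : Cont₀ ξ) {t : ℝ} (ht : 0 ≤ t) :
    lorentzDist ξ α φ (η t * φ) = ENNReal.ofReal t := by
  have : IsManifold (𝓡 (2 * n + 1)) 1 M := .of_le (n := ∞) (by simp)
  obtain ⟨R, hR, hRs, θ, hθ, hθ0, -, hint, hham, hpull⟩ := hα.exists_reebFlow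
  obtain ⟨R', hR', hη0, hint'⟩ := hη
  obtain rfl : R' = R := funext fun x ↦ hα.reeb_unique (hR' x) (hR x)
  have hηθ : ∀ s, (η s : Equiv.Perm M) = θ s := fun s ↦ Equiv.ext fun x ↦
    congrFun (isMIntegralCurve_Ioo_eq_of_contMDiff_boundaryless (t₀ := 0)
      (hRs.of_le (m := 1) (by simp)) (hint' x) (hint x) (by rw [hη0, hθ0]; rfl)) s
  have hu : ContDiff ℝ ∞ (fun s : ℝ ↦ t * s) := contDiff_const.mul contDiff_id
  have hw : ContDiff ℝ ∞ (fun s : ℝ ↦ t - t * s) := contDiff_const.sub hu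
  have hpath := (hθ.comp hu).mul (.const φ.2)
  have hpathham : ∀ s x, ham α (fun s ↦ θ (t * s) * φ) s x = t := fun s x ↦ by
    rw [hθ.ham_mul_of_preserves hham hpull (.const φ.2) hu, ham_const]
    simp
  have hn : IsNonnegPath ξ α φ (η t * φ : Cont₀ ξ) (fun s ↦ θ (t * s) * φ) :=
    hpath.isNonnegPath (by simp [hθ0]) (by simp [hηθ]) fun s _ x ↦ by rw [hpathham]; exact ht
  refine le_antisymm ?_ ?_
  · rw [lorentzDist, if_pos ⟨_, hn⟩]
    -- The return path is the reversed Reeb path `s ↦ θ (t - t * s) * φ`, whose Hamiltonian is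
    -- constantly `-t`.
    refine iSup₂_le fun γ hγ ↦ ENNReal.ofReal_le_ofReal
      (ho.lorentzLength_le hα φ.2 hγ ((hθ.comp hw).mul (.const φ.2)) (by simp [hηθ])
        (by simp [hθ0]) fun s _ x ↦ ?_)
    rw [hθ.ham_mul_of_preserves hham hpull (.const φ.2) hw, ham_const]
    simp
  · exact (ENNReal.ofReal_le_ofReal (hpath.le_lorentzLength hα.smooth
      fun s _ x ↦ (hpathham s x).ge)).trans hn.ofReal_lorentzLength_le

end LorentzDistance

end ContactGeometry

/-! ### Assembly of the equivalences and of the Reeb flow statement. -/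

theorem mainTheorem3 {n : ℕ} {M : Type*} [TopologicalSpace M] [T2Space M] [CompactSpace M]
    [ConnectedSpace M] [ChartedSpace (ContactGeometry.Model n) M]
    [IsManifold (𝓡 (2 * n + 1)) ∞ M]
    (ξ : ContactGeometry.Distribution n M) (α : ContactGeometry.OneForm n M)
    (hα : ContactGeometry.IsContactForm ξ α) :
    -- orderability means that there are no non-constant non-negative loops
    (ContactGeometry.Orderable ξ α ↔
      ∀ γ : ℝ → Equiv.Perm M, ContactGeometry.IsNonnegPath ξ α 1 1 γ →
        ∀ t ∈ Icc (0 : ℝ) 1, γ t = 1) ∧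
    -- equivalently, that there are no positive loops
    (ContactGeometry.Orderable ξ α ↔
      ¬ ∃ γ : ℝ → Equiv.Perm M, ContactGeometry.IsPosPath ξ α 1 1 γ) ∧
    -- equivalently, that the Lorentzian distance function is finite
    (ContactGeometry.Orderable ξ α ↔
      ∀ φ ψ : ContactGeometry.Cont₀ ξ, ContactGeometry.lorentzDist ξ α φ ψ < ⊤) ∧
    -- the Reeb flow exists, and in the orderable case it realises the distance
    (∃ θ : ℝ → ContactGeometry.Cont₀ ξ, ContactGeometry.IsReebFlow ξ α θ) ∧
    (ContactGeometry.Orderable ξ α →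
      ∀ θ : ℝ → ContactGeometry.Cont₀ ξ, ContactGeometry.IsReebFlow ξ α θ →
        ∀ (φ : ContactGeometry.Cont₀ ξ) (t : ℝ), 0 ≤ t →
          ContactGeometry.lorentzDist ξ α φ (θ t * φ) = ENNReal.ofReal t) := by
  refine ⟨⟨fun h γ hγ t ht ↦ h.loop_eq_one hγ ht, hα.orderable_of_loops⟩, ⟨fun h ↦
    ContactGeometry.not_isPosPath_of_loops fun γ hγ t ht ↦ h.loop_eq_one hγ ht, fun h ↦ ?_⟩,
    ⟨fun h φ ψ ↦ h.lorentzDist_lt_top hα φ ψ, fun h ↦ ?_⟩, hα.exists_isReebFlow,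
    fun h θ hθ φ t ht ↦ h.lorentzDist_reebFlow hα hθ φ ht⟩
  · by_contra hn
    obtain ⟨Γ, hΓ, hpos⟩ := hα.exists_pos_loop hn
    exact h ⟨Γ, hΓ.isPosPath hpos⟩
  · by_contra hn
    obtain ⟨Γ, hΓ, hpos⟩ := hα.exists_pos_loop hn
    exact (h 1 1).ne (hΓ.lorentzDist_eq_top hα.smooth hpos)
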